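/- Let $S^3\subset\mathbb{R}^4\subset\mathbb{RP}^4$ be the unit sphere, $B^4$ the closed unit ball, and $C_6(S^3)$ the space of ordered 6-tuples of distinct points of $S^3$ (indices mod $6$). For $p\in\mathbb{RP}^4\setminus B^4$ let $T_p\subset S^3$ be the 2-sphere of points at which a line through $p$ is tangent to $S^3$; it divides $S^3$ into two sides. Let $M\subset C_6(S^3)$ be the set of all $(x_1,\dots,x_6)$ for which there is a point $p\in\mathbb{RP}^4\setminus B^4$ such that the lines $x_1x_4$, $x_2x_5$, $x_3x_6$ all pass through $p$, and $x_1,x_3,x_5$ lie on one side of $T_p$ and $x_2,x_4,x_6$ on the other. Let $M_0\subset M$ be the set of those 6-tuples in $M$ whose six points lie on a circle. A 6-tuple of points of $S^3$ is a *stereographic trefoil* if its points lie on a 2-sphere in $S^3$ and, under some stereographic projection $S^3\setminus\{N\}\to\mathbb{R}^3$, they are mapped to six points of a round sphere in $\mathbb{R}^3$ which, joined cyclically by line segments, form a trefoil knot (of either handedness). For every neighborhood $U$ of $M$ in $C_6(S^3)$ and every continuous function $\delta:M\to(0,\infty)$ there is a smooth isotopy $F_t:M\to C_6(S^3)$, $0\le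 t\le 1$, through proper smooth embeddings, with $F_0$ the inclusion, such that $F_t(x)\in U$ and $\max_i|F_t(x)_i-x_i|<\delta(x)$ for all $t\in[0,1]$ and $x\in M$, every $F_t$ fixes $M_0$ pointwise, and $M'=F_1(M)$ satisfies: 1. $M\cap M'=M_0$; 2. every point of $M'\setminus M_0$ is a stereographic trefoil; 3. for every $x\in M\setminus M_0$, with $p$ as above and $P$ the 2-sphere in which the affine span of $x_1,\dots,x_6$ meets $S^3$, the tuple $F_1(x)$ is obtained from $x$ by applying to $x_1,x_3,x_5$ a rotation of $\mathbb{R}^4$ that maps $P$ to itself, turning it about the axis of the circle $T_p\cap P$, and keeping $x_2,x_4,x_6$ fixed. -/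

import Mathlib

open Set Topology Module
open scoped ContDiff InnerProductSpace LinearAlgebra.Projectivization

noncomputable section

namespace InscribedTrefoil

/-- Euclidean space `ℝⁿ`. -/
abbrev E (n : ℕ) : Type := EuclideanSpace ℝ (Fin n)

/-- Ordered 6-tuples of points of `ℝ⁴`, indexed cyclically by `Fin 6 = ℤ/6`. -/
abbrev Tuple : Type := Fin 6 → E 4

/-- The unit sphere `S³ ⊆ ℝ⁴`. -/
abbrev S3 : Set (E 4) := Metric.sphere 0 1

/-- The labelled configuration space `C₆(S³)`. -/
def C6 : Set Tuple := {x | (∀ i, x i ∈ S3) ∧ Function.Injective x}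

/-! ### The manifold `M` -/

/-- Real projective 4-space, containing `ℝ⁴` through `y ↦ [y : 1]`. -/
abbrev RP4 : Type := ℙ ℝ (E 4 × ℝ)

/-- The closed unit ball `B⁴ ⊆ ℝ⁴ ⊆ ℝP⁴`; its boundary is `S³`. -/
def B4 : Set RP4 := {p | ∃ y : E 4, ‖y‖ ≤ 1 ∧ p.submodule = ℝ ∙ ((y, 1) : E 4 × ℝ)}

/-- The point `p` lies on the projective line through the points `x ≠ y` of `ℝ⁴`. -/
def OnLine (p : RP4) (x y : E 4) : Prop :=
  p.submodule ≤ Submodule.span ℝ {((x, 1) : E 4 × ℝ), (y, 1)}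

/-- `T_p`: the points of `S³` at which a line through `p` is tangent to `S³`, that is, the points
`x` for which the line through `p` and `x` meets `S³` in no other point. -/
def tangencySphere (p : RP4) : Set (E 4) :=
  {x | x ∈ S3 ∧ ∀ y ∈ S3, y ≠ x → ¬ OnLine p x y}

/-- The equation of the polar hyperplane of `p = [v : w]` with respect to `S³`, at the point `x`. -/
def polarForm (p : RP4) (x : E 4) : ℝ := ⟪p.rep.1, x⟫_ℝ - p.rep.2

/-- For `p` outside the ball, `T_p` is the section of `S³` by the polar hyperplane of `p`. -/
theorem mem_tangencySphere_iff {p : RP4} (hp : p ∉ B4) (x : E 4) :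
    x ∈ tangencySphere p ↔ x ∈ S3 ∧ polarForm p x = 0 := by
  have hB : ∀ y ∈ S3, ∀ a : ℝ, p.rep ≠ a • ((y, 1) : E 4 × ℝ) := by
    intro y hy a h
    apply hp
    have ha : a ≠ 0 := by
      rintro rfl
      exact p.rep_nonzero (by simpa using h)
    refine ⟨y, by simpa using (mem_sphere_zero_iff_norm.1 hy).le, ?_⟩
    rw [p.submodule_eq, h]
    exact Submodule.span_singleton_smul_eq (IsUnit.mk0 a ha) _
  have hline : ∀ y : E 4, OnLine p x y ↔
      ∃ a b : ℝ, a • ((x, 1) : E 4 × ℝ) + b • ((y, 1) : E 4 × ℝ) = p.rep := by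
    intro y
    rw [OnLine, p.submodule_eq, Submodule.span_singleton_le_iff_mem, Submodule.mem_span_pair]
  constructor
  · rintro ⟨hx, h⟩
    refine ⟨hx, ?_⟩
    by_contra hs
    have hx1 : ‖x‖ = 1 := by simpa using hx
    set v := p.rep.1 with hv
    set w := p.rep.2 with hw
    set s := polarForm p x with hsdef
    have hs' : s = ⟪v, x⟫_ℝ - w := rfl
    set a : ℝ := (‖v‖ ^ 2 - w ^ 2) / (2 * s) with ha
    have has : 2 * a * s = ‖v‖ ^ 2 - w ^ 2 := by rw [ha]; field_simp
    have hnorm : ‖v - a • x‖ ^ 2 = (w - a) ^ 2 := by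
      rw [norm_sub_sq_real, norm_smul, inner_smul_right, hx1, Real.norm_eq_abs, mul_one, sq_abs]
      rw [hs'] at has
      linarith
    have hb : w - a ≠ 0 := by
      intro hb
      rw [hb] at hnorm
      have h0 : v - a • x = 0 := by simpa using hnorm
      refine hB x hx a (Prod.ext ?_ ?_)
      · simpa [hv] using sub_eq_zero.1 h0
      · simpa [hw] using sub_eq_zero.1 hb
    set y : E 4 := (w - a)⁻¹ • (v - a • x) with hy
    have hyS : y ∈ S3 := by
      rw [mem_sphere_zero_iff_norm, hy, norm_smul, norm_inv, Real.norm_eq_abs]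
      have : ‖v - a • x‖ = |w - a| := by
        rw [← abs_of_nonneg (norm_nonneg (v - a • x))]
        exact (sq_eq_sq_iff_abs_eq_abs _ _).1 hnorm
      rw [this]
      exact inv_mul_cancel₀ (abs_ne_zero.2 hb)
    have hsum : a • ((x, 1) : E 4 × ℝ) + (w - a) • ((y, 1) : E 4 × ℝ) = p.rep := by
      refine Prod.ext ?_ ?_
      · simp [hy, smul_smul, mul_inv_cancel₀ hb, hv]
      · simp [hw]
    refine h y hyS ?_ ((hline y).2 ⟨a, w - a, hsum⟩)
    intro hyx
    refine hB x hx w ?_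
    rw [← hsum, hyx, ← add_smul]
    congr 1
    ring
  · rintro ⟨hx, h⟩
    refine ⟨hx, fun y hy hyx hl => ?_⟩
    obtain ⟨a, b, hab⟩ := (hline y).1 hl
    have hx1 : ‖x‖ = 1 := by simpa using hx
    have hy1 : ‖y‖ = 1 := by simpa using hy
    have h1 : p.rep.1 = a • x + b • y := by rw [← hab]; simp
    have h2 : p.rep.2 = a + b := by rw [← hab]; simp
    have hin : ⟪y, x⟫_ℝ < 1 := inner_lt_one_iff_real_of_norm_eq_one hy1 hx1 |>.2 hyx
    have hz : b * (⟪y, x⟫_ℝ - 1) = 0 := by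
      have := h
      rw [polarForm, h1, h2, inner_add_left, inner_smul_left, inner_smul_left,
        real_inner_self_eq_norm_sq, hx1] at this
      simp at this
      linarith
    have hb : b = 0 := by
      rcases mul_eq_zero.1 hz with h | h
      · exact h
      · linarith
    refine hB x hx a ?_
    rw [← hab, hb]
    simp

/-- `x` and `y` lie on the same side of `T_p` in `S³`: strictly on the same side of the hyperplane
that cuts out `T_p`. -/
def SameSide (p : RP4) (x y : E 4) : Prop := 0 < polarForm p x * polarForm p y

/-- `p` is outside the ball, the three lines joining opposite points `xᵢ, xᵢ₊₃` of the 6-tuple all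
pass through `p`, and the labelling is such that, in the cyclic order, the points alternate between
the two sides of `T_p`. Equivalently, the complement of the graph in which two of the
points are joined if they are on the same side of `T_p` or on the same line is the 6-cycle
`x₀, x₁, …, x₅`. -/
def IsPrism (p : RP4) (x : Tuple) : Prop :=
  p ∉ B4 ∧ ∀ i, OnLine p (x i) (x (i + 3)) ∧ SameSide p (x i) (x (i + 2))

/-- The manifold `M`, embedded in `C₆(S³)`. -/
def M : Set Tuple := {x | x ∈ C6 ∧ ∃ p, IsPrism p x}

/-- The subset of `M` of the 6-tuples that lie on a circle. -/
def M₀ : Set Tuple := {x | x ∈ M ∧ EuclideanGeometry.Concyclic (range x)}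

/-! ### Trefoil knots -/

/-- Two subsets of `ℝ³` are ambient isotopic. -/
def AmbientIsotopic (K L : Set (E 3)) : Prop :=
  ∃ H : ℝ → E 3 → E 3,
    ContinuousOn (fun q : ℝ × E 3 => H q.1 q.2) (Icc 0 1 ×ˢ univ) ∧
    (∀ t ∈ Icc (0 : ℝ) 1, IsHomeomorph (H t)) ∧ H 0 = id ∧ H 1 '' K = L

/-- The closed hexagon obtained by joining the points cyclically by line segments. -/
def hexagon (z : Fin 6 → E 3) : Set (E 3) := ⋃ i, segment ℝ (z i) (z (i + 1))

/-- The vertices of a polygonal trefoil. Projection to the first two coordinates gives an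
alternating diagram with exactly three crossings: with edge `k` going from vertex `k` to vertex
`k + 1`, edge 3 passes over edge 1, edge 1 over edge 5, and edge 5 over edge 3. It is the closure
of the 2-braid `σ³` (or its inverse) around the third axis. -/
def trefoilVertex : Fin 6 → E 3 :=
  ![!₂[2, 0, 1], !₂[-1, -2, -1], !₂[0, 2, 1], !₂[2, 1, -1], !₂[-2, -2, 1], !₂[-1, 1, -1]]

/-- The mirror image of the trefoil above. -/
def mirrorTrefoilVertex (i : Fin 6) : E 3 :=
  !₂[trefoilVertex i 0, trefoilVertex i 1, -trefoilVertex i 2]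

/-- `K` is a trefoil knot, of either handedness. -/
def IsTrefoil (K : Set (E 3)) : Prop :=
  AmbientIsotopic K (hexagon trefoilVertex) ∨ AmbientIsotopic K (hexagon mirrorTrefoilVertex)

/-- A spherical trefoil knot: six points on a sphere in `ℝ³` that form a trefoil knot when joined
cyclically by line segments. -/
def IsSphericalTrefoil (z : Fin 6 → E 3) : Prop :=
  EuclideanGeometry.Cospherical (range z) ∧ IsTrefoil (hexagon z)

/-- A stereographic trefoil: a 6-tuple in `S³` that lies on a 2-sphere (the section of `S³` by a
hyperplane that meets the open ball) and becomes a spherical trefoil under the stereographic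
projection from some pole `N`, where the hyperplane orthogonal to `N` is identified with `ℝ³` by
some linear isometry `L`. -/
def IsStereographicTrefoil (y : Tuple) : Prop :=
  (∀ i, y i ∈ S3) ∧
  (∃ (u : E 4) (c : ℝ), |c| < ‖u‖ ∧ ∀ i, ⟪u, y i⟫_ℝ = c) ∧
  ∃ N ∈ S3, (∀ i, y i ≠ N) ∧ ∃ L : (ℝ ∙ N)ᗮ ≃ₗᵢ[ℝ] E 3,
    IsSphericalTrefoil fun i => L (stereoToFun N (y i))

/-! ### Isotopies of `M` -/

/-- Smoothness of a map on an arbitrary subset `s` of a Euclidean space: near every point of `s`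
it is the restriction of a smooth map defined on an open set. -/
def SmoothOn {X Y : Type*} [NormedAddCommGroup X] [NormedSpace ℝ X] [NormedAddCommGroup Y]
    [NormedSpace ℝ Y] (f : X → Y) (s : Set X) : Prop :=
  ∀ x ∈ s, ∃ (O : Set X) (g : X → Y),
    IsOpen O ∧ x ∈ O ∧ ContDiffOn ℝ ∞ g O ∧ EqOn f g (O ∩ s)

/-- `f` restricts to a proper smooth embedding of `A` in `C₆(S³)`: a diffeomorphism of `A` onto its
image, which is a closed subset of `C₆(S³)`. -/
def IsProperSmoothEmbedding (f : Tuple → Tuple) (A : Set Tuple) : Prop :=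
  MapsTo f A C6 ∧ SmoothOn f A ∧
  (∃ g : Tuple → Tuple, SmoothOn g (f '' A) ∧ ∀ x ∈ A, g (f x) = x) ∧
  ∃ Z : Set Tuple, IsClosed Z ∧ f '' A = Z ∩ C6

/-- `F t`, `0 ≤ t ≤ 1`, is a smooth isotopy of `A` in `C₆(S³)`, starting at the inclusion. -/
def IsIsotopy (F : ℝ → Tuple → Tuple) (A : Set Tuple) : Prop :=
  SmoothOn (fun q : ℝ × Tuple => F q.1 q.2) (Icc 0 1 ×ˢ A) ∧
  (∀ t ∈ Icc (0 : ℝ) 1, IsProperSmoothEmbedding (F t) A) ∧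
  ∀ x ∈ A, F 0 x = x

/-- For a prism `x` with lines through `p`, not all in one plane, the affine span of `x` cuts `S³`
in a 2-sphere `P`. This is the space of directions of the plane of the circle `T_p ∩ P`. -/
def circleDirections (p : RP4) (x : Tuple) : Submodule ℝ (E 4) :=
  vectorSpan ℝ (range x) ⊓ (ℝ ∙ p.rep.1)ᗮ

/-- `x'` is obtained from the prism `x` by twisting one half of it: the three points of `x` on one
side of `T_p` are moved by a rotation in the plane of directions of the circle `T_p ∩ P`, which
maps the sphere `P` and this circle to themselves; the other three points stay where they are. -/
def IsHalfTwist (x x' : Tuple) : Prop :=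
  ∃ p, IsPrism p x ∧ ∃ R : E 4 ≃ₗᵢ[ℝ] E 4,
    LinearMap.det (R.toLinearEquiv : E 4 →ₗ[ℝ] E 4) = 1 ∧
    (∀ z ∈ (circleDirections p x)ᗮ, R z = z) ∧
    (∀ i ∈ ({0, 2, 4} : Set (Fin 6)), x' i = R (x i)) ∧
    ∀ i ∈ ({1, 3, 5} : Set (Fin 6)), x' i = x i

end InscribedTrefoil

end

open InscribedTrefoil

noncomputable section

namespace InscribedTrefoil

/-! ### Ambient isotopy -/

/-! Take a non-planar prism and project stereographically from a point of `T_p` that is orthogonal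
to the directions of the circle `T_p ∩ P`. The involution of `S³` that swaps the two points on each
line through `p` becomes the reflection in a plane (`mirror_coords`). The six points therefore
become the vertices of a prism with parallel lateral edges, symmetric in that plane and inscribed in
a sphere centred on it (`IsTwistFrame.exists_sphere`), and the closed hexagon consists of the six
diagonals of the lateral faces. The rotation of the half twist fixes the pole, so after projection
it turns the upper base about an axis through the centre of the sphere. Without a twist the hexagon
meets itself only where the two diagonals of a face cross. Because the prism is inscribed, the turn
separates all three crossings to first order, with the same sign (`IsTwistFrame.isTwistable`), so a
small twist makes the hexagon embedded. Its knot type is found by continuity: embedded hexagons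
close to each other are ambient isotopic (`IsEmbeddedHexagon.eventually_ambientIsotopic`), the space
of prisms with velocities that separate the diagonals is path connected, and it contains a prism
whose full twist is the standard trefoil (`IsTwistable.eventually_mem_trefoilHexagons`).
Embeddedness also keeps the twisted tuple out of `M`: for a tuple in `M`, concurrency of the lines
would force two opposite edges to meet (`IsTwistFrame.twist_notMem_M`). For the global statement,
apex and rotation are given by formulas that are smooth on the whole space of tuples. The amount of
twist is a smooth function that is positive on injective tuples with nonzero `prismGram`, vanishes
elsewhere, and is small together with its derivative (`exists_contDiff_of_eventually`). The twist is
then a small perturbation of the identity, hence a diffeomorphism of the whole space that preserves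
`C6`; it is proper on `M` because `M` is closed in `C6` (`mem_M_of_mem_closure`). On `M`,
`prismGram` vanishes exactly on `M₀`, so precisely the planar prisms stay fixed. -/

theorem AmbientIsotopic.symm {K L : Set (E 3)} (h : AmbientIsotopic K L) :
    AmbientIsotopic L K := by
  obtain ⟨H, hc, hh, h0, h1⟩ := h
  set e := (hh 1 (by simp)).homeomorph with he
  have hecoe : ∀ x, e x = H 1 x := fun x => rfl
  refine ⟨fun t x => H (1 - t) (e.symm x), ?_, fun t ht => ?_, ?_, ?_⟩
  · refine hc.comp (f := fun q : ℝ × E 3 => (1 - q.1, e.symm q.2)) (by fun_prop) ?_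
    rintro ⟨t, x⟩ ⟨ht, -⟩
    simp only [mem_Icc, mem_prod, mem_univ, and_true] at ht ⊢
    constructor <;> linarith
  · exact (hh (1 - t) (by simp only [mem_Icc] at ht ⊢; constructor <;> linarith)).comp
      e.symm.isHomeomorph
  · funext x
    simp [← hecoe]
  · simp only [sub_self, h0, id]
    rw [← h1]
    ext x
    simp [← hecoe]

theorem AmbientIsotopic.trans {K L J : Set (E 3)} (h : AmbientIsotopic K L)
    (h' : AmbientIsotopic L J) : AmbientIsotopic K J := by
  obtain ⟨H, hc, hh, h0, h1⟩ := h
  obtain ⟨H', hc', hh', h0', h1'⟩ := h'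
  have hm : ∀ t ∈ Icc (0 : ℝ) 1, min 1 (2 * t) ∈ Icc (0 : ℝ) 1 := fun t ht =>
    ⟨le_min zero_le_one (by linarith [ht.1]), min_le_left _ _⟩
  have hm' : ∀ t ∈ Icc (0 : ℝ) 1, max 0 (2 * t - 1) ∈ Icc (0 : ℝ) 1 := fun t ht =>
    ⟨le_max_left _ _, max_le zero_le_one (by linarith [ht.2])⟩
  refine ⟨fun t x => H' (max 0 (2 * t - 1)) (H (min 1 (2 * t)) x), ?_, fun t ht => ?_, ?_, ?_⟩
  · refine hc'.comp (f := fun q : ℝ × E 3 => (max 0 (2 * q.1 - 1), H (min 1 (2 * q.1)) q.2))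
      (ContinuousOn.prodMk (by fun_prop) ?_) ?_
    · exact hc.comp (f := fun q : ℝ × E 3 => (min 1 (2 * q.1), q.2)) (by fun_prop)
        fun q hq => ⟨hm _ hq.1, mem_univ _⟩
    · exact fun q hq => ⟨hm' _ hq.1, mem_univ _⟩
  · exact (hh' _ (hm' t ht)).comp (hh _ (hm t ht))
  · funext x
    simp [h0, h0']
  · have e1 : max 0 (2 * (1 : ℝ) - 1) = 1 := by norm_num
    have e2 : min 1 (2 * (1 : ℝ)) = 1 := by norm_num
    simp only [e1, e2]
    rw [← h1', ← h1, image_image]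

/-- The map is approximated on the whole space by the identity, with error constant below 1, so the
quantitative inverse function theorem applies globally. -/
theorem isHomeomorph_add_of_lipschitzWith {X : Type*} [NormedAddCommGroup X] [NormedSpace ℝ X]
    [CompleteSpace X] [Nontrivial X] {u : X → X} {K : NNReal} (hu : LipschitzWith K u)
    (hK : K < 1) : IsHomeomorph fun x => x + u x := by
  have ha : ApproximatesLinearOn (fun x => x + u x)
      ((ContinuousLinearEquiv.refl ℝ X : X ≃L[ℝ] X) : X →L[ℝ] X) univ K := by
    intro x _ y _
    have : x + u x - (y + u y) - (x - y) = u x - u y := by abel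
    simpa [this] using hu.norm_sub_le x y
  have hc : K < ‖((ContinuousLinearEquiv.refl ℝ X).symm : X →L[ℝ] X)‖₊⁻¹ := by
    have : ‖((ContinuousLinearEquiv.refl ℝ X).symm : X →L[ℝ] X)‖₊ = 1 := by
      ext
      simp
    rw [this]
    simpa using hK
  exact (ha.toHomeomorph _ (Or.inr hc)).isHomeomorph

theorem ambientIsotopic_image_of_lipschitzWith {u : E 3 → E 3} {K : NNReal}
    (hu : LipschitzWith K u) (hK : K < 1) (A : Set (E 3)) :
    AmbientIsotopic A ((fun x => x + u x) '' A) := by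
  refine ⟨fun t x => x + t • u x, ?_, fun t ht => ?_, by funext x; simp, by simp⟩
  · have := hu.continuous
    fun_prop
  · have h : LipschitzWith K fun x => t • u x := by
      refine LipschitzWith.of_dist_le_mul fun x y => ?_
      rw [dist_smul₀, Real.norm_of_nonneg ht.1]
      calc t * dist (u x) (u y) ≤ 1 * dist (u x) (u y) := by gcongr; exact ht.2
        _ ≤ K * dist x y := by rw [one_mul]; exact hu.dist_le_mul x y
    exact isHomeomorph_add_of_lipschitzWith h hK

/-! ### Embedded hexagons -/

/-- The point with parameter `t` on the edge `i` of a closed hexagon. -/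
def edgePoint (z : Fin 6 → E 3) (i : Fin 6) (t : ℝ) : E 3 := (1 - t) • z i + t • z (i + 1)

/-- A hexagon is embedded if consecutive edges leave their common vertex in different directions
and edges without a common vertex are disjoint. -/
def IsEmbeddedHexagon (z : Fin 6 → E 3) : Prop :=
  (∀ i, ∀ t ∈ Icc (0 : ℝ) 1, (1 - t) • (z i - z (i + 1)) ≠ t • (z (i + 2) - z (i + 1))) ∧
  (∀ i, ∀ t ∈ Icc (0 : ℝ) 1, ∀ t' ∈ Icc (0 : ℝ) 1, edgePoint z i t ≠ edgePoint z (i + 2) t') ∧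
  ∀ i, ∀ t ∈ Icc (0 : ℝ) 1, ∀ t' ∈ Icc (0 : ℝ) 1, edgePoint z i t ≠ edgePoint z (i + 3) t'

theorem mem_hexagon_iff {z : Fin 6 → E 3} {a : E 3} :
    a ∈ hexagon z ↔ ∃ i, ∃ t ∈ Icc (0 : ℝ) 1, edgePoint z i t = a := by
  simp only [hexagon, mem_iUnion, segment_eq_image, edgePoint, mem_image]

theorem edgePoint_add (z w : Fin 6 → E 3) (i : Fin 6) (t : ℝ) :
    edgePoint (z + w) i t = edgePoint z i t + edgePoint w i t := by
  simp only [edgePoint, Pi.add_apply]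
  module

theorem norm_edgePoint_le (w : Fin 6 → E 3) (i : Fin 6) {t : ℝ} (ht : t ∈ Icc (0 : ℝ) 1) :
    ‖edgePoint w i t‖ ≤ ‖w‖ := by
  calc ‖edgePoint w i t‖ ≤ ‖(1 - t) • w i‖ + ‖t • w (i + 1)‖ := norm_add_le _ _
    _ = (1 - t) * ‖w i‖ + t * ‖w (i + 1)‖ := by
        rw [norm_smul, norm_smul, Real.norm_of_nonneg ht.1,
          Real.norm_of_nonneg (by linarith [ht.2])]
    _ ≤ (1 - t) * ‖w‖ + t * ‖w‖ := by
        have := ht.1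
        have : 0 ≤ 1 - t := by linarith [ht.2]
        gcongr <;> exact norm_le_pi_norm w _
    _ = ‖w‖ := by ring

/-- The displacement of the edges `i` and `j` of the hexagon `z` that is linear on each of them and
given by `w` at the vertices is Lipschitz, with a constant proportional to the size of `w`. -/
def EdgesLipschitz (z : Fin 6 → E 3) (i j : Fin 6) : Prop :=
  ∃ C : ℝ, 0 ≤ C ∧ ∀ w : Fin 6 → E 3, ∀ t ∈ Icc (0 : ℝ) 1, ∀ t' ∈ Icc (0 : ℝ) 1,
    ‖edgePoint w i t - edgePoint w j t'‖ ≤ C * ‖w‖ * ‖edgePoint z i t - edgePoint z j t'‖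

theorem EdgesLipschitz.symm {z : Fin 6 → E 3} {i j : Fin 6} (h : EdgesLipschitz z i j) :
    EdgesLipschitz z j i := by
  obtain ⟨C, hC, h⟩ := h
  refine ⟨C, hC, fun w t ht t' ht' => ?_⟩
  rw [norm_sub_rev, norm_sub_rev (edgePoint z j t)]
  exact h w t' ht' t ht

theorem edgesLipschitz_self {z : Fin 6 → E 3} {i : Fin 6} (h : z i ≠ z (i + 1)) :
    EdgesLipschitz z i i := by
  have hpos : 0 < ‖z (i + 1) - z i‖ := norm_pos_iff.2 (sub_ne_zero.2 h.symm)
  refine ⟨2 / ‖z (i + 1) - z i‖, by positivity, fun w t _ t' _ => ?_⟩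
  have e : ∀ w : Fin 6 → E 3,
      edgePoint w i t - edgePoint w i t' = (t - t') • (w (i + 1) - w i) := by
    intro w
    simp only [edgePoint]
    module
  rw [e, e, norm_smul, norm_smul]
  have hw : ‖w (i + 1) - w i‖ ≤ 2 * ‖w‖ := by
    linarith [norm_sub_le (w (i + 1)) (w i), norm_le_pi_norm w i, norm_le_pi_norm w (i + 1)]
  calc ‖t - t'‖ * ‖w (i + 1) - w i‖ ≤ ‖t - t'‖ * (2 * ‖w‖) := by gcongr
    _ = _ := by field_simp

/-- By compactness the two edges have a positive distance `D`, while displacements differ by at most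
`2 * ‖w‖`. -/
theorem edgesLipschitz_of_disjoint {z : Fin 6 → E 3} {i j : Fin 6}
    (h : ∀ t ∈ Icc (0 : ℝ) 1, ∀ t' ∈ Icc (0 : ℝ) 1, edgePoint z i t ≠ edgePoint z j t') :
    EdgesLipschitz z i j := by
  have hcomp : IsCompact (Icc (0 : ℝ) 1 ×ˢ Icc (0 : ℝ) 1) := isCompact_Icc.prod isCompact_Icc
  obtain ⟨D, hpos, hD⟩ : ∃ D > 0, ∀ t ∈ Icc (0 : ℝ) 1, ∀ t' ∈ Icc (0 : ℝ) 1,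
      D ≤ ‖edgePoint z i t - edgePoint z j t'‖ := by
    obtain ⟨m, hm, hmin⟩ := hcomp.exists_isMinOn ⟨(0, 0), by simp⟩
      (f := fun q : ℝ × ℝ => ‖edgePoint z i q.1 - edgePoint z j q.2‖)
      (by unfold edgePoint; fun_prop)
    exact ⟨_, norm_pos_iff.2 (sub_ne_zero.2 (h _ hm.1 _ hm.2)),
      fun t ht t' ht' => isMinOn_iff.1 hmin (t, t') ⟨ht, ht'⟩⟩
  refine ⟨2 / D, by positivity, fun w t ht t' ht' => ?_⟩
  calc ‖edgePoint w i t - edgePoint w j t'‖ ≤ ‖w‖ + ‖w‖ :=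
        (norm_sub_le _ _).trans (add_le_add (norm_edgePoint_le w i ht) (norm_edgePoint_le w j ht'))
    _ = 2 / D * ‖w‖ * D := by field_simp; ring
    _ ≤ _ := mul_le_mul_of_nonneg_left (hD t ht t' ht') (by positivity)

/-- The distance of the two points tends to zero at the common vertex, but both sides of the
inequality are homogeneous in `r = (1 - t) + t'`. After division by `r` the weights are convex, and
compactness bounds the distance below by `c`. -/
theorem edgesLipschitz_of_adjacent {z : Fin 6 → E 3} {i : Fin 6}
    (h : ∀ t ∈ Icc (0 : ℝ) 1, (1 - t) • (z i - z (i + 1)) ≠ t • (z (i + 2) - z (i + 1))) :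
    EdgesLipschitz z i (i + 1) := by
  set e₁ := z i - z (i + 1) with he₁
  set e₂ := z (i + 2) - z (i + 1) with he₂
  obtain ⟨m, hm, hmin⟩ := (isCompact_Icc (a := (0 : ℝ)) (b := 1)).exists_isMinOn ⟨0, by simp⟩
    (f := fun t : ℝ => ‖(1 - t) • e₁ - t • e₂‖) (by fun_prop)
  set c := ‖(1 - m) • e₁ - m • e₂‖ with hc
  have hpos : 0 < c := norm_pos_iff.2 (sub_ne_zero.2 (h _ hm))
  refine ⟨2 / c, by positivity, fun w t ht t' ht' => ?_⟩
  have e : ∀ w : Fin 6 → E 3, edgePoint w i t - edgePoint w (i + 1) t' =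
      (1 - t) • (w i - w (i + 1)) - t' • (w (i + 2) - w (i + 1)) := by
    intro w
    have : i + 1 + 1 = i + 2 := by rw [add_assoc]; rfl
    simp only [edgePoint, this]
    module
  have h1 : 0 ≤ 1 - t := by linarith [ht.2]
  have h2 : 0 ≤ t' := ht'.1
  set r := (1 - t) + t' with hr
  have hr0 : 0 ≤ r := by positivity
  have hw : ‖edgePoint w i t - edgePoint w (i + 1) t'‖ ≤ r * (2 * ‖w‖) := by
    have hd : ∀ a b, ‖w a - w b‖ ≤ 2 * ‖w‖ := fun a b => by
      linarith [norm_sub_le (w a) (w b), norm_le_pi_norm w a, norm_le_pi_norm w b]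
    rw [e]
    calc _ ≤ ‖(1 - t) • (w i - w (i + 1))‖ + ‖t' • (w (i + 2) - w (i + 1))‖ := norm_sub_le _ _
      _ = (1 - t) * ‖w i - w (i + 1)‖ + t' * ‖w (i + 2) - w (i + 1)‖ := by
          rw [norm_smul, norm_smul, Real.norm_of_nonneg h1, Real.norm_of_nonneg h2]
      _ ≤ (1 - t) * (2 * ‖w‖) + t' * (2 * ‖w‖) := by gcongr <;> exact hd _ _
      _ = _ := by rw [hr]; ring
  have hz : r * c ≤ ‖edgePoint z i t - edgePoint z (i + 1) t'‖ := by
    rw [e]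
    rcases hr0.eq_or_lt with h0 | h0
    · rw [← h0, zero_mul]
      exact norm_nonneg _
    · have hmem : t' / r ∈ Icc (0 : ℝ) 1 := ⟨by positivity, by rw [div_le_one h0]; linarith⟩
      have hle : c ≤ ‖(1 - t' / r) • e₁ - (t' / r) • e₂‖ := hmin hmem
      have : (1 - t) • e₁ - t' • e₂ = r • ((1 - t' / r) • e₁ - (t' / r) • e₂) := by
        rw [smul_sub r, smul_smul, smul_smul]
        congr 2
        · field_simp
          linarith
        · field_simp
      rw [this, norm_smul, Real.norm_of_nonneg hr0]
      gcongr
  calc _ ≤ r * (2 * ‖w‖) := hw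
    _ = 2 / c * ‖w‖ * (r * c) := by field_simp
    _ ≤ _ := by gcongr

theorem IsEmbeddedHexagon.edgesLipschitz {z : Fin 6 → E 3} (h : IsEmbeddedHexagon z)
    (i j : Fin 6) : EdgesLipschitz z i j := by
  obtain ⟨ha, h2, h3⟩ := h
  have h4 : ∀ i, EdgesLipschitz z i (i + 4) := fun i => by
    have := edgesLipschitz_of_disjoint (h2 (i + 4))
    have e : i + 4 + 2 = i := by rw [add_assoc]; exact add_zero i
    rw [e] at this
    exact this.symm
  have h5 : ∀ i, EdgesLipschitz z i (i + 5) := fun i => by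
    have := edgesLipschitz_of_adjacent (ha (i + 5))
    have e : i + 5 + 1 = i := by rw [add_assoc]; exact add_zero i
    rw [e] at this
    exact this.symm
  have h0 : ∀ i, EdgesLipschitz z i i := fun i => by
    refine edgesLipschitz_self fun he => ha i 0 (by simp) ?_
    simp [he]
  obtain ⟨k, rfl⟩ : ∃ k, j = i + k := ⟨j - i, by abel⟩
  fin_cases k
  · simpa using h0 i
  · exact edgesLipschitz_of_adjacent (ha i)
  · exact edgesLipschitz_of_disjoint (h2 i)
  · exact edgesLipschitz_of_disjoint (h3 i)
  · exact h4 i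
  · exact h5 i

/-- The piecewise linear displacement from `z` to `z'` is Lipschitz for the distance of `ℝ³`, by
embeddedness, with a constant that tends to zero with `z' - z`. Its Lipschitz extension to `ℝ³`
moves one hexagon to the other through perturbations of the identity. -/
theorem IsEmbeddedHexagon.eventually_ambientIsotopic {z : Fin 6 → E 3}
    (h : IsEmbeddedHexagon z) : ∀ᶠ z' in 𝓝 z, AmbientIsotopic (hexagon z) (hexagon z') := by
  choose C hC0 hC using h.edgesLipschitz
  set c : ℝ := ∑ i, ∑ j, C i j with hc
  have hc0 : 0 ≤ c := Finset.sum_nonneg fun i _ => Finset.sum_nonneg fun j _ => hC0 i j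
  have hCc : ∀ i j, C i j ≤ c := fun i j =>
    (Finset.single_le_sum (fun j _ => hC0 i j) (Finset.mem_univ j)).trans
      (Finset.single_le_sum (f := fun i => ∑ j, C i j)
        (fun i _ => Finset.sum_nonneg fun j _ => hC0 i j) (Finset.mem_univ i))
  have hlim : ∀ᶠ z' in 𝓝 z, (lipschitzExtensionConstant (E 3) : ℝ) * (c * ‖z' - z‖) < 1 := by
    have : Filter.Tendsto (fun z' => (lipschitzExtensionConstant (E 3) : ℝ) * (c * ‖z' - z‖))
        (𝓝 z) (𝓝 ((lipschitzExtensionConstant (E 3) : ℝ) * (c * ‖z - z‖))) :=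
      Continuous.tendsto (by fun_prop) z
    refine this.eventually_lt_const ?_
    simp
  filter_upwards [hlim] with z' hz'
  set w := z' - z with hw
  have hbound : ∀ i j, ∀ t ∈ Icc (0 : ℝ) 1, ∀ t' ∈ Icc (0 : ℝ) 1,
      ‖edgePoint w i t - edgePoint w j t'‖ ≤ c * ‖w‖ * ‖edgePoint z i t - edgePoint z j t'‖ :=
    fun i j t ht t' ht' => (hC i j w t ht t' ht').trans (by gcongr; exact hCc i j)
  -- A vertex lies on two edges, so this choice is not canonical. The displacement does not depend
  -- on it: `hbound` at distance zero gives equality, which is used in `hval`.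
  choose! ι τ hτ hpt using fun a : E 3 => (mem_hexagon_iff (z := z) (a := a)).1
  have hLip : LipschitzOnWith (Real.toNNReal (c * ‖w‖))
      (fun a => edgePoint w (ι a) (τ a)) (hexagon z) := by
    refine LipschitzOnWith.of_dist_le_mul fun a ha b hb => ?_
    rw [dist_eq_norm, dist_eq_norm, Real.coe_toNNReal _ (by positivity)]
    have := hbound (ι a) (ι b) _ (hτ a ha) _ (hτ b hb)
    rwa [hpt a ha, hpt b hb] at this
  obtain ⟨u, hu, hue⟩ := hLip.extend_finite_dimension
  have hval : ∀ i, ∀ t ∈ Icc (0 : ℝ) 1, edgePoint z i t + u (edgePoint z i t) =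
      edgePoint z' i t := by
    intro i t ht
    have hmem : edgePoint z i t ∈ hexagon z := mem_hexagon_iff.2 ⟨i, t, ht, rfl⟩
    have h1 := hbound i (ι (edgePoint z i t)) t ht _ (hτ _ hmem)
    rw [hpt _ hmem, sub_self, norm_zero, mul_zero, norm_le_zero_iff, sub_eq_zero] at h1
    rw [← hue hmem]
    simp only [← h1]
    rw [← edgePoint_add]
    simp [hw]
  have himage : (fun x => x + u x) '' hexagon z = hexagon z' := by
    ext b
    rw [mem_hexagon_iff]
    constructor
    · rintro ⟨a, ha, rfl⟩
      obtain ⟨i, t, ht, rfl⟩ := mem_hexagon_iff.1 ha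
      exact ⟨i, t, ht, (hval i t ht).symm⟩
    · rintro ⟨i, t, ht, rfl⟩
      exact ⟨_, mem_hexagon_iff.2 ⟨i, t, ht, rfl⟩, hval i t ht⟩
  rw [← himage]
  refine ambientIsotopic_image_of_lipschitzWith hu ?_ _
  rw [← NNReal.coe_lt_coe]
  rw [NNReal.coe_mul, Real.coe_toNNReal _ (by positivity)]
  exact hz'

theorem eventually_ne_of_compact {X Y V : Type*} [TopologicalSpace X] [TopologicalSpace Y]
    [TopologicalSpace V] [T2Space V] {K : Set Y} (hK : IsCompact K) {f g : X × Y → V}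
    (hf : Continuous f) (hg : Continuous g) {x : X} (h : ∀ y ∈ K, f (x, y) ≠ g (x, y)) :
    ∀ᶠ x' in 𝓝 x, ∀ y ∈ K, f (x', y) ≠ g (x', y) :=
  hK.eventually_forall_of_forall_eventually (P := fun x y => f (x, y) ≠ g (x, y)) fun y hy =>
    (isOpen_ne_fun hf hg).mem_nhds (h y hy)

theorem continuous_edgePoint (i : Fin 6) :
    Continuous fun q : (Fin 6 → E 3) × ℝ => edgePoint q.1 i q.2 := by
  unfold edgePoint
  fun_prop

theorem eventually_adjacent {z : Fin 6 → E 3} {i : Fin 6}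
    (h : ∀ t ∈ Icc (0 : ℝ) 1, (1 - t) • (z i - z (i + 1)) ≠ t • (z (i + 2) - z (i + 1))) :
    ∀ᶠ z' in 𝓝 z, ∀ t ∈ Icc (0 : ℝ) 1,
      (1 - t) • (z' i - z' (i + 1)) ≠ t • (z' (i + 2) - z' (i + 1)) :=
  eventually_ne_of_compact isCompact_Icc
    (f := fun q : (Fin 6 → E 3) × ℝ => (1 - q.2) • (q.1 i - q.1 (i + 1)))
    (g := fun q => q.2 • (q.1 (i + 2) - q.1 (i + 1))) (by fun_prop) (by fun_prop) h

theorem eventually_disjoint {z : Fin 6 → E 3} {i j : Fin 6}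
    (h : ∀ t ∈ Icc (0 : ℝ) 1, ∀ t' ∈ Icc (0 : ℝ) 1, edgePoint z i t ≠ edgePoint z j t') :
    ∀ᶠ z' in 𝓝 z, ∀ t ∈ Icc (0 : ℝ) 1, ∀ t' ∈ Icc (0 : ℝ) 1,
      edgePoint z' i t ≠ edgePoint z' j t' := by
  have := eventually_ne_of_compact (x := z)
    ((isCompact_Icc (a := (0 : ℝ)) (b := 1)).prod (isCompact_Icc (a := (0 : ℝ)) (b := 1)))
    (f := fun q : (Fin 6 → E 3) × ℝ × ℝ => edgePoint q.1 i q.2.1)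
    (g := fun q => edgePoint q.1 j q.2.2)
    ((continuous_edgePoint i).comp (by fun_prop : Continuous fun q : (Fin 6 → E 3) × ℝ × ℝ =>
      (q.1, q.2.1)))
    ((continuous_edgePoint j).comp (by fun_prop : Continuous fun q : (Fin 6 → E 3) × ℝ × ℝ =>
      (q.1, q.2.2))) (fun y hy => h _ hy.1 _ hy.2)
  filter_upwards [this] with z' hz' t ht t' ht'
  exact hz' (t, t') (mk_mem_prod ht ht')

/-- The embedded hexagons that are trefoil knots. -/
def trefoilHexagons : Set (Fin 6 → E 3) := {z | IsEmbeddedHexagon z ∧ IsTrefoil (hexagon z)}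

theorem IsTrefoil.of_ambientIsotopic {K L : Set (E 3)} (h : AmbientIsotopic K L)
    (hL : IsTrefoil L) : IsTrefoil K :=
  hL.imp h.trans h.trans

/-- Being a trefoil is locally constant among embedded hexagons, hence constant on a connected
family of them. -/
theorem subset_trefoilHexagons {S : Set (Fin 6 → E 3)} (hS : IsPreconnected S)
    (hemb : ∀ z ∈ S, IsEmbeddedHexagon z) {z₀ : Fin 6 → E 3} (hz₀ : z₀ ∈ S)
    (h₀ : IsTrefoil (hexagon z₀)) : S ⊆ trefoilHexagons := by
  have key : ∀ z ∈ S, ∀ᶠ z' in 𝓝 z, IsTrefoil (hexagon z') ↔ IsTrefoil (hexagon z) :=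
    fun z hz => (hemb z hz).eventually_ambientIsotopic.mono fun z' h =>
      ⟨IsTrefoil.of_ambientIsotopic h, IsTrefoil.of_ambientIsotopic h.symm⟩
  set u : Set (Fin 6 → E 3) := {z | ∀ᶠ z' in 𝓝 z, IsTrefoil (hexagon z')} with hu
  have huo : IsOpen u := isOpen_setOfPred_eventually_nhds
  have hsub : S ⊆ u := by
    refine hS.subset_of_closure_inter_subset huo
      ⟨z₀, hz₀, (key z₀ hz₀).mono fun z' h => h.2 h₀⟩ ?_
    rintro z ⟨hzc, hz⟩
    obtain ⟨z', hz', hz'u⟩ := mem_closure_iff_nhds.1 hzc _ (key z hz)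
    have : IsTrefoil (hexagon z) := hz'.1 hz'u.self_of_nhds
    exact (key z hz).mono fun z' h => h.2 this
  exact fun z hz => ⟨hemb z hz, (hsub hz).self_of_nhds⟩

/-! ### Twisted prisms -/

/-- Parameters `(a, b, h, ξ, η, o)` of a twisted prism: the vertices of the prism are
`(aₖ, bₖ, o ± hₖ)`, and `(ξₖ, ηₖ)` is the velocity of the upper vertices. -/
abbrev PrismParam : Type :=
  (Fin 3 → ℝ) × (Fin 3 → ℝ) × (Fin 3 → ℝ) × (Fin 3 → ℝ) × (Fin 3 → ℝ) × ℝ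

/-- Vertices of the upper base of a twisted prism. -/
def topVertex (π : PrismParam) (s : ℝ) (k : Fin 3) : E 3 :=
  !₂[π.1 k + s * π.2.2.2.1 k, π.2.1 k + s * π.2.2.2.2.1 k, π.2.2.2.2.2 + π.2.2.1 k]

/-- Vertices of the lower base of a twisted prism. -/
def bottomVertex (π : PrismParam) (k : Fin 3) : E 3 :=
  !₂[π.1 k, π.2.1 k, π.2.2.2.2.2 - π.2.2.1 k]

/-- The hexagon formed by the diagonals of the lateral faces of a twisted prism. -/
def twistedPrism (π : PrismParam) (s : ℝ) : Fin 6 → E 3 :=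
  ![topVertex π s 0, bottomVertex π 2, topVertex π s 1, bottomVertex π 0, topVertex π s 2,
    bottomVertex π 1]

/-- The rate at which the diagonals of the face over the edge `i j` move apart. -/
def separation (a b h ξ η : Fin 3 → ℝ) (i j : Fin 3) : ℝ :=
  h j * (η i * (a j - a i) - ξ i * (b j - b i)) - h i * (η j * (a j - a i) - ξ j * (b j - b i))

/-- The prism stands on a triangle in standard position, and the diagonals of its faces move apart
in the direction that gives a trefoil. -/
structure IsTwistable (π : PrismParam) : Prop where
  b_eq : π.2.1 1 = π.2.1 0
  a_lt : π.1 1 < π.1 0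
  b_lt : π.2.1 2 < π.2.1 0
  h_pos : ∀ k, 0 < π.2.2.1 k
  separation_pos : ∀ i j, i ≠ j →
    0 < separation π.1 π.2.1 π.2.2.1 π.2.2.2.1 π.2.2.2.2.1 i j

theorem continuous_twistedPrism :
    Continuous fun q : PrismParam × ℝ => twistedPrism q.1 q.2 := by
  have ht : ∀ k, Continuous fun q : PrismParam × ℝ => topVertex q.1 q.2 k := by
    intro k
    refine (PiLp.continuous_toLp 2 _).comp (continuous_pi fun i => ?_)
    fin_cases i <;> simp <;> fun_prop
  have hb : ∀ k, Continuous fun q : PrismParam × ℝ => bottomVertex q.1 k := by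
    intro k
    refine (PiLp.continuous_toLp 2 _).comp (continuous_pi fun i => ?_)
    fin_cases i <;> simp <;> fun_prop
  refine continuous_pi fun i => ?_
  fin_cases i
  exacts [ht 0, hb 2, ht 1, hb 0, ht 2, hb 1]

theorem coord_eq {u v : E 3} (h : u = v) : u 0 = v 0 ∧ u 1 = v 1 ∧ u 2 = v 2 := by
  subst h
  exact ⟨rfl, rfl, rfl⟩

theorem false_of_adjacent {x₁ y₁ x₂ y₂ t : ℝ} (hΔ : x₁ * y₂ - x₂ * y₁ ≠ 0)
    (hx : (1 - t) * x₁ = t * x₂) (hy : (1 - t) * y₁ = t * y₂) : False := by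
  have h1 : (1 - t) * (x₁ * y₂ - x₂ * y₁) = 0 := by linear_combination y₂ * hx - x₂ * hy
  have h2 : t * (x₁ * y₂ - x₂ * y₁) = 0 := by linear_combination y₁ * hx - x₁ * hy
  rcases mul_eq_zero.1 h1 with h | h
  · rcases mul_eq_zero.1 h2 with h' | h'
    · linarith
    · exact hΔ h'
  · exact hΔ h

theorem params_of_common_vertex {xk yk xl yl xm ym t t' : ℝ}
    (hΔ : (xl - xk) * (ym - yk) - (xm - xk) * (yl - yk) ≠ 0)
    (hx : (1 - t) * xk + t * xl = (1 - t') * xm + t' * xk)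
    (hy : (1 - t) * yk + t * yl = (1 - t') * ym + t' * yk) : t = 0 ∧ t' = 1 := by
  have h1 : t * ((xl - xk) * (ym - yk) - (xm - xk) * (yl - yk)) = 0 := by
    linear_combination (ym - yk) * hx - (xm - xk) * hy
  have h2 : (1 - t') * ((xl - xk) * (ym - yk) - (xm - xk) * (yl - yk)) = 0 := by
    linear_combination (yl - yk) * hx - (xl - xk) * hy
  exact ⟨(mul_eq_zero.1 h1).resolve_right hΔ,
    by linarith [(mul_eq_zero.1 h2).resolve_right hΔ]⟩

theorem IsTwistable.orientation {π : PrismParam} (h : IsTwistable π) :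
    0 < (π.1 1 - π.1 0) * (π.2.1 2 - π.2.1 0) - (π.1 2 - π.1 0) * (π.2.1 1 - π.2.1 0) := by
  rw [h.b_eq]
  nlinarith [mul_pos (sub_pos.2 h.a_lt) (sub_pos.2 h.b_lt)]

/-- Seen from above, consecutive diagonals lie over two different sides of a nondegenerate triangle.
-/
theorem IsTwistable.prism_adjacent {π : PrismParam} (h : IsTwistable π) (i : Fin 6) :
    ∀ t ∈ Icc (0 : ℝ) 1, (1 - t) • (twistedPrism π 0 i - twistedPrism π 0 (i + 1)) ≠
      t • (twistedPrism π 0 (i + 2) - twistedPrism π 0 (i + 1)) := by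
  have hΔ := h.orientation
  intro t _ he
  obtain ⟨h0, h1, -⟩ := coord_eq he
  fin_cases i <;>
    simp [twistedPrism, topVertex, bottomVertex] at h0 h1 <;>
    refine false_of_adjacent (fun h' => ?_) h0 h1 <;> linarith

/-- These two edges lie over sides of the base triangle with one common vertex. They could meet only
above that vertex, where one is at the upper and the other at the lower base. -/
theorem IsTwistable.prism_disjoint {π : PrismParam} (h : IsTwistable π) (i : Fin 6) :
    ∀ t ∈ Icc (0 : ℝ) 1, ∀ t' ∈ Icc (0 : ℝ) 1,
      edgePoint (twistedPrism π 0) i t ≠ edgePoint (twistedPrism π 0) (i + 2) t' := by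
  have hΔ := h.orientation
  intro t _ t' _ he
  obtain ⟨h0, h1, h2⟩ := coord_eq he
  have p0 := h.h_pos 0
  have p1 := h.h_pos 1
  have p2 := h.h_pos 2
  fin_cases i <;>
    simp [twistedPrism, topVertex, bottomVertex, edgePoint] at h0 h1 h2 <;>
    obtain ⟨rfl, rfl⟩ := params_of_common_vertex (fun h' => by linarith) h0 h1 <;>
    linarith

/-- Two lines are skew if their directions and a vector joining them have nonzero determinant. Up to
sign that determinant is `s` times the quantity in `hV`; the factor `s` appears because the
diagonals of an untwisted face are coplanar. The coefficients in the proof are the entries of the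
cross product of the directions. -/
theorem diagonals_disjoint {a b h ξ η : Fin 3 → ℝ} {o s t t' : ℝ} {k l : Fin 3} (hs : s ≠ 0)
    (hV : 2 * separation a b h ξ η k l - s * ((h l - h k) * (ξ k * η l - η k * ξ l)) ≠ 0) :
    (1 - t) • topVertex (a, b, h, ξ, η, o) s k + t • bottomVertex (a, b, h, ξ, η, o) l ≠
      (1 - t') • bottomVertex (a, b, h, ξ, η, o) k + t' • topVertex (a, b, h, ξ, η, o) s l := by
  intro he
  obtain ⟨h0, h1, h2⟩ := coord_eq he
  simp [topVertex, bottomVertex] at h0 h1 h2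
  have : s * (2 * separation a b h ξ η k l - s * ((h l - h k) * (ξ k * η l - η k * ξ l))) = 0 := by
    unfold separation
    linear_combination
      (-((b l - b k - s * η k) * (h k + h l) + (h k + h l) * (b l - b k + s * η l))) * h0 +
      ((h k + h l) * (a l - a k + s * ξ l) + (a l - a k - s * ξ k) * (h k + h l)) * h1 -
      ((a l - a k - s * ξ k) * (b l - b k + s * η l) -
        (b l - b k - s * η k) * (a l - a k + s * ξ l)) * h2
  rcases mul_eq_zero.1 this with h' | h'
  · exact hs h'
  · exact hV h'

/-- The conditions on adjacent edges and on edges two apart are open and already hold at `s = 0`.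
Only opposite edges meet there; for `s > 0` the positive separation rate dominates the second-order
term. The neighbourhood is taken jointly in the prism and `s`, so that velocities may later depend
on `s`. -/
theorem IsTwistable.eventually_isEmbeddedHexagon {π : PrismParam} (hπ : IsTwistable π) :
    ∀ᶠ q : PrismParam × ℝ in 𝓝 (π, 0), 0 < q.2 → IsEmbeddedHexagon (twistedPrism q.1 q.2) := by
  have htend : Filter.Tendsto (fun q : PrismParam × ℝ => twistedPrism q.1 q.2) (𝓝 (π, 0))
      (𝓝 (twistedPrism π 0)) := continuous_twistedPrism.tendsto (π, 0)
  have h1 := Filter.eventually_all.2 fun i =>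
    htend.eventually (eventually_adjacent (hπ.prism_adjacent i))
  have h2 := Filter.eventually_all.2 fun i =>
    htend.eventually (eventually_disjoint (hπ.prism_disjoint i))
  have h3 : ∀ k l, k ≠ l → ∀ᶠ q : PrismParam × ℝ in 𝓝 (π, 0),
      2 * separation q.1.1 q.1.2.1 q.1.2.2.1 q.1.2.2.2.1 q.1.2.2.2.2.1 k l -
        q.2 * ((q.1.2.2.1 l - q.1.2.2.1 k) *
          (q.1.2.2.2.1 k * q.1.2.2.2.2.1 l - q.1.2.2.2.2.1 k * q.1.2.2.2.1 l)) ≠ 0 := by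
    intro k l hkl
    refine ContinuousAt.eventually_ne (Continuous.continuousAt ?_) ?_
    · unfold separation
      fun_prop
    · have := hπ.separation_pos k l hkl
      simp only [zero_mul, sub_zero]
      positivity
  filter_upwards [h1, h2, h3 0 2 (by decide), h3 1 2 (by decide), h3 0 1 (by decide)]
    with q q1 q2 q02 q12 q01 hs
  obtain ⟨⟨a, b, h, ξ, η, o⟩, s⟩ := q
  dsimp only at q02 q12 q01 hs q1 q2 ⊢
  set π' : PrismParam := (a, b, h, ξ, η, o) with hπ'
  have swap : ∀ (u v : E 3) (r : ℝ), (1 - r) • u + r • v = (1 - (1 - r)) • v + (1 - r) • u := by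
    intros
    module
  have e0 : ∀ t t', edgePoint (twistedPrism π' s) 0 t ≠ edgePoint (twistedPrism π' s) 3 t' := by
    intro t t'
    change (1 - t) • topVertex π' s 0 + t • bottomVertex π' 2 ≠
      (1 - t') • bottomVertex π' 0 + t' • topVertex π' s 2
    exact diagonals_disjoint hs.ne' q02
  have e1 : ∀ t t', edgePoint (twistedPrism π' s) 1 t ≠ edgePoint (twistedPrism π' s) 4 t' := by
    intro t t'
    change (1 - t) • bottomVertex π' 2 + t • topVertex π' s 1 ≠
      (1 - t') • topVertex π' s 2 + t' • bottomVertex π' 1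
    rw [swap, swap (topVertex π' s 2)]
    exact diagonals_disjoint hs.ne' q12
  have e2 : ∀ t t', edgePoint (twistedPrism π' s) 2 t ≠ edgePoint (twistedPrism π' s) 5 t' := by
    intro t t'
    change (1 - t) • topVertex π' s 1 + t • bottomVertex π' 0 ≠
      (1 - t') • bottomVertex π' 1 + t' • topVertex π' s 0
    rw [swap, swap (bottomVertex π' 1)]
    exact (diagonals_disjoint hs.ne' q01).symm
  refine ⟨q1, q2, fun i t _ t' _ => ?_⟩
  fin_cases i
  exacts [e0 t t', e1 t t', e2 t t', (e0 t' t).symm, (e1 t' t).symm, (e2 t' t).symm]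

/-- The prism parameters near which a small twist gives a trefoil. -/
def trefoilParams : Set PrismParam :=
  {π | ∀ᶠ q : PrismParam × ℝ in 𝓝 (π, 0), 0 < q.2 → twistedPrism q.1 q.2 ∈ trefoilHexagons}

theorem isOpen_trefoilParams : IsOpen trefoilParams :=
  (isOpen_setOfPred_eventually_nhds (p := fun q : PrismParam × ℝ =>
    0 < q.2 → twistedPrism q.1 q.2 ∈ trefoilHexagons)).preimage
    (f := fun π : PrismParam => (π, (0 : ℝ))) (by fun_prop)

/-- Near `π` all hexagons with small positive twist are embedded and form a connected family, so a
single trefoil among them suffices. This yields that trefoil parameters are relatively closed among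
the twistable ones. -/
theorem IsTwistable.mem_trefoilParams {π : PrismParam} (hπ : IsTwistable π)
    (h : ∀ r > 0, ∃ π' ∈ Metric.ball π r, ∃ s ∈ Ioo 0 r, twistedPrism π' s ∈ trefoilHexagons) :
    π ∈ trefoilParams := by
  obtain ⟨r, hr, hemb⟩ := Metric.eventually_nhds_iff_ball.1 hπ.eventually_isEmbeddedHexagon
  obtain ⟨π₀, hπ₀, s₀, hs₀, h₀⟩ := h r hr
  have hmem : ∀ π' ∈ Metric.ball π r, ∀ s ∈ Ioo 0 r,
      (π', s) ∈ Metric.ball ((π, 0) : PrismParam × ℝ) r := by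
    intro π' hπ' s hs
    rw [← ball_prod_same]
    refine ⟨hπ', ?_⟩
    rw [Metric.mem_ball, Real.dist_eq, sub_zero, abs_of_pos hs.1]
    exact hs.2
  set S : Set (Fin 6 → E 3) :=
    (fun q : PrismParam × ℝ => twistedPrism q.1 q.2) '' (Metric.ball π r ×ˢ Ioo 0 r) with hS
  have hpre : IsPreconnected S :=
    (((convex_ball π r).isPreconnected).prod isPreconnected_Ioo).image _
      continuous_twistedPrism.continuousOn
  have hsub : S ⊆ trefoilHexagons := by
    refine subset_trefoilHexagons hpre ?_ (z₀ := twistedPrism π₀ s₀) ⟨(π₀, s₀), ⟨hπ₀, hs₀⟩, rfl⟩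
      h₀.2
    rintro _ ⟨⟨π', s⟩, ⟨hπ', hs⟩, rfl⟩
    exact hemb _ (hmem π' hπ' s hs) hs.1
  refine Metric.eventually_nhds_iff_ball.2 ⟨r, hr, fun q hq hq0 => hsub ⟨q, ?_, rfl⟩⟩
  rw [← ball_prod_same] at hq
  refine ⟨hq.1, hq0, ?_⟩
  have := hq.2
  rw [Metric.mem_ball, Real.dist_eq, sub_zero] at this
  exact (le_abs_self _).trans_lt this

/-! ### The standard trefoil as a twisted prism -/

/-- The parameters of the standard trefoil. -/
def standardParam : PrismParam :=
  (![2, -1, -1], ![1, 1, -2], ![1, 1, 1], ![0, 1, -1], ![-1, 1, 0], 0)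

theorem twistedPrism_standardParam : twistedPrism standardParam 1 = trefoilVertex := by
  funext i
  ext j
  fin_cases i <;> fin_cases j <;>
    simp [twistedPrism, topVertex, bottomVertex, standardParam, trefoilVertex] <;> norm_num

theorem isTwistable_standardParam : IsTwistable standardParam := by
  refine ⟨by simp [standardParam], by simp [standardParam]; norm_num,
    by simp [standardParam]; norm_num, fun k => ?_, fun i j => ?_⟩
  · fin_cases k <;> simp [standardParam]
  · fin_cases i <;> fin_cases j <;> simp [standardParam, separation] <;> norm_num

/-- The whole range of `s` is needed: the standard trefoil sits at `s = 1`, and its knot type must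
be carried to small twists. -/
theorem isEmbeddedHexagon_standardParam {s : ℝ} (h0 : 0 < s) (h1 : s ≤ 1) :
    IsEmbeddedHexagon (twistedPrism standardParam s) := by
  refine ⟨fun i t ht he => ?_, fun i t ht t' ht' he => ?_, fun i t ht t' ht' he => ?_⟩ <;>
    obtain ⟨ht0, ht1⟩ := ht <;> obtain ⟨e0, e1, e2⟩ := coord_eq he
  · fin_cases i <;>
      simp [twistedPrism, topVertex, bottomVertex, standardParam,
        -mul_eq_mul_left_iff, -mul_eq_mul_right_iff]
        at e0 e1 e2 <;>
      obtain rfl : t = 1 / 2 := (by linarith) <;> linarith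
  · fin_cases i <;>
      simp [twistedPrism, topVertex, bottomVertex, standardParam, edgePoint, -mul_eq_mul_left_iff,
        -mul_eq_mul_right_iff] at e0 e1 e2 <;>
      obtain rfl : t = t' := (by linarith) <;>
      nlinarith [mul_nonneg h0.le ht0, mul_nonneg h0.le (sub_nonneg.2 ht1)]
  · fin_cases i <;>
      simp [twistedPrism, topVertex, bottomVertex, standardParam, edgePoint, -mul_eq_mul_left_iff,
        -mul_eq_mul_right_iff] at e0 e1 e2 <;>
      obtain rfl : t = 1 - t' := (by linarith) <;>
      nlinarith [mul_nonneg h0.le ht0, mul_nonneg h0.le (sub_nonneg.2 ht1)]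

theorem isTrefoil_trefoilVertex : IsTrefoil (hexagon trefoilVertex) :=
  Or.inl ⟨fun _ x => x, by fun_prop, fun _ _ => IsHomeomorph.id, rfl, by simp⟩

theorem standardParam_mem_trefoilParams : standardParam ∈ trefoilParams := by
  have hsub : (fun s => twistedPrism standardParam s) '' Ioc 0 1 ⊆ trefoilHexagons := by
    refine subset_trefoilHexagons (isPreconnected_Ioc.image _ ?_) ?_ (z₀ := trefoilVertex)
      ⟨1, by simp, twistedPrism_standardParam⟩ isTrefoil_trefoilVertex
    · exact (continuous_twistedPrism.comp
        (by fun_prop : Continuous fun s : ℝ => (standardParam, s))).continuousOn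
    · rintro _ ⟨s, hs, rfl⟩
      exact isEmbeddedHexagon_standardParam hs.1 hs.2
  refine isTwistable_standardParam.mem_trefoilParams fun r hr =>
    ⟨_, Metric.mem_ball_self hr, min 1 (r / 2), ⟨by positivity, ?_⟩,
      hsub ⟨_, ⟨by positivity, ?_⟩, rfl⟩⟩
  · exact (min_le_right _ _).trans_lt (half_lt_self hr)
  · exact min_le_left _ _

/-! ### Connectedness of the space of twistable prisms -/

/-- For the velocity field of a rotation, multiplied by the height, the separation rate is `h i * h
j` times a squared side of the base. These velocities form a model that is available over every base
and every choice of heights. -/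
theorem isTwistable_radial {a b h : Fin 3 → ℝ} (o : ℝ) (hb : b 1 = b 0) (ha : a 1 < a 0)
    (hb' : b 2 < b 0) (hh : ∀ k, 0 < h k) : IsTwistable (a, b, h, h * b, -(h * a), o) := by
  refine ⟨hb, ha, hb', hh, fun i j hij => ?_⟩
  have e : separation a b h (h * b) (-(h * a)) i j =
      h i * h j * ((a j - a i) ^ 2 + (b j - b i) ^ 2) := by
    simp only [separation, Pi.mul_apply, Pi.neg_apply]
    ring
  have hne : a i ≠ a j ∨ b i ≠ b j := by
    by_contra! hc
    obtain ⟨h1, h2⟩ := hc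
    fin_cases i <;> fin_cases j <;> simp at hij h1 h2 <;> linarith
  change 0 < separation a b h (h * b) (-(h * a)) i j
  rw [e]
  have : 0 < (a j - a i) ^ 2 + (b j - b i) ^ 2 := by
    rcases hne with h' | h'
    · have := sub_ne_zero.2 h'.symm
      positivity
    · have := sub_ne_zero.2 h'.symm
      positivity
  exact mul_pos (mul_pos (hh i) (hh j)) this

theorem joinedIn_of_forall_lineMap {π π' : PrismParam}
    (h : ∀ t ∈ Icc (0 : ℝ) 1, IsTwistable ((1 - t) • π + t • π')) :
    JoinedIn {π | IsTwistable π} π π' := by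
  refine JoinedIn.of_segment_subset ?_
  rw [segment_eq_image]
  rintro _ ⟨t, ht, rfl⟩
  exact h t ht

theorem combo_pos {x y t : ℝ} (hx : 0 < x) (hy : 0 < y) (ht : t ∈ Icc (0 : ℝ) 1) :
    0 < (1 - t) * x + t * y := by
  have h := convex_Ioi (0 : ℝ) hx hy (sub_nonneg.2 ht.2) ht.1 (by ring)
  simpa using h

/-- For a fixed prism the separation rate is linear in the velocity, so the admissible velocities
form a convex set. -/
theorem joinedIn_velocity {a b h ξ η ξ' η' : Fin 3 → ℝ} {o : ℝ}
    (hπ : IsTwistable (a, b, h, ξ, η, o)) (hπ' : IsTwistable (a, b, h, ξ', η', o)) :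
    JoinedIn {π | IsTwistable π} (a, b, h, ξ, η, o) (a, b, h, ξ', η', o) := by
  refine joinedIn_of_forall_lineMap fun t ht => ?_
  have e : ((1 - t) • (a, b, h, ξ, η, o) + t • (a, b, h, ξ', η', o) : PrismParam) =
      (a, b, h, (1 - t) • ξ + t • ξ', (1 - t) • η + t • η', o) := by
    simp only [Prod.smul_mk, Prod.mk_add_mk, ← add_smul, sub_add_cancel, one_smul]
  rw [e]
  refine ⟨hπ.b_eq, hπ.a_lt, hπ.b_lt, hπ.h_pos, fun i j hij => ?_⟩
  have h1 : 0 < separation a b h ξ η i j := hπ.separation_pos i j hij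
  have h2 : 0 < separation a b h ξ' η' i j := hπ'.separation_pos i j hij
  have := combo_pos h1 h2 ht
  have e' : separation a b h ((1 - t) • ξ + t • ξ') ((1 - t) • η + t • η') i j =
      (1 - t) * separation a b h ξ η i j + t * separation a b h ξ' η' i j := by
    simp only [separation, Pi.add_apply, Pi.smul_apply, smul_eq_mul]
    ring
  change 0 < separation a b h ((1 - t) • ξ + t • ξ') ((1 - t) • η + t • η') i j
  rwa [e']

/-- The model velocity is a product of height and base coordinates. A straight segment stays among
the models only if one factor is constant, so heights are moved first and bases afterwards. -/
theorem joinedIn_radial_height {a b h : Fin 3 → ℝ} {o : ℝ} (hb : b 1 = b 0) (ha : a 1 < a 0)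
    (hb' : b 2 < b 0) (hh : ∀ k, 0 < h k) :
    JoinedIn {π | IsTwistable π} (a, b, h, h * b, -(h * a), o) (a, b, 1, 1 * b, -(1 * a), o) := by
  refine joinedIn_of_forall_lineMap fun t ht => ?_
  convert isTwistable_radial (a := a) (b := b) (h := (1 - t) • h + t • 1) o hb ha hb'
    (fun k => by simpa using combo_pos (hh k) one_pos ht) using 1
  refine Prod.ext ?_ (Prod.ext ?_ (Prod.ext ?_ (Prod.ext ?_ (Prod.ext ?_ ?_)))) <;>
    simp only [Prod.smul_mk, Prod.mk_add_mk] <;> try (ext k; simp; ring)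
  simp
  ring

/-- The normalization of the base triangle in `IsTwistable` makes the allowed bases a convex set,
which a mere nondegeneracy condition would not. -/
theorem joinedIn_radial_base {a b a' b' : Fin 3 → ℝ} {o o' : ℝ} (hb : b 1 = b 0) (ha : a 1 < a 0)
    (hb' : b 2 < b 0) (hb₁ : b' 1 = b' 0) (ha₁ : a' 1 < a' 0) (hb₁' : b' 2 < b' 0) :
    JoinedIn {π | IsTwistable π} (a, b, 1, 1 * b, -(1 * a), o)
      (a', b', 1, 1 * b', -(1 * a'), o') := by
  refine joinedIn_of_forall_lineMap fun t ht => ?_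
  convert isTwistable_radial (a := (1 - t) • a + t • a') (b := (1 - t) • b + t • b') (h := 1)
    ((1 - t) * o + t * o') (by simp [hb, hb₁])
    (by have := combo_pos (sub_pos.2 ha) (sub_pos.2 ha₁) ht
        simp only [Pi.add_apply, Pi.smul_apply, smul_eq_mul]; linarith)
    (by have := combo_pos (sub_pos.2 hb') (sub_pos.2 hb₁') ht
        simp only [Pi.add_apply, Pi.smul_apply, smul_eq_mul]; linarith)
    (fun k => by simp) using 1
  refine Prod.ext ?_ (Prod.ext ?_ (Prod.ext ?_ (Prod.ext ?_ (Prod.ext ?_ ?_)))) <;>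
    simp only [Prod.smul_mk, Prod.mk_add_mk] <;> try (ext k; simp; try ring)
  rfl

theorem IsTwistable.joinedIn_standardParam {π : PrismParam} (hπ : IsTwistable π) :
    JoinedIn {π | IsTwistable π} π standardParam := by
  obtain ⟨a, b, h, ξ, η, o⟩ := π
  have hs := isTwistable_standardParam
  have h1 : (![1, 1, 1] : Fin 3 → ℝ) = 1 := by
    ext k
    fin_cases k <;> rfl
  have hr := isTwistable_radial o hπ.b_eq hπ.a_lt hπ.b_lt hπ.h_pos
  unfold standardParam at hs ⊢
  rw [h1] at hs ⊢
  have hr' := isTwistable_radial (h := 1) 0 hs.b_eq hs.a_lt hs.b_lt fun k => by simp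
  exact (joinedIn_velocity hπ hr).trans
    ((joinedIn_radial_height hπ.b_eq hπ.a_lt hπ.b_lt hπ.h_pos).trans
      ((joinedIn_radial_base hπ.b_eq hπ.a_lt hπ.b_lt hs.b_eq hs.a_lt hs.b_lt).trans
        (joinedIn_velocity hr' hs)))

/-- The trefoil parameters form an open, relatively closed and nonempty part of the connected space
of twistable prisms. -/
theorem IsTwistable.eventually_mem_trefoilHexagons {π : PrismParam} (hπ : IsTwistable π) :
    ∀ᶠ q : PrismParam × ℝ in 𝓝 (π, 0), 0 < q.2 → twistedPrism q.1 q.2 ∈ trefoilHexagons := by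
  have hconn : IsPathConnected {π | IsTwistable π} :=
    ⟨standardParam, isTwistable_standardParam, fun _ h =>
      (IsTwistable.joinedIn_standardParam h).symm⟩
  refine hconn.isConnected.isPreconnected.subset_of_closure_inter_subset isOpen_trefoilParams
    ⟨_, isTwistable_standardParam, standardParam_mem_trefoilParams⟩ ?_ hπ
  rintro π₁ ⟨hc, h₁⟩
  refine IsTwistable.mem_trefoilParams h₁ fun r hr => ?_
  obtain ⟨π', hπ', hb⟩ := Metric.mem_closure_iff.1 hc r hr
  rw [dist_comm] at hb
  obtain ⟨r', hr', hball⟩ := Metric.eventually_nhds_iff_ball.1 hπ'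
  refine ⟨π', hb, min (r / 2) (r' / 2), ⟨by positivity, ?_⟩, hball (π', _) ?_ (by positivity)⟩
  · exact (min_le_left _ _).trans_lt (half_lt_self hr)
  · rw [← ball_prod_same]
    refine ⟨Metric.mem_ball_self hr', ?_⟩
    rw [Metric.mem_ball, Real.dist_eq, sub_zero, abs_of_pos (by positivity)]
    exact (min_le_right _ _).trans_lt (half_lt_self hr')

/-! ### Small smooth functions -/

section SmallFunctions

variable {X : Type*} [NormedAddCommGroup X] [NormedSpace ℝ X]

theorem exists_pos_smul_iteratedFDeriv_le {g : X → ℝ} (hg : ContDiff ℝ ∞ g)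
    (hg' : HasCompactSupport g) (n : ℕ) {ε : ℝ} (hε : 0 < ε) :
    ∃ r : ℝ, 0 < r ∧ ∀ i ≤ n, ∀ x, ‖iteratedFDeriv ℝ i (r • g) x‖ ≤ ε := by
  have hbdd : ∀ i, ∃ R, ∀ x, ‖iteratedFDeriv ℝ i g x‖ ≤ R := by
    intro i
    have : BddAbove (range fun x => ‖iteratedFDeriv ℝ i g x‖) := by
      apply (hg.continuous_iteratedFDeriv
        (mod_cast le_top)).norm.bddAbove_range_of_hasCompactSupport
      apply HasCompactSupport.comp_left _ norm_zero
      apply hg'.iteratedFDeriv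
    obtain ⟨R, hR⟩ := this
    exact ⟨R, fun x => hR (mem_range_self _)⟩
  choose R hR using hbdd
  have hR0 : ∀ i, 0 ≤ R i := fun i => (norm_nonneg _).trans (hR i 0)
  set m := ∑ i ∈ Finset.range (n + 1), R i + 1 with hm
  have hm0 : 0 < m := by
    have := Finset.sum_nonneg fun i (_ : i ∈ Finset.range (n + 1)) => hR0 i
    positivity
  refine ⟨m⁻¹ * ε, by positivity, fun i hi x => ?_⟩
  have hle : R i ≤ m := by
    have := Finset.single_le_sum (fun i _ => hR0 i) (Finset.mem_range.2 (Nat.lt_succ_of_le hi))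
    linarith
  calc ‖iteratedFDeriv ℝ i ((m⁻¹ * ε) • g) x‖ = ‖(m⁻¹ * ε) • iteratedFDeriv ℝ i g x‖ := by
        rw [iteratedFDeriv_const_smul_apply]
        exact hg.contDiffAt.of_le (mod_cast le_top)
    _ = m⁻¹ * ε * ‖iteratedFDeriv ℝ i g x‖ := by
        rw [norm_smul _ (iteratedFDeriv ℝ i g x), Real.norm_of_nonneg]; positivity
    _ ≤ m⁻¹ * ε * m := by gcongr; exact (hR i x).trans hle
    _ = ε := by field_simp

variable [FiniteDimensional ℝ X]

/-- On an open set there is a positive smooth function that, with its first derivative, is smaller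
than a given function, and that is smooth when extended by zero to the whole space. -/
theorem exists_contDiff_le {s : Set X} (hs : IsOpen s) {η : X → ℝ}
    (hη : ∀ x ∈ s, ∃ c > 0, ∀ᶠ y in 𝓝 x, c ≤ η y) :
    ∃ f : X → ℝ, ContDiff ℝ ∞ f ∧ (∀ x ∈ s, 0 < f x) ∧ (∀ x ∉ s, f x = 0) ∧
      ∀ x ∈ s, f x ≤ η x ∧ ‖fderiv ℝ f x‖ ≤ η x := by
  rcases eq_empty_or_nonempty s with rfl | h's
  · exact ⟨fun _ => 0, contDiff_const, by simp, by simp, by simp⟩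
  let ι := { f : X → ℝ // (∃ c > 0, ∀ x ∈ tsupport f, x ∈ s ∧ c ≤ η x) ∧ HasCompactSupport f ∧
    ContDiff ℝ ∞ f ∧ range f ⊆ Icc 0 1 }
  have hcover : ∀ x ∈ s, ∃ g : ι, x ∈ Function.support g.1 := by
    intro x hx
    obtain ⟨c, hc, hcη⟩ := hη x hx
    obtain ⟨f, hf1, hf2, hf3, hf4, hf5⟩ :=
      exists_contDiff_tsupport_subset (n := ⊤) ((hs.eventually_mem hx).and hcη)
    exact ⟨⟨f, ⟨c, hc, fun y hy => hf1 hy⟩, hf2, hf3, hf4⟩, by simp [hf5]⟩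
  obtain ⟨T, T_count, hT⟩ : ∃ T : Set ι, T.Countable ∧
      ⋃ f ∈ T, Function.support (f.1 : X → ℝ) = ⋃ f : ι, Function.support f.1 :=
    TopologicalSpace.isOpen_iUnion_countable _ fun f => f.2.2.2.1.continuous.isOpen_support
  obtain ⟨x₀, hx₀⟩ := h's
  have hTs : ∀ x ∈ s, ∃ f ∈ T, x ∈ Function.support f.1 := by
    intro x hx
    have : x ∈ ⋃ f ∈ T, Function.support (f.1 : X → ℝ) := by
      rw [hT]
      exact mem_iUnion.2 (hcover x hx)
    simpa only [mem_iUnion, exists_prop] using this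
  obtain ⟨g0, hg⟩ : ∃ g0 : ℕ → ι, T = range g0 := by
    obtain ⟨f, hf, -⟩ := hTs x₀ hx₀
    exact T_count.exists_eq_range ⟨f, hf⟩
  set g : ℕ → X → ℝ := fun n => (g0 n).1 with hgdef
  have s_g : ∀ x ∈ s, ∃ n, x ∈ Function.support (g n) := by
    intro x hx
    obtain ⟨f, hf, hxf⟩ := hTs x hx
    rw [hg] at hf
    obtain ⟨n, rfl⟩ := hf
    exact ⟨n, hxf⟩
  have g_smooth : ∀ n, ContDiff ℝ ∞ (g n) := fun n => (g0 n).2.2.2.1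
  have g_nonneg : ∀ n x, 0 ≤ g n x := fun n x => ((g0 n).2.2.2.2 (mem_range_self x)).1
  choose c hc0 hc using fun n => (g0 n).2.1
  obtain ⟨δ, δpos, D, δD, D_lt⟩ :
      ∃ δ : ℕ → NNReal, (∀ i : ℕ, 0 < δ i) ∧ ∃ D : NNReal, HasSum δ D ∧ D < 1 :=
    NNReal.exists_pos_sum_of_countable one_ne_zero ℕ
  have hδsum : HasSum (fun n => (δ n : ℝ)) D := NNReal.hasSum_coe.2 δD
  -- The order `n + 1` grows with `n`, which gives smoothness of the sum, and is at least 1, so that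
  -- the first derivative of every term is controlled. The factor `c n` compares the term with `η`
  -- on its support; the bound 1 makes the series summable.
  choose r rpos hr using fun n => exists_pos_smul_iteratedFDeriv_le (g_smooth n) (g0 n).2.2.1
    (n + 1) (ε := δ n * min (c n) 1)
    (mul_pos (NNReal.coe_pos.2 (δpos n)) (lt_min (hc0 n) one_pos))
  have hrδ : ∀ n, ∀ i ≤ n + 1, ∀ x, ‖iteratedFDeriv ℝ i (r n • g n) x‖ ≤ δ n := fun n i hi x =>
    (hr n i hi x).trans (mul_le_of_le_one_right (by positivity) (min_le_right _ _))
  have hrc : ∀ n, ∀ i ≤ n + 1, ∀ x ∈ s, ‖iteratedFDeriv ℝ i (r n • g n) x‖ ≤ δ n * η x := by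
    intro n i hi x hx
    have hη0 : 0 ≤ η x := by
      obtain ⟨c, hc, h⟩ := hη x hx
      exact hc.le.trans h.self_of_nhds
    by_cases hxt : x ∈ tsupport (g n)
    · refine (hr n i hi x).trans ?_
      gcongr
      exact (min_le_left _ _).trans (hc n x hxt).2
    · have : x ∉ tsupport (iteratedFDeriv ℝ i (r n • g n)) := fun h =>
        hxt (closure_mono (Function.support_const_smul_subset _ _)
          (tsupport_iteratedFDeriv_subset i h))
      rw [image_eq_zero_of_notMem_tsupport this, norm_zero]
      positivity
  have hval : ∀ n x, ‖iteratedFDeriv ℝ 0 (r n • g n) x‖ = r n * g n x := by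
    intro n x
    rw [norm_iteratedFDeriv_zero, Pi.smul_apply, smul_eq_mul,
      Real.norm_of_nonneg (mul_nonneg (rpos n).le (g_nonneg n x))]
  have S : ∀ x, Summable fun n => (r n • g n) x := fun x =>
    Summable.of_norm_bounded hδsum.summable fun n => by
      simpa only [norm_iteratedFDeriv_zero] using hrδ n 0 (Nat.zero_le _) x
  have hfd : ∀ x, fderiv ℝ (fun x => ∑' n, (r n • g n) x) x = ∑' n, fderiv ℝ (r n • g n) x :=
    fderiv_tsum_apply (x₀ := x₀) hδsum.summable
      (fun n => ((g_smooth n).const_smul (r n)).differentiable (by simp))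
      (fun n x => by
        rw [← norm_iteratedFDeriv_one]
        exact hrδ n 1 (by omega) x) (S x₀)
  refine ⟨fun x => ∑' n, (r n • g n) x, ?_, fun x hx => ?_, fun x hx => ?_, fun x hx => ?_⟩
  · refine contDiff_tsum_of_eventually (N := ⊤) (v := fun _ n => (δ n : ℝ))
      (fun k => (g_smooth k).const_smul (r k)) (fun k _ => hδsum.summable) ?_
    intro i _
    simp only [Nat.cofinite_eq_atTop, Filter.eventually_atTop]
    exact ⟨i, fun n hn x => hrδ n i (by omega) x⟩
  · obtain ⟨n, hn⟩ := s_g x hx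
    exact (S x).tsum_pos (fun i => mul_nonneg (rpos i).le (g_nonneg i x)) n
      (mul_pos (rpos n) (lt_of_le_of_ne (g_nonneg n x) (Ne.symm hn)))
  · have : ∀ n, g n x = 0 := fun n => by
      by_contra h
      exact hx (hc n x (subset_tsupport _ h)).1
    simp [this]
  · have hη0 : 0 ≤ η x := by
      obtain ⟨c, hc, h⟩ := hη x hx
      exact hc.le.trans h.self_of_nhds
    have hDη : (D : ℝ) * η x ≤ η x := mul_le_of_le_one_left hη0 (by exact_mod_cast D_lt.le)
    constructor
    · have : ‖∑' n, (r n • g n) x‖ ≤ D * η x := by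
        refine tsum_of_norm_bounded (hδsum.mul_right (η x)) fun n => ?_
        simpa only [norm_iteratedFDeriv_zero] using hrc n 0 (Nat.zero_le _) x hx
      exact (Real.le_norm_self _).trans (this.trans hDη)
    · rw [hfd]
      refine (tsum_of_norm_bounded (hδsum.mul_right (η x)) fun n => ?_).trans hDη
      rw [← norm_iteratedFDeriv_one]
      exact hrc n 1 (by omega) x hx

/-- On an open set there is a positive smooth function whose value and derivative satisfy a given
condition that holds for all sufficiently small values and derivatives. -/
theorem exists_contDiff_of_eventually {s : Set X} (hs : IsOpen s)
    {P : X → ℝ → (X →L[ℝ] ℝ) → Prop}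
    (hP : ∀ x ∈ s, ∀ᶠ q : X × ℝ × (X →L[ℝ] ℝ) in 𝓝 (x, 0, 0),
      0 ≤ q.2.1 → P q.1 q.2.1 q.2.2) :
    ∃ f : X → ℝ, ContDiff ℝ ∞ f ∧ (∀ x ∈ s, 0 < f x) ∧ (∀ x ∉ s, f x = 0) ∧
      ∀ x ∈ s, ∀ t ∈ Icc (0 : ℝ) 1, P x (t * f x) (t • fderiv ℝ f x) := by
  set A : X → Set ℝ := fun x =>
    {c | c ∈ Ioc 0 1 ∧ ∀ σ ∈ Icc 0 c, ∀ l : X →L[ℝ] ℝ, ‖l‖ ≤ c → P x σ l} with hA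
  have hbdd : ∀ x, BddAbove (A x) := fun x => ⟨1, fun c hc => hc.1.2⟩
  have hloc : ∀ x ∈ s, ∃ c > 0, ∀ᶠ y in 𝓝 x, c ∈ A y := by
    intro x hx
    obtain ⟨r, hr, hball⟩ := Metric.eventually_nhds_iff_ball.1 (hP x hx)
    refine ⟨min (r / 2) 1, by positivity, ?_⟩
    filter_upwards [Metric.ball_mem_nhds x hr] with y hy
    refine ⟨⟨by positivity, min_le_right _ _⟩, fun σ hσ l hl => hball (y, σ, l) ?_ hσ.1⟩
    have hlt : min (r / 2) 1 < r := (min_le_left _ _).trans_lt (half_lt_self hr)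
    rw [← ball_prod_same, ← ball_prod_same]
    refine ⟨hy, ?_, ?_⟩
    · rw [Metric.mem_ball, Real.dist_eq, sub_zero, abs_of_nonneg hσ.1]
      exact hσ.2.trans_lt hlt
    · rw [Metric.mem_ball, dist_zero_right]
      exact hl.trans_lt hlt
  -- Half of the supremum of the admissible bounds is used because the supremum need not be
  -- attained; above its half there is an admissible bound.
  obtain ⟨f, hf, hpos, hzero, hle⟩ := exists_contDiff_le hs (η := fun x => sSup (A x) / 2)
    fun x hx => by
      obtain ⟨c, hc, h⟩ := hloc x hx
      exact ⟨c / 2, by positivity, h.mono fun y hy => by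
        have := le_csSup (hbdd y) hy
        linarith⟩
  refine ⟨f, hf, hpos, hzero, fun x hx t ht => ?_⟩
  obtain ⟨c₀, hc₀, h⟩ := hloc x hx
  have hlt : sSup (A x) / 2 < sSup (A x) :=
    half_lt_self (hc₀.trans_le (le_csSup (hbdd x) h.self_of_nhds))
  obtain ⟨c, hc, hlt'⟩ := exists_lt_of_lt_csSup ⟨c₀, h.self_of_nhds⟩ hlt
  obtain ⟨h1, h2⟩ := hle x hx
  have hfx := hpos x hx
  refine hc.2 _ ⟨mul_nonneg ht.1 hfx.le, ?_⟩ _ ?_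
  · calc t * f x ≤ 1 * f x := by gcongr; exact ht.2
      _ ≤ c := by linarith
  · calc ‖t • fderiv ℝ f x‖ = t * ‖fderiv ℝ f x‖ := by
          rw [norm_smul, Real.norm_of_nonneg ht.1]
      _ ≤ 1 * ‖fderiv ℝ f x‖ := by gcongr; exact ht.2
      _ ≤ c := by linarith

/-! ### Small perturbations of the identity -/

/-- The derivative of the sum is invertible by the Neumann series, so the inverse homeomorphism is
smooth. -/
theorem exists_contDiff_inverse [Nontrivial X] {G : X → X} (hG : ContDiff ℝ ∞ G)
    (hG' : ∀ x, ‖fderiv ℝ G x‖ ≤ 1 / 2) :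
    ∃ e : X ≃ₜ X, (∀ x, e x = x + G x) ∧ ContDiff ℝ ∞ e.symm := by
  have hlip : LipschitzWith (1 / 2) G := by
    refine lipschitzWith_of_nnnorm_fderiv_le (hG.differentiable (by simp)) fun x => ?_
    rw [← NNReal.coe_le_coe]
    simpa using hG' x
  have : CompleteSpace X := FiniteDimensional.complete ℝ X
  set e := (isHomeomorph_add_of_lipschitzWith hlip (by
    rw [← NNReal.coe_lt_coe]
    norm_num)).homeomorph with he
  refine ⟨e, fun x => rfl, ?_⟩
  have hlt : ∀ x, ‖-fderiv ℝ G x‖ < 1 := fun x => by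
    rw [norm_neg]
    linarith [hG' x]
  refine e.contDiff_symm
    (f₀' := fun x => ContinuousLinearEquiv.unitsEquiv ℝ X (Units.oneSub _ (hlt x))) (fun x => ?_) ?_
  · have h := (hasFDerivAt_id x).add (hG.differentiable (by simp) x).hasFDerivAt
    have e' : ((ContinuousLinearEquiv.unitsEquiv ℝ X (Units.oneSub _ (hlt x)) : X ≃L[ℝ] X) :
        X →L[ℝ] X) = ContinuousLinearMap.id ℝ X + fderiv ℝ G x := by
      ext y
      simp [ContinuousLinearEquiv.unitsEquiv, ContinuousLinearEquiv.ofUnit]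
    rw [e']
    exact h
  · exact contDiff_id.add hG

end SmallFunctions

/-! ### Rotations in a plane of `ℝ⁴` -/

/-- The skew-symmetric endomorphism of the bivector `d₁ ∧ d₂`. -/
def skewMap (d₁ d₂ : E 4) : E 4 →ₗ[ℝ] E 4 :=
  (innerₛₗ ℝ d₂).smulRight d₁ - (innerₛₗ ℝ d₁).smulRight d₂

/-- The squared area of the parallelogram spanned by two vectors. -/
def gram (d₁ d₂ : E 4) : ℝ := ⟪d₁, d₁⟫_ℝ * ⟪d₂, d₂⟫_ℝ - ⟪d₁, d₂⟫_ℝ ^ 2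

/-- The Cayley transform of `σ • skewMap d₁ d₂`. -/
def cayley (σ : ℝ) (d₁ d₂ : E 4) : E 4 →ₗ[ℝ] E 4 :=
  LinearMap.id + (2 * σ / (1 + σ ^ 2 * gram d₁ d₂)) • skewMap d₁ d₂ +
    (2 * σ ^ 2 / (1 + σ ^ 2 * gram d₁ d₂)) • (skewMap d₁ d₂ ∘ₗ skewMap d₁ d₂)

theorem skewMap_apply (d₁ d₂ z : E 4) :
    skewMap d₁ d₂ z = ⟪d₂, z⟫_ℝ • d₁ - ⟪d₁, z⟫_ℝ • d₂ := by
  simp [skewMap]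

theorem cayley_apply (σ : ℝ) (d₁ d₂ z : E 4) :
    cayley σ d₁ d₂ z = z + (2 * σ / (1 + σ ^ 2 * gram d₁ d₂)) • skewMap d₁ d₂ z +
      (2 * σ ^ 2 / (1 + σ ^ 2 * gram d₁ d₂)) • skewMap d₁ d₂ (skewMap d₁ d₂ z) := rfl

theorem gram_nonneg (d₁ d₂ : E 4) : 0 ≤ gram d₁ d₂ := by
  have := real_inner_mul_inner_self_le d₁ d₂
  unfold gram
  linarith [sq ⟪d₁, d₂⟫_ℝ]

theorem one_add_gram_pos (σ : ℝ) (d₁ d₂ : E 4) : 0 < 1 + σ ^ 2 * gram d₁ d₂ := by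
  have := gram_nonneg d₁ d₂
  positivity

theorem inner_skewMap (d₁ d₂ y z : E 4) :
    ⟪y, skewMap d₁ d₂ z⟫_ℝ = ⟪d₂, z⟫_ℝ * ⟪d₁, y⟫_ℝ - ⟪d₁, z⟫_ℝ * ⟪d₂, y⟫_ℝ := by
  rw [skewMap_apply, inner_sub_right, inner_smul_right, inner_smul_right, real_inner_comm y d₁,
    real_inner_comm y d₂]

theorem skewMap_skew (d₁ d₂ y z : E 4) :
    ⟪skewMap d₁ d₂ y, z⟫_ℝ = -⟪y, skewMap d₁ d₂ z⟫_ℝ := by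
  rw [real_inner_comm, inner_skewMap, inner_skewMap]
  ring

/-- On the plane of `d₁, d₂` the map is a quarter turn scaled by the square root of `gram`, and it
kills the orthogonal complement. Hence the Cayley transform is a quadratic polynomial in it, with a
formula that stays smooth where `d₁` and `d₂` become dependent. -/
theorem skewMap_cube (d₁ d₂ z : E 4) :
    skewMap d₁ d₂ (skewMap d₁ d₂ (skewMap d₁ d₂ z)) = -(gram d₁ d₂) • skewMap d₁ d₂ z := by
  have h : ∀ y, skewMap d₁ d₂ (skewMap d₁ d₂ y) =
      (⟪d₁, y⟫_ℝ * ⟪d₁, d₂⟫_ℝ * 1) • d₂ + (⟪d₂, y⟫_ℝ * ⟪d₁, d₂⟫_ℝ) • d₁ -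
        (⟪d₂, y⟫_ℝ * ⟪d₁, d₁⟫_ℝ) • d₂ - (⟪d₁, y⟫_ℝ * ⟪d₂, d₂⟫_ℝ) • d₁ := by
    intro y
    rw [skewMap_apply d₁ d₂ (skewMap d₁ d₂ y), inner_skewMap, inner_skewMap,
      real_inner_comm d₁ d₂]
    module
  rw [h, inner_skewMap, inner_skewMap, skewMap_apply, gram, real_inner_comm d₁ d₂]
  module

theorem norm_cayley (σ : ℝ) (d₁ d₂ z : E 4) : ‖cayley σ d₁ d₂ z‖ = ‖z‖ := by
  have hpos := one_add_gram_pos σ d₁ d₂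
  rw [← sq_eq_sq₀ (norm_nonneg _) (norm_nonneg _), ← real_inner_self_eq_norm_sq,
    ← real_inner_self_eq_norm_sq, cayley_apply]
  set B := skewMap d₁ d₂ with hB
  set α := 2 * σ / (1 + σ ^ 2 * gram d₁ d₂) with hα
  set β := 2 * σ ^ 2 / (1 + σ ^ 2 * gram d₁ d₂) with hβ
  have h1 : ⟪z, B z⟫_ℝ = 0 := by
    have := skewMap_skew d₁ d₂ z z
    rw [real_inner_comm] at this
    linarith
  have h2 : ⟪z, B (B z)⟫_ℝ = -⟪B z, B z⟫_ℝ := by linarith [skewMap_skew d₁ d₂ z (B z)]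
  have h3 : ⟪B z, B (B z)⟫_ℝ = 0 := by
    have := skewMap_skew d₁ d₂ (B z) (B z)
    rw [real_inner_comm] at this
    linarith
  have h4 : ⟪B (B z), B (B z)⟫_ℝ = gram d₁ d₂ * ⟪B z, B z⟫_ℝ := by
    have := skewMap_skew d₁ d₂ (B z) (B (B z))
    rw [skewMap_cube, inner_smul_right] at this
    linarith
  have h5 : α ^ 2 + β ^ 2 * gram d₁ d₂ = 2 * β := by
    rw [hα, hβ]
    field_simp
  simp only [inner_add_left, inner_add_right, inner_smul_left, inner_smul_right,
    real_inner_comm z (B z), real_inner_comm z (B (B z)), real_inner_comm (B z) (B (B z)),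
    h1, h2, h3, h4, conj_trivial]
  linear_combination ⟪B z, B z⟫_ℝ * h5

/-- The Cayley transform as a linear isometry. -/
def cayleyIsometry (σ : ℝ) (d₁ d₂ : E 4) : E 4 ≃ₗᵢ[ℝ] E 4 :=
  (⟨cayley σ d₁ d₂, norm_cayley σ d₁ d₂⟩ : E 4 →ₗᵢ[ℝ] E 4).toLinearIsometryEquiv rfl

/-- The Cayley transform is `(1 + S)(1 - S)⁻¹` with `S` skew. The two factors are adjoint, so their
determinants agree, and `1 - S` is injective because `⟪z, S z⟫ = 0`. -/
theorem det_cayley (σ : ℝ) (d₁ d₂ : E 4) : LinearMap.det (cayley σ d₁ d₂) = 1 := by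
  set S := σ • skewMap d₁ d₂ with hS
  have hadj : LinearMap.adjoint (LinearMap.id + S) = LinearMap.id - S := by
    symm
    rw [LinearMap.eq_adjoint_iff]
    intro y z
    simp only [LinearMap.sub_apply, LinearMap.add_apply, LinearMap.id_apply, hS,
      LinearMap.smul_apply, inner_sub_left, inner_add_right, inner_smul_left, inner_smul_right,
      skewMap_skew, conj_trivial]
    ring
  have hdet : LinearMap.det (LinearMap.id - S) = LinearMap.det (LinearMap.id + S) := by
    rw [← hadj, ← LinearMap.det_toMatrix (stdOrthonormalBasis ℝ (E 4)).toBasis,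
      LinearMap.toMatrix_adjoint, Matrix.det_conjTranspose, star_trivial, LinearMap.det_toMatrix]
  have hcomp : cayley σ d₁ d₂ ∘ₗ (LinearMap.id - S) = LinearMap.id + S := by
    have hpos := (one_add_gram_pos σ d₁ d₂).ne'
    ext1 z
    simp only [LinearMap.comp_apply, LinearMap.sub_apply, LinearMap.add_apply, LinearMap.id_apply,
      hS, LinearMap.smul_apply, cayley_apply, map_sub, map_smul, skewMap_cube]
    match_scalars <;> field_simp <;> ring
  have hne : LinearMap.det (LinearMap.id - S) ≠ 0 := by
    intro h0
    obtain ⟨z, hz, hz0⟩ := Submodule.exists_mem_ne_zero_of_ne_bot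
      (LinearMap.bot_lt_ker_of_det_eq_zero h0).ne'
    rw [LinearMap.mem_ker, LinearMap.sub_apply, LinearMap.id_apply, sub_eq_zero] at hz
    have h1 : ⟪z, skewMap d₁ d₂ z⟫_ℝ = 0 := by
      have := skewMap_skew d₁ d₂ z z
      rw [real_inner_comm] at this
      linarith
    have : ⟪z, z⟫_ℝ = 0 := by
      nth_rw 2 [hz]
      rw [hS, LinearMap.smul_apply, inner_smul_right, h1, mul_zero]
    exact hz0 (inner_self_eq_zero.1 this)
  have := congrArg LinearMap.det hcomp
  rw [LinearMap.det_comp, ← hdet] at this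
  exact mul_right_cancel₀ hne (by rw [this, one_mul])

theorem cayley_of_orthogonal (σ : ℝ) {d₁ d₂ z : E 4} (h₁ : ⟪d₁, z⟫_ℝ = 0) (h₂ : ⟪d₂, z⟫_ℝ = 0) :
    cayley σ d₁ d₂ z = z := by
  have : skewMap d₁ d₂ z = 0 := by simp [skewMap_apply, h₁, h₂]
  simp [cayley_apply, this]

theorem cayley_zero (d₁ d₂ z : E 4) : cayley 0 d₁ d₂ z = z := by
  simp [cayley_apply]

/-! ### The twist -/

/-- The component of `z` orthogonal to `e`, scaled by `‖e‖²`. -/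
def orthComponent (e z : E 4) : E 4 := ⟪e, e⟫_ℝ • z - ⟪e, z⟫_ℝ • e

/-- The weight of `x 0` in the intersection point of the lines `x 0 x 3` and `x 2 x 5`. -/
def apexCoeff₀ (x : Tuple) : ℝ :=
  -⟪orthComponent (x 2 - x 5) (x 3 - x 5), orthComponent (x 2 - x 5) (x 0 - x 5)⟫_ℝ

/-- The weight of `x 3` in the intersection point of the lines `x 0 x 3` and `x 2 x 5`. -/
def apexCoeff₃ (x : Tuple) : ℝ :=
  ⟪orthComponent (x 2 - x 5) (x 0 - x 5), orthComponent (x 2 - x 5) (x 0 - x 5)⟫_ℝ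

/-- The vector part of homogeneous coordinates of the common point of the lines of a prism. -/
def apexVector (x : Tuple) : E 4 := apexCoeff₀ x • x 0 + apexCoeff₃ x • x 3

/-- The last homogeneous coordinate of the common point of the lines of a prism. -/
def apexWeight (x : Tuple) : ℝ := apexCoeff₀ x + apexCoeff₃ x

/-- A vector in the directions of the circle `T_p ∩ P` of a prism. -/
def circleVector (x : Tuple) (j : Fin 6) : E 4 :=
  ⟪apexVector x, x 3 - x 0⟫_ℝ • (x j - x 0) - ⟪apexVector x, x j - x 0⟫_ℝ • (x 3 - x 0)

/-- The squared area spanned by the two circle vectors of a prism; it vanishes if the prism is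
planar. -/
def prismGram (x : Tuple) : ℝ := gram (circleVector x 2) (circleVector x 4)

/-- The rotation used to twist a prism. -/
def twistRotation (σ : ℝ) (x : Tuple) : E 4 →ₗ[ℝ] E 4 :=
  cayley σ (circleVector x 2) (circleVector x 4)

/-- Twisting one half of a prism. -/
def twist (σ : ℝ) (x : Tuple) : Tuple :=
  ![twistRotation σ x (x 0), x 1, twistRotation σ x (x 2), x 3, twistRotation σ x (x 4), x 5]

@[fun_prop]
theorem contDiff_real_inner {X : Type*} [NormedAddCommGroup X] [NormedSpace ℝ X] {n : ℕ}
    {f g : X → E n} (hf : ContDiff ℝ ∞ f) (hg : ContDiff ℝ ∞ g) :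
    ContDiff ℝ ∞ fun x => ⟪f x, g x⟫_ℝ :=
  hf.inner ℝ hg

/-- The apex is a polynomial in the vertices rather than a chosen point `p`. The twist is therefore
smooth on all tuples, including those that are planar, not injective or not prisms. -/
theorem contDiff_circleVector (j : Fin 6) : ContDiff ℝ ∞ fun x : Tuple => circleVector x j := by
  unfold circleVector apexVector apexCoeff₀ apexCoeff₃ orthComponent
  fun_prop

theorem contDiff_apexVector : ContDiff ℝ ∞ apexVector := by
  unfold apexVector apexCoeff₀ apexCoeff₃ orthComponent
  fun_prop

theorem contDiff_apexWeight : ContDiff ℝ ∞ apexWeight := by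
  unfold apexWeight apexCoeff₀ apexCoeff₃ orthComponent
  fun_prop

theorem contDiff_prismGram : ContDiff ℝ ∞ prismGram := by
  have h2 := contDiff_circleVector 2
  have h4 := contDiff_circleVector 4
  unfold prismGram gram
  fun_prop

theorem contDiff_twistRotation (i : Fin 6) :
    ContDiff ℝ ∞ fun q : ℝ × Tuple => twistRotation q.1 q.2 (q.2 i) := by
  have h2 : ContDiff ℝ ∞ fun q : ℝ × Tuple => circleVector q.2 2 :=
    (contDiff_circleVector 2).comp contDiff_snd
  have h4 : ContDiff ℝ ∞ fun q : ℝ × Tuple => circleVector q.2 4 :=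
    (contDiff_circleVector 4).comp contDiff_snd
  have hg : ContDiff ℝ ∞ fun q : ℝ × Tuple => gram (circleVector q.2 2) (circleVector q.2 4) :=
    contDiff_prismGram.comp contDiff_snd
  have hne : ∀ q : ℝ × Tuple,
      1 + q.1 ^ 2 * gram (circleVector q.2 2) (circleVector q.2 4) ≠ 0 :=
    fun q => (one_add_gram_pos _ _ _).ne'
  have hB : ∀ {g : ℝ × Tuple → E 4}, ContDiff ℝ ∞ g →
      ContDiff ℝ ∞ fun q => skewMap (circleVector q.2 2) (circleVector q.2 4) (g q) := by
    intro g hg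
    simp only [skewMap_apply]
    fun_prop
  have hx : ContDiff ℝ ∞ fun q : ℝ × Tuple => q.2 i := by fun_prop
  have h₁ : ContDiff ℝ ∞ fun q : ℝ × Tuple =>
      2 * q.1 / (1 + q.1 ^ 2 * gram (circleVector q.2 2) (circleVector q.2 4)) :=
    ContDiff.div (by fun_prop) (by fun_prop) hne
  have h₂ : ContDiff ℝ ∞ fun q : ℝ × Tuple =>
      2 * q.1 ^ 2 / (1 + q.1 ^ 2 * gram (circleVector q.2 2) (circleVector q.2 4)) :=
    ContDiff.div (by fun_prop) (by fun_prop) hne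
  have hBx := hB hx
  have hBBx := hB (hB hx)
  simp only [twistRotation, cayley_apply]
  fun_prop

theorem contDiff_twist : ContDiff ℝ ∞ fun q : ℝ × Tuple => twist q.1 q.2 := by
  rw [contDiff_pi]
  intro i
  fin_cases i
  exacts [contDiff_twistRotation 0, by simp [twist]; fun_prop, contDiff_twistRotation 2,
    by simp [twist]; fun_prop, contDiff_twistRotation 4, by simp [twist]; fun_prop]

theorem twist_zero (x : Tuple) : twist 0 x = x := by
  funext i
  fin_cases i <;> simp [twist, twistRotation, cayley_zero]

theorem norm_twist (σ : ℝ) (x : Tuple) (i : Fin 6) : ‖twist σ x i‖ = ‖x i‖ := by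
  fin_cases i <;> simp [twist, twistRotation, norm_cayley]

/-! ### Prisms in homogeneous coordinates -/

/-- The vector `(v, w)` represents a point outside the ball through which the lines
`x i x (i + 3)` pass, with the points of even index on its negative side. -/
structure IsPrismVector (x : Tuple) (k : Fin 6 → ℝ) (v : E 4) (w : ℝ) : Prop where
  line : ∀ i, k i • x i + k (i + 3) • x (i + 3) = v
  sum : ∀ i, k i + k (i + 3) = w
  neg : k 0 < 0 ∧ k 2 < 0 ∧ k 4 < 0
  pos : 0 < k 1 ∧ 0 < k 3 ∧ 0 < k 5

theorem inner_self_of_mem_S3 {z : E 4} (hz : z ∈ S3) : ⟪z, z⟫_ℝ = 1 := by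
  rw [real_inner_self_eq_norm_sq, mem_sphere_zero_iff_norm.1 hz, one_pow]

theorem inner_lt_one_of_ne {y z : E 4} (hy : y ∈ S3) (hz : z ∈ S3) (h : y ≠ z) :
    ⟪y, z⟫_ℝ < 1 :=
  (inner_lt_one_iff_real_of_norm_eq_one (mem_sphere_zero_iff_norm.1 hy)
    (mem_sphere_zero_iff_norm.1 hz)).2 h

theorem inner_add_smul_sub {y z : E 4} (hy : y ∈ S3) (a b : ℝ) :
    ⟪a • y + b • z, y⟫_ℝ - (a + b) = b * (⟪y, z⟫_ℝ - 1) := by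
  rw [inner_add_left, inner_smul_left, inner_smul_left, inner_self_of_mem_S3 hy,
    real_inner_comm y z]
  simp
  ring

theorem norm_sq_sub_weight_sq {y z : E 4} (hy : y ∈ S3) (hz : z ∈ S3) (a b : ℝ) :
    ‖a • y + b • z‖ ^ 2 - (a + b) ^ 2 = 2 * (a * b) * (⟪y, z⟫_ℝ - 1) := by
  rw [← real_inner_self_eq_norm_sq]
  simp only [inner_add_left, inner_add_right, inner_smul_left, inner_smul_right,
    inner_self_of_mem_S3 hy, inner_self_of_mem_S3 hz, real_inner_comm y z, conj_trivial]
  ring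

namespace IsPrismVector

variable {x : Tuple} {k : Fin 6 → ℝ} {v : E 4} {w : ℝ}

theorem coeff_ne_zero (h : IsPrismVector x k v w) (i : Fin 6) : k i ≠ 0 := by
  obtain ⟨n0, n2, n4⟩ := h.neg
  obtain ⟨p1, p3, p5⟩ := h.pos
  fin_cases i
  exacts [n0.ne, p1.ne', n2.ne, p3.ne', n4.ne, p5.ne']

theorem smul (h : IsPrismVector x k v w) {c : ℝ} (hc : 0 < c) :
    IsPrismVector x (c • k) (c • v) (c * w) where
  line i := by simp only [Pi.smul_apply, smul_assoc, ← smul_add, h.line i]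
  sum i := by simp only [Pi.smul_apply, smul_eq_mul, ← mul_add, h.sum i]
  neg := ⟨mul_neg_of_pos_of_neg hc h.neg.1, mul_neg_of_pos_of_neg hc h.neg.2.1,
    mul_neg_of_pos_of_neg hc h.neg.2.2⟩
  pos := ⟨mul_pos hc h.pos.1, mul_pos hc h.pos.2.1, mul_pos hc h.pos.2.2⟩

/-- The side of `T_p` on which a vertex lies is thus read off from the sign of the coefficient of
the opposite vertex. Opposite signs on a line say that the apex is outside the ball, so the signs of
`k` encode both conditions on a prism. -/
theorem polar_eq (hx : x ∈ C6) (h : IsPrismVector x k v w) (i : Fin 6) :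
    ⟪v, x i⟫_ℝ - w = k (i + 3) * (⟪x i, x (i + 3)⟫_ℝ - 1) := by
  rw [← h.line i, ← h.sum i, inner_add_smul_sub (hx.1 i)]

theorem inner_sub_one_neg (hx : x ∈ C6) (i : Fin 6) : ⟪x i, x (i + 3)⟫_ℝ - 1 < 0 := by
  have hne : x i ≠ x (i + 3) := hx.2.ne (by fin_cases i <;> decide)
  linarith [inner_lt_one_of_ne (hx.1 i) (hx.1 (i + 3)) hne]

theorem polar_neg (hx : x ∈ C6) (h : IsPrismVector x k v w) :
    ⟪v, x 0⟫_ℝ - w < 0 ∧ ⟪v, x 2⟫_ℝ - w < 0 ∧ ⟪v, x 4⟫_ℝ - w < 0 := by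
  rw [h.polar_eq hx 0, h.polar_eq hx 2, h.polar_eq hx 4]
  exact ⟨mul_neg_of_pos_of_neg h.pos.2.1 (inner_sub_one_neg hx 0),
    mul_neg_of_pos_of_neg h.pos.2.2 (inner_sub_one_neg hx 2),
    mul_neg_of_pos_of_neg h.pos.1 (inner_sub_one_neg hx 4)⟩

theorem polar_pos (hx : x ∈ C6) (h : IsPrismVector x k v w) :
    0 < ⟪v, x 1⟫_ℝ - w ∧ 0 < ⟪v, x 3⟫_ℝ - w ∧ 0 < ⟪v, x 5⟫_ℝ - w := by
  rw [h.polar_eq hx 1, h.polar_eq hx 3, h.polar_eq hx 5]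
  exact ⟨mul_pos_of_neg_of_neg h.neg.2.2 (inner_sub_one_neg hx 1),
    mul_pos_of_neg_of_neg h.neg.1 (inner_sub_one_neg hx 3),
    mul_pos_of_neg_of_neg h.neg.2.1 (inner_sub_one_neg hx 5)⟩

theorem polar_ne_zero (hx : x ∈ C6) (h : IsPrismVector x k v w) (i : Fin 6) :
    ⟪v, x i⟫_ℝ - w ≠ 0 := by
  rw [h.polar_eq hx]
  exact mul_ne_zero (h.coeff_ne_zero _) (inner_sub_one_neg hx i).ne

theorem sq_lt_norm_sq (hx : x ∈ C6) (h : IsPrismVector x k v w) : w ^ 2 < ‖v‖ ^ 2 := by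
  have h1 := norm_sq_sub_weight_sq (hx.1 0) (hx.1 3) (k 0) (k 3)
  have e1 : k 0 • x 0 + k 3 • x 3 = v := h.line 0
  have e2 : k 0 + k 3 = w := h.sum 0
  rw [e1, e2] at h1
  have h2 : 0 < k 0 * k 3 * (⟪x 0, x 3⟫_ℝ - 1) :=
    mul_pos_of_neg_of_neg (mul_neg_of_neg_of_pos h.neg.1 h.pos.2.1) (inner_sub_one_neg hx 0)
  linarith

theorem vector_ne_zero (hx : x ∈ C6) (h : IsPrismVector x k v w) : v ≠ 0 := by
  rintro rfl
  have := h.sq_lt_norm_sq hx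
  simp at this
  nlinarith

theorem ne_zero (hx : x ∈ C6) (h : IsPrismVector x k v w) : ((v, w) : E 4 × ℝ) ≠ 0 :=
  fun h0 => h.vector_ne_zero hx (congrArg Prod.fst h0)

theorem isPrism_mk (hx : x ∈ C6) (h : IsPrismVector x k v w) :
    IsPrism (Projectivization.mk ℝ (v, w) (h.ne_zero hx)) x := by
  set p := Projectivization.mk ℝ ((v, w) : E 4 × ℝ) (h.ne_zero hx) with hp
  have hsub : p.submodule = ℝ ∙ ((v, w) : E 4 × ℝ) := Projectivization.submodule_mk _ _
  refine ⟨?_, fun i => ⟨?_, ?_⟩⟩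
  · rintro ⟨y, hy, hpy⟩
    rw [hsub] at hpy
    have hmem : ((v, w) : E 4 × ℝ) ∈ ℝ ∙ ((y, 1) : E 4 × ℝ) := by
      rw [← hpy]
      exact Submodule.mem_span_singleton_self _
    obtain ⟨c, hc⟩ := Submodule.mem_span_singleton.1 hmem
    have h1 : c • y = v := congrArg Prod.fst hc
    have h2 : c = w := by simpa using congrArg Prod.snd hc
    have h3 := h.sq_lt_norm_sq hx
    rw [← h1, ← h2, norm_smul, mul_pow, Real.norm_eq_abs, sq_abs] at h3
    have h4 : ‖y‖ ^ 2 ≤ 1 := pow_le_one₀ (norm_nonneg _) hy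
    nlinarith [sq_nonneg c]
  · rw [OnLine, hsub, Submodule.span_singleton_le_iff_mem, Submodule.mem_span_pair]
    refine ⟨k i, k (i + 3), Prod.ext ?_ ?_⟩
    · simpa using h.line i
    · simpa using h.sum i
  · obtain ⟨c, hc⟩ := Projectivization.exists_smul_eq_mk_rep ℝ (v, w) (h.ne_zero hx)
    have hc' : p.rep = ((c : ℝ) • v, (c : ℝ) * w) := hc.symm
    have hpol : ∀ j, polarForm p (x j) = (c : ℝ) * (⟪v, x j⟫_ℝ - w) := by
      intro j
      rw [polarForm, hc', inner_smul_left]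
      simp
      ring
    rw [SameSide, hpol, hpol]
    have hc2 : 0 < (c : ℝ) * c := mul_self_pos.2 c.ne_zero
    suffices 0 < (⟪v, x i⟫_ℝ - w) * (⟪v, x (i + 2)⟫_ℝ - w) by nlinarith
    obtain ⟨n0, n2, n4⟩ := h.polar_neg hx
    obtain ⟨p1, p3, p5⟩ := h.polar_pos hx
    fin_cases i
    exacts [mul_pos_of_neg_of_neg n0 n2, mul_pos p1 p3, mul_pos_of_neg_of_neg n2 n4,
      mul_pos p3 p5, mul_pos_of_neg_of_neg n4 n0, mul_pos p5 p1]

end IsPrismVector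

theorem norm_sq_of_notMem_B4 {p : RP4} (hp : p ∉ B4) : p.rep.2 ^ 2 < ‖p.rep.1‖ ^ 2 := by
  by_contra! hle
  have habs : ‖p.rep.1‖ ≤ |p.rep.2| := by
    rw [← abs_of_nonneg (norm_nonneg p.rep.1)]
    exact sq_le_sq.1 hle
  have hw : p.rep.2 ≠ 0 := by
    intro h0
    rw [h0, abs_zero] at habs
    exact p.rep_nonzero (Prod.ext (norm_le_zero_iff.1 habs) h0)
  refine hp ⟨p.rep.2⁻¹ • p.rep.1, ?_, ?_⟩
  · rw [norm_smul, norm_inv, Real.norm_eq_abs, inv_mul_le_iff₀ (abs_pos.2 hw), mul_one]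
    exact habs
  · have e : p.rep = p.rep.2 • ((p.rep.2⁻¹ • p.rep.1, 1) : E 4 × ℝ) := by
      refine Prod.ext ?_ ?_
      · simp [smul_smul, mul_inv_cancel₀ hw]
      · simp
    rw [p.submodule_eq]
    nth_rw 1 [e]
    exact Submodule.span_singleton_smul_eq (IsUnit.mk0 _ hw) _

theorem IsPrism.exists_isPrismVector {p : RP4} {x : Tuple} (hx : x ∈ C6) (h : IsPrism p x) :
    ∃ k v w, IsPrismVector x k v w := by
  obtain ⟨hp, h⟩ := h
  have hline : ∀ i, ∃ a b : ℝ, a • x i + b • x (i + 3) = p.rep.1 ∧ a + b = p.rep.2 := by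
    intro i
    have := (h i).1
    rw [OnLine, p.submodule_eq, Submodule.span_singleton_le_iff_mem, Submodule.mem_span_pair]
      at this
    obtain ⟨a, b, hab⟩ := this
    refine ⟨a, b, ?_, ?_⟩
    · rw [← hab]; simp
    · rw [← hab]; simp
  choose a b hv hw using hline
  have hpol : ∀ i, polarForm p (x i) = b i * (⟪x i, x (i + 3)⟫_ℝ - 1) := by
    intro i
    rw [polarForm, ← inner_add_smul_sub (hx.1 i) (a i), hv, hw]
  have hneg := IsPrismVector.inner_sub_one_neg hx
  have hside : ∀ i, 0 < b i * b (i + 2) := by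
    intro i
    have h1 := (h i).2
    rw [SameSide, hpol, hpol] at h1
    nlinarith [mul_pos_of_neg_of_neg (hneg i) (hneg (i + 2))]
  have hab : ∀ i, a i * b i < 0 := by
    intro i
    have h1 := norm_sq_sub_weight_sq (hx.1 i) (hx.1 (i + 3)) (a i) (b i)
    rw [hv, hw] at h1
    have h2 := norm_sq_of_notMem_B4 hp
    by_contra! h3
    nlinarith [mul_nonneg h3 (neg_nonneg.2 (hneg i).le)]
  have s0 : 0 < b 0 * b 2 := hside 0
  have s2 : 0 < b 2 * b 4 := hside 2
  -- The coefficients are taken from the lines with even index; the partner of 4 is 1, hence `b 4`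
  -- in position 1. The factor `c = ±1` normalizes the sign of the homogeneous coordinates.
  have key : ∀ c : ℝ, 0 < c * b 0 → 0 < c * b 2 → 0 < c * b 4 →
      IsPrismVector x ![c * a 0, c * b 4, c * a 2, c * b 0, c * a 4, c * b 2]
        (c • p.rep.1) (c * p.rep.2) := by
    intro c c0 c2 c4
    have hl : ∀ i, (c * a i) • x i + (c * b i) • x (i + 3) = c • p.rep.1 := fun i => by
      rw [← hv i, smul_add, smul_smul, smul_smul]
    have hl' : ∀ i, (c * b i) • x (i + 3) + (c * a i) • x i = c • p.rep.1 := fun i => by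
      rw [add_comm, hl]
    have hs : ∀ i, c * a i + c * b i = c * p.rep.2 := fun i => by rw [← mul_add, hw]
    have hs' : ∀ i, c * b i + c * a i = c * p.rep.2 := fun i => by rw [add_comm, hs]
    have hn : ∀ i, 0 < c * b i → c * a i < 0 := by
      intro i hi
      have h1 : c ≠ 0 := by rintro rfl; simp at hi
      have h2 : c * a i * (c * b i) < 0 := by
        have := hab i
        have : 0 < c * c := mul_self_pos.2 h1
        nlinarith
      exact (neg_iff_pos_of_mul_neg h2).2 hi
    refine ⟨fun i => ?_, fun i => ?_, ⟨hn 0 c0, hn 2 c2, hn 4 c4⟩, ⟨c4, c0, c2⟩⟩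
    · fin_cases i
      exacts [hl 0, hl' 4, hl 2, hl' 0, hl 4, hl' 2]
    · fin_cases i
      exacts [hs 0, hs' 4, hs 2, hs' 0, hs 4, hs' 2]
  rcases lt_trichotomy (b 0) 0 with h0 | h0 | h0
  · have h2 : b 2 < 0 := by nlinarith
    have h4 : b 4 < 0 := by nlinarith
    exact ⟨_, _, _, key (-1) (by linarith) (by linarith) (by linarith)⟩
  · rw [h0, zero_mul] at s0
    exact absurd s0 (lt_irrefl _)
  · have h2 : 0 < b 2 := (pos_iff_pos_of_mul_pos s0).1 h0
    have h4 : 0 < b 4 := (pos_iff_pos_of_mul_pos s2).1 h2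
    exact ⟨_, _, _, key 1 (by linarith) (by linarith) (by linarith)⟩

theorem mem_M_iff {x : Tuple} : x ∈ M ↔ x ∈ C6 ∧ ∃ k v w, IsPrismVector x k v w :=
  ⟨fun ⟨hx, _, hp⟩ => ⟨hx, hp.exists_isPrismVector hx⟩,
    fun ⟨hx, _, _, _, h⟩ => ⟨hx, _, h.isPrism_mk hx⟩⟩

/-! ### The apex of a prism -/

/-- Three distinct points of a sphere are not collinear. -/
theorem orthComponent_ne_zero {y₀ y₁ y₂ : E 4} (h₀ : y₀ ∈ S3) (h₁ : y₁ ∈ S3) (h₂ : y₂ ∈ S3)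
    (h01 : y₀ ≠ y₁) (h02 : y₀ ≠ y₂) (h12 : y₁ ≠ y₂) : orthComponent (y₁ - y₂) (y₀ - y₂) ≠ 0 := by
  intro h
  have i01 := inner_lt_one_of_ne h₀ h₁ h01
  have i02 := inner_lt_one_of_ne h₀ h₂ h02
  have i12 := inner_lt_one_of_ne h₁ h₂ h12
  rw [orthComponent] at h
  have e0 := congrArg (fun z => ⟪z, y₀⟫_ℝ) h
  have e1 := congrArg (fun z => ⟪z, y₁⟫_ℝ) h
  have e2 := congrArg (fun z => ⟪z, y₂⟫_ℝ) h
  simp only [inner_sub_left, inner_sub_right, inner_smul_left, inner_self_of_mem_S3 h₀,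
    inner_self_of_mem_S3 h₁, inner_self_of_mem_S3 h₂, inner_zero_left, real_inner_comm y₀ y₁,
    real_inner_comm y₀ y₂, real_inner_comm y₁ y₂, conj_trivial] at e0 e1 e2
  nlinarith [mul_pos (sub_pos.2 i01) (sub_pos.2 i02), mul_pos (sub_pos.2 i01) (sub_pos.2 i12),
    mul_pos (sub_pos.2 i02) (sub_pos.2 i12)]

theorem orthComponent_linear (e : E 4) (a b : ℝ) (y z : E 4) :
    orthComponent e (a • y + b • z) = a • orthComponent e y + b • orthComponent e z := by
  simp only [orthComponent, inner_add_right, inner_smul_right]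
  module

theorem orthComponent_self (e : E 4) : orthComponent e e = 0 := by
  simp [orthComponent]

/-- Equating the expressions of `v` on the lines `x 0 x 3` and `x 2 x 5` and removing the component
along `x 2 - x 5` leaves one linear relation between `k 0` and `k 3`. Pairing it with the component
of `x 0 - x 5` gives their ratio, which is that of the apex coefficients; the multiple is positive
because `k 3` and `apexCoeff₃ x` are. -/
theorem exists_isPrismVector_apex {x : Tuple} (hx : x ∈ M) :
    ∃ k, IsPrismVector x k (apexVector x) (apexWeight x) := by
  obtain ⟨hC, k, v, w, h⟩ := mem_M_iff.1 hx
  have hb : 0 < apexCoeff₃ x := real_inner_self_pos.2 (orthComponent_ne_zero (hC.1 0) (hC.1 2)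
    (hC.1 5) (hC.2.ne (by decide)) (hC.2.ne (by decide)) (hC.2.ne (by decide)))
  have l0 : k 0 • x 0 + k 3 • x 3 = v := h.line 0
  have l2 : k 2 • x 2 + k 5 • x 5 = v := h.line 2
  have s0 : k 0 + k 3 = w := h.sum 0
  have s2 : k 2 + k 5 = w := h.sum 2
  have hsub : k 0 • (x 0 - x 5) + k 3 • (x 3 - x 5) = k 2 • (x 2 - x 5) := by
    have : k 0 • (x 0 - x 5) + k 3 • (x 3 - x 5) =
        (k 0 • x 0 + k 3 • x 3) - (k 0 + k 3) • x 5 := by module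
    rw [this, l0, s0, ← l2, ← s2]
    module
  have horth := congrArg (orthComponent (x 2 - x 5)) hsub
  have e2 : orthComponent (x 2 - x 5) (k 2 • (x 2 - x 5)) = 0 := by
    have := orthComponent_linear (x 2 - x 5) (k 2) 0 (x 2 - x 5) (x 2 - x 5)
    simpa [orthComponent_self] using this
  rw [orthComponent_linear, e2] at horth
  have hin := congrArg (fun z => ⟪z, orthComponent (x 2 - x 5) (x 0 - x 5)⟫_ℝ) horth
  simp only [inner_add_left, inner_smul_left, inner_zero_left, conj_trivial] at hin
  have hrel : k 3 * apexCoeff₀ x = k 0 * apexCoeff₃ x := by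
    rw [apexCoeff₀, apexCoeff₃]
    linarith
  have hk3 : 0 < k 3 := h.pos.2.1
  have hA : apexCoeff₀ x = apexCoeff₃ x / k 3 * k 0 := by
    field_simp
    linarith
  have hB : apexCoeff₃ x = apexCoeff₃ x / k 3 * k 3 := by field_simp
  have := h.smul (c := apexCoeff₃ x / k 3) (by positivity)
  refine ⟨(apexCoeff₃ x / k 3) • k, ?_⟩
  convert this using 1
  · rw [apexVector, ← l0, smul_add, smul_smul, smul_smul, ← hA, ← hB]
  · rw [apexWeight, ← s0, mul_add, ← hA, ← hB]

/-! ### Planar prisms -/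

theorem circleVector_mem (x : Tuple) (j : Fin 6) :
    circleVector x j ∈ vectorSpan ℝ (range x) ⊓ (ℝ ∙ apexVector x)ᗮ := by
  have hv : ∀ i j, x i - x j ∈ vectorSpan ℝ (range x) := fun i j =>
    vsub_mem_vectorSpan ℝ (mem_range_self i) (mem_range_self j)
  refine ⟨Submodule.sub_mem _ (Submodule.smul_mem _ _ (hv _ _)) (Submodule.smul_mem _ _ (hv _ _)),
    ?_⟩
  rw [SetLike.mem_coe, Submodule.mem_orthogonal_singleton_iff_inner_right, circleVector,
    inner_sub_right,
    inner_smul_right, inner_smul_right]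
  ring

theorem inner_apexVector_pos {x : Tuple} (hx : x ∈ M) : 0 < ⟪apexVector x, x 3 - x 0⟫_ℝ := by
  obtain ⟨k, hk⟩ := exists_isPrismVector_apex hx
  rw [inner_sub_right]
  linarith [(hk.polar_neg hx.1).1, (hk.polar_pos hx.1).2.1]

/-- Both circle vectors lie in the at most two-dimensional direction space of `x` and are orthogonal
to the apex vector. As `x 3 - x 0` is not orthogonal to it, only one dimension is left for them. -/
theorem prismGram_eq_zero_of_mem_M₀ {x : Tuple} (hx : x ∈ M₀) : prismGram x = 0 := by
  obtain ⟨hxM, -, hcop⟩ := hx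
  set V := vectorSpan ℝ (range x) with hV
  have h2 : finrank ℝ V ≤ 2 := coplanar_iff_finrank_le_two.1 hcop
  have hlt : V ⊓ (ℝ ∙ apexVector x)ᗮ < V := by
    refine lt_of_le_of_ne inf_le_left fun he => ?_
    have h3 : x 3 - x 0 ∈ V := vsub_mem_vectorSpan ℝ (mem_range_self 3) (mem_range_self 0)
    rw [← he] at h3
    have h4 := Submodule.mem_orthogonal_singleton_iff_inner_right.1 h3.2
    exact (inner_apexVector_pos hxM).ne' h4
  have h1 : finrank ℝ ↥(V ⊓ (ℝ ∙ apexVector x)ᗮ) ≤ 1 := by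
    have := Submodule.finrank_lt_finrank_of_lt hlt
    omega
  obtain ⟨u, hu⟩ := finrank_le_one_iff.1 h1
  obtain ⟨a, ha⟩ := hu ⟨_, circleVector_mem x 2⟩
  obtain ⟨b, hb⟩ := hu ⟨_, circleVector_mem x 4⟩
  have ha' : a • (u : E 4) = circleVector x 2 := congrArg Subtype.val ha
  have hb' : b • (u : E 4) = circleVector x 4 := congrArg Subtype.val hb
  rw [prismGram, gram, ← ha', ← hb']
  simp only [inner_smul_left, inner_smul_right, conj_trivial]
  ring

theorem inner_self_orthComponent (d e : E 4) :
    ⟪orthComponent d e, orthComponent d e⟫_ℝ = ⟪d, d⟫_ℝ * gram d e := by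
  simp only [orthComponent, gram, inner_sub_left, inner_sub_right, inner_smul_left,
    inner_smul_right, conj_trivial, real_inner_comm d e]
  ring

/-- Dependent circle vectors put `x 0, x 2, x 3, x 4` into one plane. The apex lies in it as well,
as a projective point, and the lines through it carry `x 1` and `x 5` into the plane. -/
theorem mem_M₀_of_prismGram_eq_zero {x : Tuple} (hx : x ∈ M) (h : prismGram x = 0) : x ∈ M₀ := by
  refine ⟨hx, ⟨0, 1, ?_⟩, ?_⟩
  · rintro _ ⟨i, rfl⟩
    exact hx.1.1 i
  have hc := (inner_apexVector_pos hx).ne'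
  obtain ⟨k, hk⟩ := exists_isPrismVector_apex hx
  set c := ⟪apexVector x, x 3 - x 0⟫_ℝ with hcdef
  obtain ⟨y, h3, h2, h4⟩ : ∃ y, x 3 - x 0 ∈ Submodule.span ℝ {x 3 - x 0, y} ∧
      x 2 - x 0 ∈ Submodule.span ℝ {x 3 - x 0, y} ∧
      x 4 - x 0 ∈ Submodule.span ℝ {x 3 - x 0, y} := by
    have horth : orthComponent (circleVector x 2) (circleVector x 4) = 0 := by
      rw [← inner_self_eq_zero (𝕜 := ℝ), inner_self_orthComponent]
      exact mul_eq_zero_of_right _ h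
    have hmem : ∀ j, circleVector x j = c • (x j - x 0) -
      ⟪apexVector x, x j - x 0⟫_ℝ • (x 3 - x 0) := fun j => rfl
    have h3 : ∀ y : E 4, x 3 - x 0 ∈ Submodule.span ℝ {x 3 - x 0, y} := fun y =>
      Submodule.subset_span (by simp)
    have hy : ∀ y : E 4, y ∈ Submodule.span ℝ {x 3 - x 0, y} := fun y =>
      Submodule.subset_span (by simp)
    by_cases hd : circleVector x 2 = 0
    · refine ⟨x 4 - x 0, h3 _, ?_, hy _⟩
      rw [hmem, sub_eq_zero] at hd
      rw [← Submodule.smul_mem_iff _ hc, hd]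
      exact Submodule.smul_mem _ _ (h3 _)
    · refine ⟨x 2 - x 0, h3 _, hy _, ?_⟩
      have h2 : circleVector x 2 ∈ Submodule.span ℝ {x 3 - x 0, x 2 - x 0} := by
        rw [hmem]
        exact Submodule.sub_mem _ (Submodule.smul_mem _ _ (hy _)) (Submodule.smul_mem _ _ (h3 _))
      have h4 : circleVector x 4 ∈ Submodule.span ℝ {x 3 - x 0, x 2 - x 0} := by
        rw [← Submodule.smul_mem_iff _ (inner_self_ne_zero (𝕜 := ℝ).2 hd),
          sub_eq_zero.1 horth]
        exact Submodule.smul_mem _ _ h2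
      rw [← Submodule.smul_mem_iff _ hc]
      have : c • (x 4 - x 0) = circleVector x 4 + ⟪apexVector x, x 4 - x 0⟫_ℝ • (x 3 - x 0) := by
        rw [hmem]
        abel
      rw [this]
      exact Submodule.add_mem _ h4 (Submodule.smul_mem _ _ (h3 _))
  set W := Submodule.span ℝ {x 3 - x 0, y} with hW
  have hother : ∀ i j, k i • x i + k j • x j = apexVector x → k i + k j = apexWeight x →
      k j ≠ 0 → x i - x 0 ∈ W → x j - x 0 ∈ W := by
    intro i j hl hs hne hi
    have l0 : k 0 • x 0 + k 3 • x 3 = apexVector x := hk.line 0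
    have s0 : k 0 + k 3 = apexWeight x := hk.sum 0
    have e : k j • (x j - x 0) = k 3 • (x 3 - x 0) - k i • (x i - x 0) := by
      have e1 : k j • (x j - x 0) + k i • (x i - x 0) =
          (k i • x i + k j • x j) - (k i + k j) • x 0 := by module
      have e2 : k 3 • (x 3 - x 0) = (k 0 • x 0 + k 3 • x 3) - (k 0 + k 3) • x 0 := by module
      rw [eq_sub_iff_add_eq, e1, e2, hl, hs, l0, s0]
    rw [← Submodule.smul_mem_iff _ hne, e]
    exact Submodule.sub_mem _ (Submodule.smul_mem _ _ h3) (Submodule.smul_mem _ _ hi)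
  have hle : vectorSpan ℝ (range x) ≤ W := by
    rw [vectorSpan_range_eq_span_range_vsub_right ℝ x 0, Submodule.span_le]
    rintro _ ⟨i, rfl⟩
    fin_cases i
    · simp
    · exact hother 4 1 (hk.line 4) (hk.sum 4) (hk.coeff_ne_zero 1) h4
    · exact h2
    · exact h3
    · exact h4
    · exact hother 2 5 (hk.line 2) (hk.sum 2) (hk.coeff_ne_zero 5) h2
  rw [coplanar_iff_finrank_le_two]
  refine (Submodule.finrank_mono hle).trans ?_
  have := finrank_span_finset_le_card (R := ℝ) ({x 3 - x 0, y} : Finset (E 4))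
  simp only [Finset.coe_insert, Finset.coe_singleton] at this
  exact this.trans Finset.card_le_two

/-! ### The set of prisms is closed -/

theorem coeffs_eq_zero {y₀ y₁ y₂ : E 4} (h₀ : y₀ ∈ S3) (h₁ : y₁ ∈ S3) (h₂ : y₂ ∈ S3)
    (h01 : y₀ ≠ y₁) (h02 : y₀ ≠ y₂) (h12 : y₁ ≠ y₂) {a b c : ℝ}
    (h : a • y₀ = b • y₁ + c • y₂) (hs : a = b + c) : a = 0 ∧ b = 0 ∧ c = 0 := by
  have hne := orthComponent_ne_zero h₀ h₁ h₂ h01 h02 h12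
  have e : a • (y₀ - y₂) = b • (y₁ - y₂) := by
    have : a • (y₀ - y₂) = a • y₀ - a • y₂ := smul_sub _ _ _
    rw [this, h, hs]
    module
  have e' := congrArg (orthComponent (y₁ - y₂)) e
  have hl : ∀ (r : ℝ) (z : E 4), orthComponent (y₁ - y₂) (r • z) =
      r • orthComponent (y₁ - y₂) z := fun r z => by
    simpa using orthComponent_linear (y₁ - y₂) r 0 z z
  rw [hl, hl, orthComponent_self, smul_zero, smul_eq_zero] at e'
  have ha : a = 0 := e'.resolve_right hne
  rw [ha, zero_smul] at e
  have hb : b = 0 := (smul_eq_zero.1 e.symm).resolve_right (sub_ne_zero.2 h12)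
  exact ⟨ha, hb, by linarith⟩

/-- With coefficients normalized to the compact unit sphere, the weak form of the prism conditions
is closed and survives projection to the tuples. Injectivity then makes the sign conditions strict
again. -/
theorem mem_M_of_mem_closure {x : Tuple} (hinj : Function.Injective x) (hx : x ∈ closure M) :
    x ∈ M := by
  set K := Metric.sphere (0 : Fin 6 → ℝ) 1 with hK
  have : CompactSpace K := isCompact_iff_compactSpace.1 (isCompact_sphere _ _)
  set Z : Set (K × Tuple) := {q | (∀ i, ‖q.2 i‖ = 1) ∧
    (∀ i, q.1.1 i • q.2 i + q.1.1 (i + 3) • q.2 (i + 3) =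
      q.1.1 0 • q.2 0 + q.1.1 3 • q.2 3) ∧
    (∀ i, q.1.1 i + q.1.1 (i + 3) = q.1.1 0 + q.1.1 3) ∧
    (q.1.1 0 ≤ 0 ∧ q.1.1 2 ≤ 0 ∧ q.1.1 4 ≤ 0) ∧
    (0 ≤ q.1.1 1 ∧ 0 ≤ q.1.1 3 ∧ 0 ≤ q.1.1 5)} with hZ
  have hc : ∀ i, Continuous fun q : K × Tuple => q.1.1 i := fun i =>
    (continuous_apply i).comp (continuous_subtype_val.comp continuous_fst)
  have hZc : IsClosed Z := by
    simp only [hZ, ofPred_and, ofPred_forall]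
    refine IsClosed.inter (isClosed_iInter fun i => isClosed_eq (by fun_prop) (by fun_prop))
      (IsClosed.inter (isClosed_iInter fun i => isClosed_eq (by fun_prop) (by fun_prop))
      (IsClosed.inter (isClosed_iInter fun i => isClosed_eq (by fun_prop) (by fun_prop))
      (IsClosed.inter (IsClosed.inter ?_ (IsClosed.inter ?_ ?_))
      (IsClosed.inter ?_ (IsClosed.inter ?_ ?_))))) <;>
    exact isClosed_le (by fun_prop) (by fun_prop)
  have hsub : M ⊆ Prod.snd '' Z := by
    intro y hy
    obtain ⟨hC, k, v, w, h⟩ := mem_M_iff.1 hy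
    have hk0 : k ≠ 0 := fun h0 => h.coeff_ne_zero 0 (congrFun h0 0)
    have hpos : 0 < ‖k‖⁻¹ := inv_pos.2 (norm_pos_iff.2 hk0)
    have h' := h.smul hpos
    refine ⟨(⟨‖k‖⁻¹ • k, ?_⟩, y), ⟨fun i => mem_sphere_zero_iff_norm.1 (hC.1 i),
      fun i => (h'.line i).trans (h'.line 0).symm, fun i => (h'.sum i).trans (h'.sum 0).symm,
      ⟨h'.neg.1.le, h'.neg.2.1.le, h'.neg.2.2.le⟩, ⟨h'.pos.1.le, h'.pos.2.1.le, h'.pos.2.2.le⟩⟩,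
      rfl⟩
    rw [mem_sphere_zero_iff_norm, norm_smul, norm_inv, norm_norm,
      inv_mul_cancel₀ (norm_ne_zero_iff.2 hk0)]
  obtain ⟨⟨⟨k, hkS⟩, x'⟩, ⟨hS, hl, hs, hn, hp⟩, hxx⟩ :=
    closure_minimal hsub (isClosedMap_snd_of_compactSpace _ hZc) hx
  obtain rfl : x' = x := hxx
  dsimp only at hS hl hs hn hp
  have hC : x' ∈ C6 := ⟨fun i => mem_sphere_zero_iff_norm.2 (hS i), hinj⟩
  -- If `k i = 0`, the apex is `x (i + 3)` or all coefficients on that line vanish. Since three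
  -- distinct points of the sphere are not collinear, comparison with the two other lines makes
  -- every coefficient zero, against the normalization.
  have hne : ∀ i, k i ≠ 0 := by
    intro i hi
    have h1 : ∀ j, j ≠ i + 3 → j + 3 ≠ i + 3 → j ≠ j + 3 →
        k (i + 3) = 0 ∧ k j = 0 ∧ k (j + 3) = 0 := by
      intro j hj1 hj2 hj3
      refine coeffs_eq_zero (hC.1 (i + 3)) (hC.1 j) (hC.1 (j + 3)) (hinj.ne hj1.symm)
        (hinj.ne hj2.symm) (hinj.ne hj3) ?_ ?_
      · rw [hl j, ← hl i, hi, zero_smul, zero_add]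
      · rw [hs j, ← hs i, hi, zero_add]
    have ha := h1 (i + 1) (by fin_cases i <;> decide) (by fin_cases i <;> decide)
      (by fin_cases i <;> decide)
    have hb := h1 (i + 2) (by fin_cases i <;> decide) (by fin_cases i <;> decide)
      (by fin_cases i <;> decide)
    have hzero : k = 0 := by
      funext j
      obtain ⟨m, rfl⟩ : ∃ m, j = i + m := ⟨j - i, by abel⟩
      have e1 : i + 1 + 3 = i + 4 := by rw [add_assoc]; rfl
      have e2 : i + 2 + 3 = i + 5 := by rw [add_assoc]; rfl
      rw [e1] at ha
      rw [e2] at hb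
      fin_cases m
      exacts [by simpa using hi, ha.2.1, hb.2.1, ha.1, ha.2.2, hb.2.2]
    rw [mem_sphere_zero_iff_norm, hzero, norm_zero] at hkS
    exact zero_ne_one hkS
  exact mem_M_iff.2 ⟨hC, k, _, _, ⟨hl, hs,
    ⟨hn.1.lt_of_ne (hne 0), hn.2.1.lt_of_ne (hne 2), hn.2.2.lt_of_ne (hne 4)⟩,
    ⟨hp.1.lt_of_ne' (hne 1), hp.2.1.lt_of_ne' (hne 3), hp.2.2.lt_of_ne' (hne 5)⟩⟩⟩

theorem isHalfTwist_twist {x : Tuple} (hx : x ∈ M) (σ : ℝ) : IsHalfTwist x (twist σ x) := by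
  obtain ⟨k, hk⟩ := exists_isPrismVector_apex hx
  refine ⟨_, hk.isPrism_mk hx.1, cayleyIsometry σ (circleVector x 2) (circleVector x 4),
    det_cayley _ _ _, fun z hz => ?_, ?_, ?_⟩
  · obtain ⟨c, hc⟩ := Projectivization.exists_smul_eq_mk_rep ℝ (apexVector x, apexWeight x)
      (hk.ne_zero hx.1)
    have hmem : ∀ j, circleVector x j ∈ circleDirections
        (Projectivization.mk ℝ (apexVector x, apexWeight x) (hk.ne_zero hx.1)) x := by
      intro j
      rw [circleDirections, ← hc]
      have : (c • ((apexVector x, apexWeight x) : E 4 × ℝ)).1 = (c : ℝ) • apexVector x := rfl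
      rw [this, Submodule.span_singleton_smul_eq c.isUnit]
      exact circleVector_mem x j
    exact cayley_of_orthogonal σ (hz _ (hmem 2)) (hz _ (hmem 4))
  · rintro i (rfl | rfl | rfl) <;> rfl
  · rintro i (rfl | rfl | rfl) <;> rfl

/-! ### Stereographic coordinates of a prism -/

/-- The coordinate in the direction `e` of the stereographic projection of `z` from `N`. -/
def stereoCoord (N e z : E 4) : ℝ := 2 / (1 - ⟪N, z⟫_ℝ) * ⟪e, z⟫_ℝ

/-- An orthonormal frame adapted to a prism: `e 0` and `e 1` span the directions of the circle
`T_p ∩ P`, and `e 3` is a point of `T_p`. -/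
structure IsTwistFrame (x : Tuple) (e : Fin 4 → E 4) (r g : ℝ) : Prop where
  orthonormal : Orthonormal ℝ e
  apex : apexVector x = apexWeight x • e 3 - r • e 2
  r_pos : 0 < r
  circle : ∃ l m n : ℝ, 0 < l ∧ 0 < n ∧ g = l * n ∧ circleVector x 2 = -l • e 0 ∧
    circleVector x 4 = m • e 0 - n • e 1

theorem sum_sq_inner_of_orthonormal {e : Fin 4 → E 4} (he : Orthonormal ℝ e) (z : E 4) :
    ⟪z, z⟫_ℝ = ⟪e 0, z⟫_ℝ ^ 2 + ⟪e 1, z⟫_ℝ ^ 2 + ⟪e 2, z⟫_ℝ ^ 2 + ⟪e 3, z⟫_ℝ ^ 2 := by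
  set b := OrthonormalBasis.mk he
    (he.linearIndependent.span_eq_top_of_card_eq_finrank' (by simp)).ge with hb
  have h := b.sum_sq_norm_inner_right z
  simp only [hb, OrthonormalBasis.coe_mk, Fin.sum_univ_four, Real.norm_eq_abs, sq_abs] at h
  rw [real_inner_self_eq_norm_sq, ← h]

/-- Two points of the unit sphere on a line through the point `w N - r e` outside the ball have
stereographic projections from `N` that are mirror images in a plane orthogonal to `e`. -/
theorem mirror_coords {n a b c n' a' b' c' k k' w r : ℝ} (hn : n < 1) (hn' : n' < 1)
    (hr : r ≠ 0) (hk : k' ≠ 0) (h1 : a ^ 2 + b ^ 2 + c ^ 2 + n ^ 2 = 1)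
    (h2 : a' ^ 2 + b' ^ 2 + c' ^ 2 + n' ^ 2 = 1) (hs : k + k' = w) (hkn : k * n + k' * n' = w)
    (hka : k * a + k' * a' = 0) (hkb : k * b + k' * b' = 0) (hkc : k * c + k' * c' = -r) :
    2 / (1 - n') * a' = 2 / (1 - n) * a ∧ 2 / (1 - n') * b' = 2 / (1 - n) * b ∧
      2 / (1 - n) * c + 2 / (1 - n') * c' = 2 * (-2 * w / r) := by
  have p : 0 < 1 - n := by linarith
  have p' : 0 < 1 - n' := by linarith
  -- Passing to the second point multiplies `1 - n`, `a` and `b` by the same factor `t`, so the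
  -- quotients agree. The last coordinate then follows from the difference of the two sphere
  -- equations.
  obtain ⟨t, ht⟩ : ∃ t, t * k' = -k := ⟨-k / k', by field_simp⟩
  have hν : 1 - n' = t * (1 - n) :=
    mul_left_cancel₀ hk (by linear_combination hs - hkn - (1 - n) * ht)
  have ha : a' = t * a := mul_left_cancel₀ hk (by linear_combination hka - a * ht)
  have hb : b' = t * b := mul_left_cancel₀ hk (by linear_combination hkb - b * ht)
  have ht0 : 0 < t := by
    rw [hν] at p'
    exact (pos_iff_pos_of_mul_pos p').2 p
  have hc : r * (c' + t * c) = -2 * t * (1 - n) * w := by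
    have h3 : (c' - t * c) * (c' + t * c) = 2 * t * (1 - n) * (1 - t) := by
      have hn'' : n' = 1 - t * (1 - n) := by linarith
      rw [ha, hb, hn''] at h2
      linear_combination h2 - t ^ 2 * h1
    have h4 : k' * (c' - t * c) = -r := by linear_combination hkc - c * ht
    have h5 : k' * (1 - t) = w := by linear_combination hs - ht
    linear_combination (-k') * h3 + (c' + t * c) * h4 + (-2 * t * (1 - n)) * h5
  rw [hν, ha, hb]
  refine ⟨by field_simp, by field_simp, ?_⟩
  field_simp
  linear_combination hc

/-- In the coordinates `(c, ν)` of points of `S³` the condition of lying on a sphere centred at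
height `o` on the axis is affine. If it holds at two distinct points it holds on the line through
them. -/
theorem common_sphere {o ρ ν₀ c₀ ν₃ c₃ ν c : ℝ} (h₀ : 2 - o * c₀ = ρ * ν₀)
    (h₃ : 2 - o * c₃ = ρ * ν₃) (hcol : (c₃ - c₀) * (ν - ν₀) = (c - c₀) * (ν₃ - ν₀))
    (hne : ν₃ = ν₀ → c₃ ≠ c₀) : 2 - o * c = ρ * ν := by
  by_cases hν : ν₃ = ν₀
  · have hc := sub_ne_zero.2 (hne hν)
    have ho : o = 0 := by
      have : o * (c₃ - c₀) = 0 := by rw [hν] at h₃; linarith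
      exact (mul_eq_zero.1 this).resolve_right hc
    have hν' : ν = ν₀ := by
      rw [hν, sub_self, mul_zero] at hcol
      linarith [(mul_eq_zero.1 hcol).resolve_left hc]
    rw [ho, hν', ← h₀, ho]
    ring
  · refine mul_left_cancel₀ (sub_ne_zero.2 hν) ?_
    linear_combination (ν₃ - ν) * h₀ + (ν - ν₀) * h₃ + o * hcol

/-- The inverse image under stereographic projection of a sphere centred on an axis. -/
theorem stereo_sphere_iff {e : Fin 4 → E 4} (he : Orthonormal ℝ e) {z : E 4} (hz : z ∈ S3)
    (hlt : ⟪e 3, z⟫_ℝ < 1) (o S : ℝ) :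
    stereoCoord (e 3) (e 0) z ^ 2 + stereoCoord (e 3) (e 1) z ^ 2 +
      (stereoCoord (e 3) (e 2) z - o) ^ 2 = S ↔
    2 - o * ⟪e 2, z⟫_ℝ = (S + 4 - o ^ 2) / 4 * (1 - ⟪e 3, z⟫_ℝ) := by
  have hs := sum_sq_inner_of_orthonormal he z
  rw [inner_self_of_mem_S3 hz] at hs
  simp only [stereoCoord]
  set a := ⟪e 0, z⟫_ℝ
  set b := ⟪e 1, z⟫_ℝ
  set c := ⟪e 2, z⟫_ℝ
  set n := ⟪e 3, z⟫_ℝ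
  have p : 0 < 1 - n := by linarith
  have e1 : (2 / (1 - n) * a) ^ 2 + (2 / (1 - n) * b) ^ 2 + (2 / (1 - n) * c - o) ^ 2 =
      4 * (2 - o * c) / (1 - n) - 4 + o ^ 2 := by
    field_simp
    linear_combination (-4) * hs
  rw [e1]
  constructor
  · intro h'
    field_simp at h'
    linear_combination (1 / 4) * h'
  · intro h'
    rw [h']
    field_simp
    ring

namespace IsTwistFrame

variable {x : Tuple} {e : Fin 4 → E 4} {r g : ℝ}

theorem inner_self (h : IsTwistFrame x e r g) (i : Fin 4) : ⟪e i, e i⟫_ℝ = 1 := by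
  rw [real_inner_self_eq_norm_sq, h.orthonormal.1 i, one_pow]

theorem inner_ne (h : IsTwistFrame x e r g) {i j : Fin 4} (hij : i ≠ j) : ⟪e i, e j⟫_ℝ = 0 :=
  h.orthonormal.2 hij

theorem polar_eq (h : IsTwistFrame x e r g) (i : Fin 6) :
    ⟪apexVector x, x i⟫_ℝ - apexWeight x =
      -apexWeight x * (1 - ⟪e 3, x i⟫_ℝ) - r * ⟪e 2, x i⟫_ℝ := by
  rw [h.apex, inner_sub_left, inner_smul_left, inner_smul_left]
  simp
  ring

/-- The pole lies on `T_p`, where the polar form vanishes, and no vertex does. -/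
theorem inner_pole_lt_one (h : IsTwistFrame x e r g) (hx : x ∈ M) (i : Fin 6) :
    ⟪e 3, x i⟫_ℝ < 1 := by
  obtain ⟨k, hk⟩ := exists_isPrismVector_apex hx
  refine inner_lt_one_of_ne (mem_sphere_zero_iff_norm.2 (h.orthonormal.1 3)) (hx.1.1 i) fun he => ?_
  refine hk.polar_ne_zero hx.1 i ?_
  rw [h.polar_eq, ← he, h.inner_self, h.inner_ne (by decide)]
  ring

theorem sum_sq (h : IsTwistFrame x e r g) (hx : x ∈ M) (i : Fin 6) :
    ⟪e 0, x i⟫_ℝ ^ 2 + ⟪e 1, x i⟫_ℝ ^ 2 + ⟪e 2, x i⟫_ℝ ^ 2 + ⟪e 3, x i⟫_ℝ ^ 2 = 1 := by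
  rw [← sum_sq_inner_of_orthonormal h.orthonormal, inner_self_of_mem_S3 (hx.1.1 i)]

theorem mirror (h : IsTwistFrame x e r g) (hx : x ∈ M) (i : Fin 6) :
    stereoCoord (e 3) (e 0) (x (i + 3)) = stereoCoord (e 3) (e 0) (x i) ∧
    stereoCoord (e 3) (e 1) (x (i + 3)) = stereoCoord (e 3) (e 1) (x i) ∧
    stereoCoord (e 3) (e 2) (x i) + stereoCoord (e 3) (e 2) (x (i + 3)) =
      2 * (-2 * apexWeight x / r) := by
  obtain ⟨k, hk⟩ := exists_isPrismVector_apex hx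
  have hin : ∀ j, k i * ⟪e j, x i⟫_ℝ + k (i + 3) * ⟪e j, x (i + 3)⟫_ℝ =
      ⟪e j, apexVector x⟫_ℝ := by
    intro j
    rw [← hk.line i, inner_add_right, inner_smul_right, inner_smul_right]
  have hv : ∀ j, ⟪e j, apexVector x⟫_ℝ =
      apexWeight x * ⟪e j, e 3⟫_ℝ - r * ⟪e j, e 2⟫_ℝ := by
    intro j
    rw [h.apex, inner_sub_right, inner_smul_right, inner_smul_right]
  refine mirror_coords (h.inner_pole_lt_one hx i) (h.inner_pole_lt_one hx (i + 3)) h.r_pos.ne'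
    (hk.coeff_ne_zero (i + 3)) (h.sum_sq hx i) (h.sum_sq hx (i + 3)) (hk.sum i) ?_ ?_ ?_ ?_
  · rw [hin, hv, h.inner_self, h.inner_ne (by decide)]
    ring
  · rw [hin, hv, h.inner_ne (by decide), h.inner_ne (by decide)]
    ring
  · rw [hin, hv, h.inner_ne (by decide), h.inner_ne (by decide)]
    ring
  · rw [hin, hv, h.inner_self, h.inner_ne (by decide)]
    ring

theorem inner_circleVector_eq_zero (h : IsTwistFrame x e r g) {i : Fin 4} (h0 : i ≠ 0)
    (h1 : i ≠ 1) : ⟪e i, circleVector x 2⟫_ℝ = 0 ∧ ⟪e i, circleVector x 4⟫_ℝ = 0 := by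
  obtain ⟨l, m, n, -, -, -, h2, h4⟩ := h.circle
  rw [h2, h4, inner_smul_right, inner_sub_right, inner_smul_right, inner_smul_right,
    h.inner_ne h0, h.inner_ne h1]
  simp

theorem inner_circleVector (z : E 4) (j : Fin 6) :
    ⟪z, circleVector x j⟫_ℝ =
      ((⟪apexVector x, x 3⟫_ℝ - apexWeight x) - (⟪apexVector x, x 0⟫_ℝ - apexWeight x)) *
        (⟪z, x j⟫_ℝ - ⟪z, x 0⟫_ℝ) -
      ((⟪apexVector x, x j⟫_ℝ - apexWeight x) - (⟪apexVector x, x 0⟫_ℝ - apexWeight x)) *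
        (⟪z, x 3⟫_ℝ - ⟪z, x 0⟫_ℝ) := by
  simp only [circleVector, inner_sub_right, inner_smul_right]
  ring

theorem sphere_eq_iff (h : IsTwistFrame x e r g) (hx : x ∈ M) (i : Fin 6) (o S : ℝ) :
    stereoCoord (e 3) (e 0) (x i) ^ 2 + stereoCoord (e 3) (e 1) (x i) ^ 2 +
      (stereoCoord (e 3) (e 2) (x i) - o) ^ 2 = S ↔
    2 - o * ⟪e 2, x i⟫_ℝ = (S + 4 - o ^ 2) / 4 * (1 - ⟪e 3, x i⟫_ℝ) :=
  stereo_sphere_iff h.orthonormal (hx.1.1 i) (h.inner_pole_lt_one hx i) o S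

theorem collinear_coords (h : IsTwistFrame x e r g) {j : Fin 6} (hj : j = 2 ∨ j = 4) :
    (⟪e 2, x 3⟫_ℝ - ⟪e 2, x 0⟫_ℝ) * ((1 - ⟪e 3, x j⟫_ℝ) - (1 - ⟪e 3, x 0⟫_ℝ)) =
      (⟪e 2, x j⟫_ℝ - ⟪e 2, x 0⟫_ℝ) * ((1 - ⟪e 3, x 3⟫_ℝ) - (1 - ⟪e 3, x 0⟫_ℝ)) := by
  have h3 : ⟪e 3, circleVector x j⟫_ℝ = 0 := by
    have := h.inner_circleVector_eq_zero (i := 3) (by decide) (by decide)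
    rcases hj with rfl | rfl
    exacts [this.1, this.2]
  rw [inner_circleVector, h.polar_eq, h.polar_eq, h.polar_eq] at h3
  refine mul_left_cancel₀ h.r_pos.ne' ?_
  linear_combination h3

/-- The mirror symmetry gives equal values at opposite vertices. For `x 2` and `x 4` the value
agrees with that at `x 0` and `x 3` because the projections to the plane of `e 2` and `e 3` are
collinear, the circle vectors having no component there. -/
theorem exists_sphere (h : IsTwistFrame x e r g) (hx : x ∈ M) : ∃ S, ∀ i,
    stereoCoord (e 3) (e 0) (x i) ^ 2 + stereoCoord (e 3) (e 1) (x i) ^ 2 +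
      (stereoCoord (e 3) (e 2) (x i) - (-2 * apexWeight x / r)) ^ 2 = S := by
  obtain ⟨k, hk⟩ := exists_isPrismVector_apex hx
  set o := -2 * apexWeight x / r with ho
  set F : Fin 6 → ℝ := fun i =>
    stereoCoord (e 3) (e 0) (x i) ^ 2 + stereoCoord (e 3) (e 1) (x i) ^ 2 +
      (stereoCoord (e 3) (e 2) (x i) - o) ^ 2 with hF
  have hmir : ∀ i, F (i + 3) = F i := by
    intro i
    obtain ⟨h1, h2, h3⟩ := h.mirror hx i
    simp only [hF, h1, h2]
    have : stereoCoord (e 3) (e 2) (x (i + 3)) - o = -(stereoCoord (e 3) (e 2) (x i) - o) := by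
      linarith
    rw [this]
    ring
  have hj : ∀ j, j = 2 ∨ j = 4 → F j = F 0 := by
    intro j hj
    rw [h.sphere_eq_iff hx]
    refine common_sphere ((h.sphere_eq_iff hx 0 o (F 0)).1 rfl)
      ((h.sphere_eq_iff hx 3 o (F 0)).1 (hmir 0)) (h.collinear_coords hj) fun hν hc => ?_
    have h0 := (hk.polar_neg hx.1).1
    have h3 := (hk.polar_pos hx.1).2.1
    rw [h.polar_eq] at h0 h3
    rw [hν, hc] at h3
    linarith
  refine ⟨F 0, fun i => ?_⟩
  change F i = F 0
  fin_cases i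
  exacts [rfl, (hmir 4).trans (hj 4 (by simp)), hj 2 (by simp), hmir 0, hj 4 (by simp),
    (hmir 2).trans (hj 2 (by simp))]

theorem stereoCoord_sub (h : IsTwistFrame x e r g) (hx : x ∈ M) {j : Fin 6} (hj : j = 2 ∨ j = 4)
    {i : Fin 4} (hi : i = 0 ∨ i = 1) : ∃ c > 0, ⟪e i, circleVector x j⟫_ℝ =
      c * (stereoCoord (e 3) (e i) (x j) - stereoCoord (e 3) (e i) (x 0)) := by
  obtain ⟨k, hk⟩ := exists_isPrismVector_apex hx
  have h3 : ⟪e 3, circleVector x j⟫_ℝ = 0 := by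
    have := h.inner_circleVector_eq_zero (i := 3) (by decide) (by decide)
    rcases hj with rfl | rfl
    exacts [this.1, this.2]
  have hm : stereoCoord (e 3) (e i) (x 3) = stereoCoord (e 3) (e i) (x 0) := by
    rcases hi with rfl | rfl
    exacts [(h.mirror hx 0).1, (h.mirror hx 0).2.1]
  have hcoord : ∀ m, ⟪e i, x m⟫_ℝ = (1 - ⟪e 3, x m⟫_ℝ) / 2 * stereoCoord (e 3) (e i) (x m) := by
    intro m
    have : 0 < 1 - ⟪e 3, x m⟫_ℝ := by linarith [h.inner_pole_lt_one hx m]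
    rw [stereoCoord]
    field_simp
  have h0 := (hk.polar_neg hx.1).1
  have hp3 := (hk.polar_pos hx.1).2.1
  have hν : 0 < 1 - ⟪e 3, x j⟫_ℝ := by linarith [h.inner_pole_lt_one hx j]
  refine ⟨((⟪apexVector x, x 3⟫_ℝ - apexWeight x) - (⟪apexVector x, x 0⟫_ℝ - apexWeight x)) *
    (1 - ⟪e 3, x j⟫_ℝ) / 2, ?_, ?_⟩
  · have := sub_pos.2 (h0.trans hp3)
    positivity
  · rw [inner_circleVector] at h3 ⊢
    rw [hcoord, hcoord 0, hcoord 3, hm]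
    linear_combination (-(1 / 2) * stereoCoord (e 3) (e i) (x 0)) * h3

end IsTwistFrame

/-! ### The stereographic projection of a twisted prism -/

/-- The isometry of the orthogonal complement of `e 3` with `ℝ³` given by the frame `e`. -/
theorem exists_isometry_of_orthonormal {e : Fin 4 → E 4} (he : Orthonormal ℝ e) :
    ∃ L : (ℝ ∙ e 3)ᗮ ≃ₗᵢ[ℝ] E 3, ∀ z, L (stereoToFun (e 3) z) =
      !₂[stereoCoord (e 3) (e 0) z, stereoCoord (e 3) (e 1) z, stereoCoord (e 3) (e 2) z] := by
  have h3 : e 3 ≠ 0 := he.ne_zero 3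
  have : Fact (finrank ℝ (E 4) = 3 + 1) := ⟨by simp⟩
  set A : (ℝ ∙ e 3)ᗮ →ₗ[ℝ] E 3 := (WithLp.linearEquiv 2 ℝ (Fin 3 → ℝ)).symm.toLinearMap ∘ₗ
    LinearMap.pi (fun k : Fin 3 => innerₛₗ ℝ (e k.castSucc) ∘ₗ (ℝ ∙ e 3)ᗮ.subtype) with hA
  have hcoord : ∀ z (k : Fin 3), A z k = ⟪e k.castSucc, (z : E 4)⟫_ℝ := fun z k => rfl
  have hnorm : ∀ z, ‖A z‖ = ‖z‖ := by
    intro z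
    rw [← sq_eq_sq₀ (norm_nonneg _) (norm_nonneg _), EuclideanSpace.norm_sq_eq, Fin.sum_univ_three,
      hcoord, hcoord, hcoord, Submodule.coe_norm,
      ← real_inner_self_eq_norm_sq (z : E 4), sum_sq_inner_of_orthonormal he,
      Submodule.mem_orthogonal_singleton_iff_inner_right.1 z.2]
    simp
  refine ⟨(⟨A, hnorm⟩ : (ℝ ∙ e 3)ᗮ →ₗᵢ[ℝ] E 3).toLinearIsometryEquiv ?_, fun z => ?_⟩
  · rw [Submodule.finrank_orthogonal_span_singleton (n := 3) h3]
    simp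
  · change A (stereoToFun (e 3) z) = _
    have hk : ∀ k : Fin 3, A (stereoToFun (e 3) z) k = stereoCoord (e 3) (e k.castSucc) z := by
      intro k
      have hmem : e k.castSucc ∈ (ℝ ∙ e 3)ᗮ :=
        Submodule.mem_orthogonal_singleton_iff_inner_right.2 (he.2 (Fin.castSucc_lt_last k).ne')
      rw [hcoord, stereoToFun_apply, Submodule.coe_smul, inner_smul_right, stereoCoord]
      congr 1
      exact Submodule.inner_orthogonalProjectionOnto_eq_of_mem_left ⟨_, hmem⟩ z
    ext k
    rw [hk]
    fin_cases k <;> rfl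

/-- The indices of the upper vertices of a prism. -/
def upperIndex : Fin 3 → Fin 6 := ![0, 2, 4]

/-- The parameters of the twisted prism that is the stereographic projection of `twist σ x`. -/
def frameParam (x : Tuple) (e : Fin 4 → E 4) (r g σ : ℝ) : PrismParam :=
  (fun k => stereoCoord (e 3) (e 0) (x (upperIndex k)),
    fun k => stereoCoord (e 3) (e 1) (x (upperIndex k)),
    fun k => stereoCoord (e 3) (e 2) (x (upperIndex k)) - (-2 * apexWeight x / r),
    fun k => (2 * g * stereoCoord (e 3) (e 1) (x (upperIndex k)) -
      2 * σ * g ^ 2 * stereoCoord (e 3) (e 0) (x (upperIndex k))) / (1 + σ ^ 2 * g ^ 2),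
    fun k => (-2 * g * stereoCoord (e 3) (e 0) (x (upperIndex k)) -
      2 * σ * g ^ 2 * stereoCoord (e 3) (e 1) (x (upperIndex k))) / (1 + σ ^ 2 * g ^ 2),
    -2 * apexWeight x / r)

namespace IsTwistFrame

variable {x : Tuple} {e : Fin 4 → E 4} {r g : ℝ}

theorem g_pos (h : IsTwistFrame x e r g) : 0 < g := by
  obtain ⟨l, m, n, hl, hn, hg, -, -⟩ := h.circle
  rw [hg]
  positivity

theorem prismGram_eq (h : IsTwistFrame x e r g) : prismGram x = g ^ 2 := by
  obtain ⟨l, m, n, hl, hn, hg, h2, h4⟩ := h.circle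
  have h01 : ⟪e 0, e 1⟫_ℝ = 0 := h.inner_ne (by decide)
  have h10 : ⟪e 1, e 0⟫_ℝ = 0 := h.inner_ne (by decide)
  simp only [prismGram, gram, h2, h4, inner_sub_left, inner_sub_right, inner_smul_left,
    inner_smul_right, h.inner_self, h01, h10, hg, conj_trivial]
  ring

theorem skewMap_eq (h : IsTwistFrame x e r g) (z : E 4) :
    skewMap (circleVector x 2) (circleVector x 4) z =
      (g * ⟪e 1, z⟫_ℝ) • e 0 - (g * ⟪e 0, z⟫_ℝ) • e 1 := by
  obtain ⟨l, m, n, hl, hn, hg, h2, h4⟩ := h.circle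
  rw [skewMap_apply, h2, h4, inner_sub_left, inner_smul_left, inner_smul_left, inner_smul_left, hg]
  simp only [conj_trivial]
  module

theorem twistRotation_eq (h : IsTwistFrame x e r g) (σ : ℝ) (z : E 4) :
    twistRotation σ x z = z +
      (σ * ((2 * g * ⟪e 1, z⟫_ℝ - 2 * σ * g ^ 2 * ⟪e 0, z⟫_ℝ) / (1 + σ ^ 2 * g ^ 2))) • e 0 +
      (σ * ((-2 * g * ⟪e 0, z⟫_ℝ - 2 * σ * g ^ 2 * ⟪e 1, z⟫_ℝ) / (1 + σ ^ 2 * g ^ 2))) • e 1 := by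
  have hg := h.prismGram_eq
  rw [prismGram] at hg
  have h01 : ⟪e 0, e 1⟫_ℝ = 0 := h.inner_ne (by decide)
  have h10 : ⟪e 1, e 0⟫_ℝ = 0 := h.inner_ne (by decide)
  rw [twistRotation, cayley_apply, hg, h.skewMap_eq z, h.skewMap_eq]
  simp only [inner_sub_right, inner_smul_right, h.inner_self, h01, h10]
  match_scalars <;> ring

theorem inner_twistRotation (h : IsTwistFrame x e r g) (σ : ℝ) (z : E 4) :
    ⟪e 0, twistRotation σ x z⟫_ℝ = ⟪e 0, z⟫_ℝ +
      σ * ((2 * g * ⟪e 1, z⟫_ℝ - 2 * σ * g ^ 2 * ⟪e 0, z⟫_ℝ) / (1 + σ ^ 2 * g ^ 2)) ∧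
    ⟪e 1, twistRotation σ x z⟫_ℝ = ⟪e 1, z⟫_ℝ +
      σ * ((-2 * g * ⟪e 0, z⟫_ℝ - 2 * σ * g ^ 2 * ⟪e 1, z⟫_ℝ) / (1 + σ ^ 2 * g ^ 2)) ∧
    ⟪e 2, twistRotation σ x z⟫_ℝ = ⟪e 2, z⟫_ℝ ∧ ⟪e 3, twistRotation σ x z⟫_ℝ = ⟪e 3, z⟫_ℝ := by
  have h01 : ⟪e 0, e 1⟫_ℝ = 0 := h.inner_ne (by decide)
  have h10 : ⟪e 1, e 0⟫_ℝ = 0 := h.inner_ne (by decide)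
  have h20 : ⟪e 2, e 0⟫_ℝ = 0 := h.inner_ne (by decide)
  have h21 : ⟪e 2, e 1⟫_ℝ = 0 := h.inner_ne (by decide)
  have h30 : ⟪e 3, e 0⟫_ℝ = 0 := h.inner_ne (by decide)
  have h31 : ⟪e 3, e 1⟫_ℝ = 0 := h.inner_ne (by decide)
  rw [h.twistRotation_eq]
  simp only [inner_add_right, inner_smul_right, h.inner_self, h01, h10, h20, h21, h30, h31]
  refine ⟨?_, ?_, ?_, ?_⟩ <;> ring

theorem inner_twist (h : IsTwistFrame x e r g) (σ : ℝ) (i : Fin 6) :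
    ⟪e 2, twist σ x i⟫_ℝ = ⟪e 2, x i⟫_ℝ ∧ ⟪e 3, twist σ x i⟫_ℝ = ⟪e 3, x i⟫_ℝ := by
  fin_cases i
  exacts [(h.inner_twistRotation σ (x 0)).2.2, ⟨rfl, rfl⟩, (h.inner_twistRotation σ (x 2)).2.2,
    ⟨rfl, rfl⟩, (h.inner_twistRotation σ (x 4)).2.2, ⟨rfl, rfl⟩]

/-- The rotation fixes `e 2` and `e 3`, so it commutes with the projection. The displacement is
exactly `σ` times a velocity that itself depends on `σ`, so no error term occurs. -/
theorem stereoCoord_twist_upper (h : IsTwistFrame x e r g) (σ : ℝ) (k : Fin 3) :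
    !₂[stereoCoord (e 3) (e 0) (twistRotation σ x (x (upperIndex k))),
      stereoCoord (e 3) (e 1) (twistRotation σ x (x (upperIndex k))),
      stereoCoord (e 3) (e 2) (twistRotation σ x (x (upperIndex k)))] =
      topVertex (frameParam x e r g σ) σ k := by
  obtain ⟨h0, h1, h2, h3⟩ := h.inner_twistRotation σ (x (upperIndex k))
  simp only [topVertex, frameParam, stereoCoord, h0, h1, h2, h3]
  congr 2
  · ring
  · congr 1
    · ring
    · congr 1
      ring

theorem stereoCoord_lower (h : IsTwistFrame x e r g) (hx : x ∈ M) (σ : ℝ) (k : Fin 3) :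
    !₂[stereoCoord (e 3) (e 0) (x (upperIndex k + 3)),
      stereoCoord (e 3) (e 1) (x (upperIndex k + 3)),
      stereoCoord (e 3) (e 2) (x (upperIndex k + 3))] =
      bottomVertex (frameParam x e r g σ) k := by
  obtain ⟨h0, h1, h2⟩ := h.mirror hx (upperIndex k)
  simp only [bottomVertex, frameParam, h0, h1]
  congr 4
  linarith

theorem stereoCoord_twist (h : IsTwistFrame x e r g) (hx : x ∈ M) (σ : ℝ) (i : Fin 6) :
    !₂[stereoCoord (e 3) (e 0) (twist σ x i), stereoCoord (e 3) (e 1) (twist σ x i),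
      stereoCoord (e 3) (e 2) (twist σ x i)] = twistedPrism (frameParam x e r g σ) σ i := by
  fin_cases i
  exacts [h.stereoCoord_twist_upper σ 0, h.stereoCoord_lower hx σ 2, h.stereoCoord_twist_upper σ 1,
    h.stereoCoord_lower hx σ 0, h.stereoCoord_twist_upper σ 2, h.stereoCoord_lower hx σ 1]

/-- Up to a positive factor, the height above the mirror plane is minus the polar form. -/
theorem height_pos (h : IsTwistFrame x e r g) (hx : x ∈ M) (k : Fin 3) :
    0 < stereoCoord (e 3) (e 2) (x (upperIndex k)) - (-2 * apexWeight x / r) := by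
  obtain ⟨κ, hκ⟩ := exists_isPrismVector_apex hx
  have hneg : ⟪apexVector x, x (upperIndex k)⟫_ℝ - apexWeight x < 0 := by
    obtain ⟨h0, h2, h4⟩ := hκ.polar_neg hx.1
    fin_cases k
    exacts [h0, h2, h4]
  have hν : 0 < 1 - ⟪e 3, x (upperIndex k)⟫_ℝ := by
    linarith [h.inner_pole_lt_one hx (upperIndex k)]
  have hr := h.r_pos
  rw [h.polar_eq] at hneg
  have : stereoCoord (e 3) (e 2) (x (upperIndex k)) - (-2 * apexWeight x / r) =
      2 / (r * (1 - ⟪e 3, x (upperIndex k)⟫_ℝ)) *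
        (apexWeight x * (1 - ⟪e 3, x (upperIndex k)⟫_ℝ) + r * ⟪e 2, x (upperIndex k)⟫_ℝ) := by
    rw [stereoCoord]
    field_simp
    ring
  rw [this]
  refine mul_pos (by positivity) (by linarith)

theorem isTwistable (h : IsTwistFrame x e r g) (hx : x ∈ M) :
    IsTwistable (frameParam x e r g 0) := by
  obtain ⟨l, m, n, hl, hn, hg, h2, h4⟩ := h.circle
  have h10 : ⟪e 1, e 0⟫_ℝ = 0 := h.inner_ne (by decide)
  obtain ⟨S, hS⟩ := h.exists_sphere hx
  have ha : stereoCoord (e 3) (e 0) (x 2) < stereoCoord (e 3) (e 0) (x 0) := by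
    obtain ⟨c, hc, hcd⟩ := h.stereoCoord_sub hx (j := 2) (by simp) (i := 0) (by simp)
    rw [h2, inner_smul_right, h.inner_self] at hcd
    nlinarith
  have hb : stereoCoord (e 3) (e 1) (x 2) = stereoCoord (e 3) (e 1) (x 0) := by
    obtain ⟨c, hc, hcd⟩ := h.stereoCoord_sub hx (j := 2) (by simp) (i := 1) (by simp)
    rw [h2, inner_smul_right, h10, mul_zero, zero_eq_mul] at hcd
    linarith [hcd.resolve_left hc.ne']
  have hb' : stereoCoord (e 3) (e 1) (x 4) < stereoCoord (e 3) (e 1) (x 0) := by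
    obtain ⟨c, hc, hcd⟩ := h.stereoCoord_sub hx (j := 4) (by simp) (i := 1) (by simp)
    rw [h4, inner_sub_right, inner_smul_right, inner_smul_right, h10, h.inner_self] at hcd
    nlinarith
  refine ⟨hb, ha, hb', h.height_pos hx, fun i j hij => ?_⟩
  have hne : 0 < (stereoCoord (e 3) (e 0) (x (upperIndex i)) -
      stereoCoord (e 3) (e 0) (x (upperIndex j))) ^ 2 +
      (stereoCoord (e 3) (e 1) (x (upperIndex i)) -
      stereoCoord (e 3) (e 1) (x (upperIndex j))) ^ 2 := by
    have hsq : ∀ u v w : ℝ, u ≠ v → 0 < w ^ 2 + (u - v) ^ 2 := fun u v w huv => by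
      have := sub_ne_zero.2 huv
      positivity
    have hsq' : ∀ u v w : ℝ, u ≠ v → 0 < (u - v) ^ 2 + w ^ 2 := fun u v w huv => by
      have := sub_ne_zero.2 huv
      positivity
    fin_cases i <;> fin_cases j <;> first | exact absurd rfl hij | skip
    exacts [hsq' _ _ _ ha.ne', hsq _ _ _ hb'.ne', hsq' _ _ _ ha.ne, hsq _ _ _ (hb.trans_ne hb'.ne'),
      hsq _ _ _ hb'.ne, hsq _ _ _ (hb.symm ▸ hb'.ne)]
  have hi := h.height_pos hx i
  have hj := h.height_pos hx j
  have hSi := hS (upperIndex i)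
  have hSj := hS (upperIndex j)
  simp only [separation, frameParam]
  set o := -2 * apexWeight x / r
  set a := stereoCoord (e 3) (e 0) (x (upperIndex i))
  set a' := stereoCoord (e 3) (e 0) (x (upperIndex j))
  set b := stereoCoord (e 3) (e 1) (x (upperIndex i))
  set b' := stereoCoord (e 3) (e 1) (x (upperIndex j))
  set c := stereoCoord (e 3) (e 2) (x (upperIndex i)) - o
  set c' := stereoCoord (e 3) (e 2) (x (upperIndex j)) - o
  -- At `σ = 0` the velocity is the rotation field `2g (b, -a)`. Because both vertices lie on a
  -- sphere centred at height `o` on the axis, the separation rate becomes a product of positive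
  -- factors.
  have key : g * (c + c') * ((a - a') ^ 2 + (b - b') ^ 2 + (c - c') ^ 2) =
      c' * ((-2 * g * a - 2 * 0 * g ^ 2 * b) / (1 + 0 ^ 2 * g ^ 2) * (a' - a) -
          (2 * g * b - 2 * 0 * g ^ 2 * a) / (1 + 0 ^ 2 * g ^ 2) * (b' - b)) -
        c * ((-2 * g * a' - 2 * 0 * g ^ 2 * b') / (1 + 0 ^ 2 * g ^ 2) * (a' - a) -
          (2 * g * b' - 2 * 0 * g ^ 2 * a') / (1 + 0 ^ 2 * g ^ 2) * (b' - b)) := by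
    have e1 : (1 + 0 ^ 2 * g ^ 2 : ℝ) = 1 := by ring
    rw [e1]
    linear_combination g * (c - c') * (hSi - hSj)
  rw [← key]
  have := h.g_pos
  positivity

end IsTwistFrame

/-- A hexagon whose opposite vertices lie on concurrent lines, alternating on the two sides, is not
embedded. -/
theorem not_isEmbeddedHexagon_of_concurrent {z : Fin 6 → E 3} {K₀ K₁ K₃ K₄ : ℝ} (h₀ : K₀ < 0)
    (h₁ : 0 < K₁) (h₃ : 0 < K₃) (h₄ : K₄ < 0) (hs : K₀ + K₃ = K₁ + K₄)
    (hz : K₀ • z 0 + K₃ • z 3 = K₁ • z 1 + K₄ • z 4) : ¬ IsEmbeddedHexagon z := by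
  intro hE
  have hT : 0 < K₁ - K₀ := by linarith
  have hT' : K₃ - K₄ = K₁ - K₀ := by linarith
  refine hE.2.2 0 (K₁ / (K₁ - K₀)) ⟨by positivity, (div_le_one hT).2 (by linarith)⟩
    (-K₄ / (K₁ - K₀)) ⟨div_nonneg (by linarith) hT.le, (div_le_one hT).2 (by linarith)⟩ ?_
  have e₁ : 1 - K₁ / (K₁ - K₀) = -K₀ / (K₁ - K₀) := by field_simp; ring
  have e₂ : 1 - -K₄ / (K₁ - K₀) = K₃ / (K₁ - K₀) := by field_simp; linarith
  change (1 - K₁ / (K₁ - K₀)) • z 0 + (K₁ / (K₁ - K₀)) • z 1 =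
    (1 - -K₄ / (K₁ - K₀)) • z 3 + (-K₄ / (K₁ - K₀)) • z 4
  rw [e₁, e₂]
  have : (K₁ - K₀)⁻¹ • (K₁ • z 1 - K₀ • z 0) = (K₁ - K₀)⁻¹ • (K₃ • z 3 - K₄ • z 4) := by
    congr 1
    linear_combination (norm := module) -hz
  simp only [div_eq_inv_mul]
  linear_combination (norm := module) this

namespace IsTwistFrame

variable {x : Tuple} {e : Fin 4 → E 4} {r g : ℝ}

theorem twist_mem_S3 (hx : x ∈ M) (σ : ℝ) (i : Fin 6) : twist σ x i ∈ S3 := by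
  rw [mem_sphere_zero_iff_norm, norm_twist]
  exact mem_sphere_zero_iff_norm.1 (hx.1.1 i)

theorem isStereographicTrefoil (h : IsTwistFrame x e r g) (hx : x ∈ M) {σ : ℝ}
    (hT : IsTrefoil (hexagon (twistedPrism (frameParam x e r g σ) σ))) :
    IsStereographicTrefoil (twist σ x) := by
  obtain ⟨S, hS⟩ := h.exists_sphere hx
  have hSpos : 0 < S := by
    have h0 := h.height_pos hx 0
    rw [← hS (upperIndex 0)]
    positivity
  have hlt : ∀ i, ⟪e 3, twist σ x i⟫_ℝ < 1 := fun i => by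
    rw [(h.inner_twist σ i).2]
    exact h.inner_pole_lt_one hx i
  set o := -2 * apexWeight x / r with ho
  have hplane : ∀ i, 2 - o * ⟪e 2, twist σ x i⟫_ℝ =
      (S + 4 - o ^ 2) / 4 * (1 - ⟪e 3, twist σ x i⟫_ℝ) := by
    intro i
    rw [(h.inner_twist σ i).1, (h.inner_twist σ i).2]
    exact (h.sphere_eq_iff hx i o S).1 (hS i)
  obtain ⟨L, hL⟩ := exists_isometry_of_orthonormal h.orthonormal
  have hz : (fun i => L (stereoToFun (e 3) (twist σ x i))) =
      twistedPrism (frameParam x e r g σ) σ := by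
    funext i
    rw [hL, h.stereoCoord_twist hx]
  refine ⟨twist_mem_S3 hx σ, ⟨((S + 4 - o ^ 2) / 4) • e 3 - o • e 2, (S + 4 - o ^ 2) / 4 - 2, ?_,
    fun i => ?_⟩, e 3, mem_sphere_zero_iff_norm.2 (h.orthonormal.1 3), fun i hi => ?_, L, ?_, ?_⟩
  · have h23 : ⟪e 2, e 3⟫_ℝ = 0 := h.inner_ne (by decide)
    have h32 : ⟪e 3, e 2⟫_ℝ = 0 := h.inner_ne (by decide)
    -- After expansion the inequality says just `0 < S`.
    refine abs_lt_of_sq_lt_sq ?_ (norm_nonneg _)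
    rw [← real_inner_self_eq_norm_sq]
    simp only [inner_sub_left, inner_sub_right, inner_smul_left, inner_smul_right, h.inner_self,
      h23, h32, conj_trivial]
    linarith
  · rw [inner_sub_left, inner_smul_left, inner_smul_left]
    simp only [conj_trivial]
    linarith [hplane i]
  · have := hlt i
    rw [hi, h.inner_self] at this
    exact lt_irrefl _ this
  · refine ⟨!₂[0, 0, o], √S, ?_⟩
    rintro _ ⟨i, rfl⟩
    dsimp only
    rw [hL, EuclideanSpace.dist_eq, Fin.sum_univ_three,
      ← (stereo_sphere_iff h.orthonormal (twist_mem_S3 hx σ i) (hlt i) o S).2 (hplane i)]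
    simp [Real.dist_eq]
  · rwa [hz]

/-- A linear relation between points of `S³` with equal total weights on both sides passes to their
stereographic images when each weight is multiplied by `1 - ⟪e 3, ·⟫ > 0`. Concurrency and the signs
are thus inherited by the projected hexagon, which cannot then be embedded. -/
theorem twist_notMem_M (h : IsTwistFrame x e r g) (hx : x ∈ M) {σ : ℝ}
    (hE : IsEmbeddedHexagon (twistedPrism (frameParam x e r g σ) σ)) : twist σ x ∉ M := by
  intro hy
  obtain ⟨-, k, v, w, hk⟩ := mem_M_iff.1 hy
  have hν : ∀ i, 0 < 1 - ⟪e 3, twist σ x i⟫_ℝ := fun i => by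
    rw [(h.inner_twist σ i).2]
    linarith [h.inner_pole_lt_one hx i]
  have hin : ∀ j i, k i * ⟪e j, twist σ x i⟫_ℝ + k (i + 3) * ⟪e j, twist σ x (i + 3)⟫_ℝ =
      ⟪e j, v⟫_ℝ := by
    intro j i
    rw [← hk.line i, inner_add_right, inner_smul_right, inner_smul_right]
  have hcoord : ∀ j i, k i * (1 - ⟪e 3, twist σ x i⟫_ℝ) * stereoCoord (e 3) (e j) (twist σ x i) =
      2 * (k i * ⟪e j, twist σ x i⟫_ℝ) := by
    intro j i
    have := (hν i).ne'
    rw [stereoCoord]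
    field_simp
  have hj : ∀ j, k 0 * (1 - ⟪e 3, twist σ x 0⟫_ℝ) * stereoCoord (e 3) (e j) (twist σ x 0) +
      k 3 * (1 - ⟪e 3, twist σ x 3⟫_ℝ) * stereoCoord (e 3) (e j) (twist σ x 3) =
      k 1 * (1 - ⟪e 3, twist σ x 1⟫_ℝ) * stereoCoord (e 3) (e j) (twist σ x 1) +
      k 4 * (1 - ⟪e 3, twist σ x 4⟫_ℝ) * stereoCoord (e 3) (e j) (twist σ x 4) := by
    intro j
    rw [hcoord, hcoord, hcoord, hcoord]
    have h0 := hin j 0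
    have h1 := hin j 1
    simp only [zero_add, Fin.reduceAdd] at h0 h1
    linarith
  obtain ⟨n0, -, n4⟩ := hk.neg
  obtain ⟨p1, p3, -⟩ := hk.pos
  refine not_isEmbeddedHexagon_of_concurrent (mul_neg_of_neg_of_pos n0 (hν 0)) (mul_pos p1 (hν 1))
    (mul_pos p3 (hν 3)) (mul_neg_of_neg_of_pos n4 (hν 4)) ?_ ?_ hE
  · have h0 := hin 3 0
    have h1 := hin 3 1
    have s0 := hk.sum 0
    have s1 := hk.sum 1
    simp only [zero_add, Fin.reduceAdd] at h0 h1 s0 s1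
    linarith
  · simp only [← h.stereoCoord_twist hx]
    ext j
    fin_cases j
    exacts [hj 0, hj 1, hj 2]

end IsTwistFrame

/-! ### Adapted frames that depend continuously on the prism -/

/-- The unit vector in the direction of `z`. -/
def unitVector (z : E 4) : E 4 := ‖z‖⁻¹ • z

theorem norm_unitVector {z : E 4} (hz : z ≠ 0) : ‖unitVector z‖ = 1 := by
  rw [unitVector, norm_smul, norm_inv, norm_norm, inv_mul_cancel₀ (norm_ne_zero_iff.2 hz)]

theorem norm_smul_unitVector {z : E 4} (hz : z ≠ 0) : ‖z‖ • unitVector z = z := by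
  rw [unitVector, smul_smul, mul_inv_cancel₀ (norm_ne_zero_iff.2 hz), one_smul]

theorem inner_unitVector (y z : E 4) : ⟪y, unitVector z⟫_ℝ = ‖z‖⁻¹ * ⟪y, z⟫_ℝ := by
  rw [unitVector, inner_smul_right]

theorem continuousAt_unitVector {X : Type*} [TopologicalSpace X] {f : X → E 4} {a : X}
    (hf : ContinuousAt f a) (h : f a ≠ 0) : ContinuousAt (fun y => unitVector (f y)) a :=
  (hf.norm.inv₀ (norm_ne_zero_iff.2 h)).smul hf

theorem orthonormal_four {a b c d : E 4} (ha : ‖a‖ = 1) (hb : ‖b‖ = 1) (hc : ‖c‖ = 1) (hd : ‖d‖ = 1)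
    (hab : ⟪a, b⟫_ℝ = 0) (hac : ⟪a, c⟫_ℝ = 0) (had : ⟪a, d⟫_ℝ = 0) (hbc : ⟪b, c⟫_ℝ = 0)
    (hbd : ⟪b, d⟫_ℝ = 0) (hcd : ⟪c, d⟫_ℝ = 0) : Orthonormal ℝ ![a, b, c, d] := by
  refine ⟨fun i => ?_, fun i j hij => ?_⟩
  · fin_cases i
    exacts [ha, hb, hc, hd]
  · fin_cases i <;> fin_cases j <;> first | exact absurd rfl hij | skip
    exacts [hab, hac, had, real_inner_comm a b ▸ hab, hbc, hbd, real_inner_comm a c ▸ hac,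
      real_inner_comm b c ▸ hbc, hcd, real_inner_comm a d ▸ had, real_inner_comm b d ▸ hbd,
      real_inner_comm c d ▸ hcd]

theorem exists_ne_zero_orthogonal (a b c : E 4) :
    ∃ f : E 4, f ≠ 0 ∧ ⟪a, f⟫_ℝ = 0 ∧ ⟪b, f⟫_ℝ = 0 ∧ ⟪c, f⟫_ℝ = 0 := by
  have hne : Submodule.span ℝ (range ![a, b, c]) ≠ ⊤ := by
    intro h
    have h1 := finrank_range_le_card (R := ℝ) ![a, b, c]
    rw [Set.finrank, h, finrank_top] at h1
    simp at h1
  have hbot : (Submodule.span ℝ (range ![a, b, c]))ᗮ ≠ ⊥ :=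
    fun h => hne (Submodule.orthogonal_eq_bot_iff.1 h)
  obtain ⟨f, hf, hf0⟩ := Submodule.exists_mem_ne_zero_of_ne_bot hbot
  have hin : ∀ i, ⟪![a, b, c] i, f⟫_ℝ = 0 := fun i =>
    hf _ (Submodule.subset_span (mem_range_self i))
  exact ⟨f, hf0, hin 0, hin 1, hin 2⟩

/-- The first unit vector in the plane of the circle `T_p ∩ P`. -/
def circleUnit (x : Tuple) : E 4 := unitVector (circleVector x 2)

/-- The component of the second circle vector orthogonal to the first. -/
def circleRest (x : Tuple) : E 4 :=
  circleVector x 4 - ⟪circleUnit x, circleVector x 4⟫_ℝ • circleUnit x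

/-- The component of `f` orthogonal to the circle vectors and to the apex vector. -/
def normalRest (f : E 4) (x : Tuple) : E 4 :=
  f - ⟪circleUnit x, f⟫_ℝ • circleUnit x -
    ⟪unitVector (circleRest x), f⟫_ℝ • unitVector (circleRest x) -
    ⟪unitVector (apexVector x), f⟫_ℝ • unitVector (apexVector x)

/-- The height of the apex of a prism, relative to its norm. -/
def apexCos (x : Tuple) : ℝ := apexWeight x / ‖apexVector x‖

/-- A frame adapted to a prism, obtained by orthogonalization. -/
def twistFrame (f : E 4) (x : Tuple) : Fin 4 → E 4 :=
  ![-circleUnit x, -unitVector (circleRest x),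
    -√(1 - apexCos x ^ 2) • unitVector (apexVector x) + apexCos x • unitVector (normalRest f x),
    apexCos x • unitVector (apexVector x) + √(1 - apexCos x ^ 2) • unitVector (normalRest f x)]

theorem circleVector_two_ne_zero {x : Tuple} (h : prismGram x ≠ 0) : circleVector x 2 ≠ 0 := by
  intro h0
  simp [prismGram, gram, h0] at h

theorem circleRest_ne_zero {x : Tuple} (h : prismGram x ≠ 0) : circleRest x ≠ 0 := by
  intro h0
  apply h
  rw [circleRest, circleUnit, unitVector, sub_eq_zero, smul_smul] at h0
  rw [prismGram, gram, h0]
  simp only [inner_smul_left, inner_smul_right, conj_trivial]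
  ring

theorem inner_apexVector_circleVector (x : Tuple) (j : Fin 6) :
    ⟪apexVector x, circleVector x j⟫_ℝ = 0 :=
  Submodule.mem_orthogonal_singleton_iff_inner_right.1 (circleVector_mem x j).2

theorem inner_circleUnit_circleRest {x : Tuple} (h : prismGram x ≠ 0) :
    ⟪circleUnit x, circleRest x⟫_ℝ = 0 := by
  have h1 := norm_unitVector (circleVector_two_ne_zero h)
  rw [circleRest, inner_sub_right, inner_smul_right, real_inner_self_eq_norm_sq, circleUnit, h1]
  ring

theorem inner_apexVector_circleUnit (x : Tuple) : ⟪apexVector x, circleUnit x⟫_ℝ = 0 := by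
  rw [circleUnit, inner_unitVector, inner_apexVector_circleVector, mul_zero]

theorem inner_apexVector_circleRest (x : Tuple) : ⟪apexVector x, circleRest x⟫_ℝ = 0 := by
  rw [circleRest, inner_sub_right, inner_smul_right, inner_apexVector_circleUnit,
    inner_apexVector_circleVector, mul_zero, sub_zero]

/-- The vectors `e 2` and `e 3` arise by rotating the apex direction and a unit normal so that `e 3`
makes with the apex direction the angle of cosine `apexCos x`; this puts `e 3` on `T_p`. The signs
of `e 0` and `e 1` bring the base triangle into the standard position of `IsTwistable`. -/
theorem isTwistFrame_twistFrame {x : Tuple} (hx : x ∈ M) (hg : prismGram x ≠ 0) {f : E 4}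
    (hf : normalRest f x ≠ 0) : IsTwistFrame x (twistFrame f x)
      (‖apexVector x‖ * √(1 - apexCos x ^ 2)) (‖circleVector x 2‖ * ‖circleRest x‖) := by
  obtain ⟨k, hk⟩ := exists_isPrismVector_apex hx
  have hv := hk.vector_ne_zero hx.1
  have hv' : 0 < ‖apexVector x‖ := norm_pos_iff.2 hv
  have hd := circleVector_two_ne_zero hg
  have hd' := circleRest_ne_zero hg
  have hcos : apexCos x ^ 2 < 1 := by
    rw [apexCos, div_pow, div_lt_one (by positivity)]
    exact hk.sq_lt_norm_sq hx.1
  have hsin : 0 < √(1 - apexCos x ^ 2) := Real.sqrt_pos.2 (by linarith)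
  have hcs : √(1 - apexCos x ^ 2) ^ 2 = 1 - apexCos x ^ 2 := Real.sq_sqrt (by linarith)
  have n1 : ⟪circleUnit x, circleUnit x⟫_ℝ = 1 := by
    rw [real_inner_self_eq_norm_sq, circleUnit, norm_unitVector hd, one_pow]
  have n2 : ⟪unitVector (circleRest x), unitVector (circleRest x)⟫_ℝ = 1 := by
    rw [real_inner_self_eq_norm_sq, norm_unitVector hd', one_pow]
  have n3 : ⟪unitVector (apexVector x), unitVector (apexVector x)⟫_ℝ = 1 := by
    rw [real_inner_self_eq_norm_sq, norm_unitVector hv, one_pow]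
  have n4 : ⟪unitVector (normalRest f x), unitVector (normalRest f x)⟫_ℝ = 1 := by
    rw [real_inner_self_eq_norm_sq, norm_unitVector hf, one_pow]
  have i12 : ⟪circleUnit x, unitVector (circleRest x)⟫_ℝ = 0 := by
    rw [inner_unitVector, inner_circleUnit_circleRest hg, mul_zero]
  have i13 : ⟪circleUnit x, unitVector (apexVector x)⟫_ℝ = 0 := by
    rw [inner_unitVector, real_inner_comm, inner_apexVector_circleUnit, mul_zero]
  have i23 : ⟪unitVector (circleRest x), unitVector (apexVector x)⟫_ℝ = 0 := by
    rw [inner_unitVector, real_inner_comm, inner_unitVector, inner_apexVector_circleRest, mul_zero,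
      mul_zero]
  have i21 := (real_inner_comm (unitVector (circleRest x)) (circleUnit x)).symm.trans i12
  have i31 := (real_inner_comm (unitVector (apexVector x)) (circleUnit x)).symm.trans i13
  have i32 := (real_inner_comm (unitVector (apexVector x)) (unitVector (circleRest x))).symm.trans
    i23
  have i14 : ⟪circleUnit x, unitVector (normalRest f x)⟫_ℝ = 0 := by
    rw [inner_unitVector, normalRest]
    simp only [inner_sub_right, inner_smul_right, n1, i12, i13]
    ring
  have i24 : ⟪unitVector (circleRest x), unitVector (normalRest f x)⟫_ℝ = 0 := by
    rw [inner_unitVector, normalRest]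
    simp only [inner_sub_right, inner_smul_right, n2, i21, i23]
    ring
  have i34 : ⟪unitVector (apexVector x), unitVector (normalRest f x)⟫_ℝ = 0 := by
    rw [inner_unitVector, normalRest]
    simp only [inner_sub_right, inner_smul_right, n3, i31, i32]
    ring
  have i43 := (real_inner_comm (unitVector (normalRest f x)) (unitVector (apexVector x))).symm.trans
    i34
  have hone : ∀ z : E 4, ⟪z, z⟫_ℝ = 1 → ‖z‖ = 1 := fun z hz => by
    rw [real_inner_self_eq_norm_sq] at hz
    exact (pow_eq_one_iff_of_nonneg (norm_nonneg z) two_ne_zero).1 hz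
  refine ⟨orthonormal_four (hone _ ?_) (hone _ ?_) (hone _ ?_) (hone _ ?_) ?_ ?_ ?_ ?_ ?_ ?_,
    ?_, by positivity, ‖circleVector x 2‖, -⟪circleUnit x, circleVector x 4⟫_ℝ, ‖circleRest x‖,
    norm_pos_iff.2 hd, norm_pos_iff.2 hd', rfl, ?_, ?_⟩
  any_goals
    simp only [inner_add_left, inner_add_right, inner_smul_left, inner_smul_right, inner_neg_left,
      inner_neg_right, n1, n2, n3, n4, i12, i13, i14, i23, i24, i34, i43, conj_trivial]
    ring1
  · simp only [inner_add_left, inner_add_right, inner_smul_left, inner_smul_right,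
      n3, n4, i34, i43, conj_trivial]
    linear_combination hcs
  · simp only [inner_add_left, inner_add_right, inner_smul_left, inner_smul_right,
      n3, n4, i34, i43, conj_trivial]
    linear_combination hcs
  · change apexVector x = apexWeight x • (apexCos x • unitVector (apexVector x) +
        √(1 - apexCos x ^ 2) • unitVector (normalRest f x)) -
      (‖apexVector x‖ * √(1 - apexCos x ^ 2)) • (-√(1 - apexCos x ^ 2) •
        unitVector (apexVector x) + apexCos x • unitVector (normalRest f x))
    have hw : apexWeight x = apexCos x * ‖apexVector x‖ := by
      rw [apexCos, div_mul_cancel₀ _ hv'.ne']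
    nth_rw 1 [← norm_smul_unitVector hv, hw]
    match_scalars
    · linear_combination (-‖apexVector x‖) * hcs
    · ring
  · change circleVector x 2 = -‖circleVector x 2‖ • -circleUnit x
    rw [neg_smul_neg, circleUnit, norm_smul_unitVector hd]
  · change circleVector x 4 = -⟪circleUnit x, circleVector x 4⟫_ℝ • -circleUnit x -
      ‖circleRest x‖ • -unitVector (circleRest x)
    rw [neg_smul_neg, smul_neg, norm_smul_unitVector hd', circleRest]
    abel

theorem continuousAt_stereoCoord {X : Type*} [TopologicalSpace X] {N e z : X → E 4} {a : X}
    (hN : ContinuousAt N a) (he : ContinuousAt e a) (hz : ContinuousAt z a)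
    (h : ⟪N a, z a⟫_ℝ < 1) : ContinuousAt (fun y => stereoCoord (N y) (e y) (z y)) a :=
  (continuousAt_const.div (continuousAt_const.sub (hN.inner hz)) (sub_pos.2 h).ne').mul
    (he.inner hz)

theorem continuousAt_frameParam {e : Tuple → Fin 4 → E 4} {r g : Tuple → ℝ} {x : Tuple}
    (hx : x ∈ M) (h : IsTwistFrame x (e x) (r x) (g x)) (he : ContinuousAt e x)
    (hr : ContinuousAt r x) (hg : ContinuousAt g x) :
    ContinuousAt (fun q : Tuple × ℝ => frameParam q.1 (e q.1) (r q.1) (g q.1) q.2) (x, 0) := by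
  have hfst : ContinuousAt (Prod.fst : Tuple × ℝ → Tuple) (x, 0) := continuousAt_fst
  have hσ : ContinuousAt (Prod.snd : Tuple × ℝ → ℝ) (x, 0) := continuousAt_snd
  have he' : ∀ i, ContinuousAt (fun q : Tuple × ℝ => e q.1 i) (x, 0) := fun i =>
    (continuousAt_pi.1 he i).comp (f := Prod.fst) (x := (x, (0 : ℝ))) hfst
  have hr' : ContinuousAt (fun q : Tuple × ℝ => r q.1) (x, 0) :=
    hr.comp (f := Prod.fst) (x := (x, (0 : ℝ))) hfst
  have hg' : ContinuousAt (fun q : Tuple × ℝ => g q.1) (x, 0) :=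
    hg.comp (f := Prod.fst) (x := (x, (0 : ℝ))) hfst
  have hw : ContinuousAt (fun q : Tuple × ℝ => -2 * apexWeight q.1 / r q.1) (x, 0) :=
    (continuousAt_const.mul (contDiff_apexWeight.continuous.comp continuous_fst).continuousAt).div
      hr' h.r_pos.ne'
  have hc : ∀ i k, ContinuousAt
      (fun q : Tuple × ℝ => stereoCoord (e q.1 3) (e q.1 i) (q.1 (upperIndex k))) (x, 0) :=
    fun i k => continuousAt_stereoCoord (he' 3) (he' i)
      ((continuous_apply (upperIndex k)).comp continuous_fst).continuousAt
      (h.inner_pole_lt_one hx _)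
  have hden : ContinuousAt (fun q : Tuple × ℝ => 1 + q.2 ^ 2 * g q.1 ^ 2) (x, 0) :=
    continuousAt_const.add ((hσ.pow 2).mul (hg'.pow 2))
  have hne : ∀ q : Tuple × ℝ, 1 + q.2 ^ 2 * g q.1 ^ 2 ≠ 0 := fun q => by positivity
  refine .prodMk (continuousAt_pi.2 fun k => hc 0 k) <| .prodMk (continuousAt_pi.2 fun k => hc 1 k)
    <| .prodMk (continuousAt_pi.2 fun k => (hc 2 k).sub hw)
    <| .prodMk (continuousAt_pi.2 fun k => ?_) <| .prodMk (continuousAt_pi.2 fun k => ?_) hw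
  · exact (((continuousAt_const.mul hg').mul (hc 1 k)).sub
      (((continuousAt_const.mul hσ).mul (hg'.pow 2)).mul (hc 0 k))).div hden (hne _)
  · exact (((continuousAt_const.mul hg').mul (hc 0 k)).sub
      (((continuousAt_const.mul hσ).mul (hg'.pow 2)).mul (hc 1 k))).div hden (hne _)

/-- Near a non-planar prism, adapted frames can be chosen continuously. -/
theorem exists_continuousAt_frame {x : Tuple} (hx : x ∈ M) (hg : prismGram x ≠ 0) :
    ∃ (e : Tuple → Fin 4 → E 4) (r g : Tuple → ℝ), ContinuousAt e x ∧ ContinuousAt r x ∧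
      ContinuousAt g x ∧ ∀ᶠ y in 𝓝 x, y ∈ M → IsTwistFrame y (e y) (r y) (g y) := by
  obtain ⟨k, hk⟩ := exists_isPrismVector_apex hx
  have hv := hk.vector_ne_zero hx.1
  have hd := circleVector_two_ne_zero hg
  have hd' := circleRest_ne_zero hg
  -- The vector is orthogonal to the other three directions only at `x`, but it stays fixed while
  -- the prism varies. Its normal component remains nonzero nearby.
  obtain ⟨f, hf0, hf1, hf2, hf3⟩ := exists_ne_zero_orthogonal (circleUnit x)
    (unitVector (circleRest x)) (unitVector (apexVector x))
  have hf : normalRest f x = f := by simp [normalRest, hf1, hf2, hf3]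
  have c2 : ContinuousAt (fun y : Tuple => circleVector y 2) x :=
    (contDiff_circleVector 2).continuous.continuousAt
  have c4 : ContinuousAt (fun y : Tuple => circleVector y 4) x :=
    (contDiff_circleVector 4).continuous.continuousAt
  have cv : ContinuousAt apexVector x := contDiff_apexVector.continuous.continuousAt
  have cw : ContinuousAt apexWeight x := contDiff_apexWeight.continuous.continuousAt
  have cu : ContinuousAt circleUnit x := continuousAt_unitVector c2 hd
  have cr : ContinuousAt circleRest x := c4.sub ((cu.inner (𝕜 := ℝ) c4).smul cu)
  have cr' := continuousAt_unitVector cr hd'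
  have cv' := continuousAt_unitVector cv hv
  have cn : ContinuousAt (normalRest f) x :=
    ((continuousAt_const.sub ((cu.inner (𝕜 := ℝ) continuousAt_const).smul cu)).sub
      ((cr'.inner (𝕜 := ℝ) continuousAt_const).smul cr')).sub
      ((cv'.inner (𝕜 := ℝ) continuousAt_const).smul cv')
  have cn' := continuousAt_unitVector cn (hf.trans_ne hf0)
  have cc : ContinuousAt apexCos x := cw.div cv.norm (norm_ne_zero_iff.2 hv)
  have cs : ContinuousAt (fun y => √(1 - apexCos y ^ 2)) x :=
    (continuousAt_const.sub (cc.pow 2)).sqrt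
  refine ⟨twistFrame f, fun y => ‖apexVector y‖ * √(1 - apexCos y ^ 2),
    fun y => ‖circleVector y 2‖ * ‖circleRest y‖, continuousAt_pi.2 fun i => ?_, cv.norm.mul cs,
    c2.norm.mul cr.norm, ?_⟩
  · fin_cases i
    exacts [cu.neg, cr'.neg, (cs.neg.smul cv').add (cc.smul cn'), (cc.smul cv').add (cs.smul cn')]
  · filter_upwards [cn.eventually_ne (hf.trans_ne hf0),
      contDiff_prismGram.continuous.continuousAt.eventually_ne hg] with y hy hy' hyM
    exact isTwistFrame_twistFrame hyM hy' hy

/-- Small twists of prisms near a non-planar prism are stereographic trefoils, and not prisms. -/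
theorem eventually_twist {x : Tuple} (hx : x ∈ M) (hg : prismGram x ≠ 0) :
    ∀ᶠ q : Tuple × ℝ in 𝓝 (x, 0), q.1 ∈ M → 0 < q.2 →
      IsStereographicTrefoil (twist q.2 q.1) ∧ twist q.2 q.1 ∉ M := by
  obtain ⟨e, r, g, he, hr, hg, hframe⟩ := exists_continuousAt_frame hx hg
  have hx' := hframe.self_of_nhds hx
  have hparam := (continuousAt_frameParam hx hx' he hr hg).prodMk
    (continuousAt_snd : ContinuousAt (Prod.snd : Tuple × ℝ → ℝ) (x, 0))
  have hev := hparam.eventually (hx'.isTwistable hx).eventually_mem_trefoilHexagons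
  have hfst : ∀ᶠ q : Tuple × ℝ in 𝓝 (x, 0), q.1 ∈ M →
      IsTwistFrame q.1 (e q.1) (r q.1) (g q.1) :=
    (continuousAt_fst : ContinuousAt (Prod.fst : Tuple × ℝ → Tuple) (x, 0)).eventually hframe
  filter_upwards [hev, hfst] with q hq hq' hM hσ
  exact ⟨(hq' hM).isStereographicTrefoil hM (hq hσ).2, (hq' hM).twist_notMem_M hM (hq hσ).1⟩

/-! ### The isotopy -/

theorem isOpen_setOf_injective : IsOpen {x : Tuple | Function.Injective x} := by
  have : {x : Tuple | Function.Injective x} = ⋂ i, ⋂ j, {x | x i = x j → i = j} := by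
    ext x
    simp [Function.Injective]
  rw [this]
  refine isOpen_iInter_of_finite fun i => isOpen_iInter_of_finite fun j => ?_
  by_cases hij : i = j
  · simp [hij]
  · simpa [hij] using isOpen_ne_fun (continuous_apply i) (continuous_apply j)

/-- The injective tuples that are moved by a twist. -/
def twistDomain : Set Tuple := {x | Function.Injective x ∧ prismGram x ≠ 0}

theorem isOpen_twistDomain : IsOpen twistDomain :=
  isOpen_setOf_injective.inter (isOpen_ne_fun contDiff_prismGram.continuous continuous_const)

/-- The displacement of a tuple under a twist. -/
def displacement (q : ℝ × Tuple) : Tuple := twist q.1 q.2 - q.2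

theorem contDiff_displacement : ContDiff ℝ ∞ displacement := contDiff_twist.sub contDiff_snd

/-- The derivative of `x ↦ (f x, x)` for a function `f` with derivative `ℓ`. -/
def graphDeriv (ℓ : Tuple →L[ℝ] ℝ) : Tuple →L[ℝ] ℝ × Tuple :=
  (ContinuousLinearMap.inl ℝ ℝ Tuple).comp ℓ + ContinuousLinearMap.inr ℝ ℝ Tuple

theorem hasFDerivAt_displacement_graph {f : Tuple → ℝ} {ℓ : Tuple →L[ℝ] ℝ} {x : Tuple}
    (hf : HasFDerivAt f ℓ x) : HasFDerivAt (fun y => displacement (f y, y))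
      ((fderiv ℝ displacement (f x, x)).comp (graphDeriv ℓ)) x := by
  have hd : HasFDerivAt displacement (fderiv ℝ displacement (f x, x)) (f x, x) :=
    (contDiff_displacement.differentiable (by simp) _).hasFDerivAt
  have hg : HasFDerivAt (fun y => (f y, y)) (graphDeriv ℓ) x := by
    have h : graphDeriv ℓ = ℓ.prod (ContinuousLinearMap.id ℝ Tuple) := by
      refine ContinuousLinearMap.ext fun z => ?_
      simp [graphDeriv]
    rw [h]
    exact hf.prodMk (hasFDerivAt_id x)
  exact hd.comp (f := fun y => (f y, y)) x hg

theorem fderiv_displacement_zero (x : Tuple) :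
    (fderiv ℝ displacement (0, x)).comp (graphDeriv 0) = 0 := by
  have h := hasFDerivAt_displacement_graph (hasFDerivAt_const (0 : ℝ) x)
  have h0 : (fun y : Tuple => displacement (0, y)) = fun _ => 0 := by
    funext y
    simp [displacement, twist_zero]
  rw [h0] at h
  exact h.unique (hasFDerivAt_const 0 x)

theorem eventually_norm_fderiv_le (x : Tuple) :
    ∀ᶠ q : Tuple × ℝ × (Tuple →L[ℝ] ℝ) in 𝓝 (x, 0, 0),
      ‖(fderiv ℝ displacement (q.2.1, q.1)).comp (graphDeriv q.2.2)‖ ≤ 1 / 2 := by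
  have hc : Continuous fun q : Tuple × ℝ × (Tuple →L[ℝ] ℝ) =>
      ‖(fderiv ℝ displacement (q.2.1, q.1)).comp (graphDeriv q.2.2)‖ := by
    refine (Continuous.clm_comp ?_ ?_).norm
    · exact (contDiff_displacement.continuous_fderiv (by simp)).comp (by fun_prop)
    · exact (continuous_const.clm_comp (by fun_prop)).add continuous_const
  refine (hc.tendsto (x, 0, 0)).eventually_le_const ?_
  rw [fderiv_displacement_zero, norm_zero]
  norm_num

/-- Each requirement holds for all sufficiently small twists near a given tuple, locally uniformly,
so one smooth function can meet them all on `twistDomain`. -/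
theorem exists_twist_size {U : Set Tuple} (hU : ∀ x ∈ M, U ∈ 𝓝[C6] x) {δ : Tuple → ℝ}
    (hδ : ContinuousOn δ M) (hδ_pos : ∀ x ∈ M, 0 < δ x) :
    ∃ f : Tuple → ℝ, ContDiff ℝ ∞ f ∧ (∀ x ∉ twistDomain, f x = 0) ∧
      (∀ t ∈ Icc (0 : ℝ) 1, ∀ x, ‖fderiv ℝ (fun y => displacement (t * f y, y)) x‖ ≤ 1 / 2) ∧
      (∀ t ∈ Icc (0 : ℝ) 1, ∀ x ∈ M,
        twist (t * f x) x ∈ U ∧ dist (twist (t * f x) x) x < δ x) ∧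
      ∀ x ∈ M, prismGram x ≠ 0 →
        IsStereographicTrefoil (twist (f x) x) ∧ twist (f x) x ∉ M := by
  obtain ⟨f, hf, hpos, hzero, hP⟩ := exists_contDiff_of_eventually isOpen_twistDomain
    (P := fun x σ ℓ => ‖(fderiv ℝ displacement (σ, x)).comp (graphDeriv ℓ)‖ ≤ 1 / 2 ∧
      (x ∈ M → twist σ x ∈ U ∧ dist (twist σ x) x < δ x ∧
        (0 < σ → IsStereographicTrefoil (twist σ x) ∧ twist σ x ∉ M))) (by
    intro x hx
    have hfst : ContinuousAt (fun q : Tuple × ℝ × (Tuple →L[ℝ] ℝ) => q.1) (x, 0, 0) :=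
      continuousAt_fst
    by_cases hxM : x ∈ M
    · have hpair : ContinuousAt (fun q : Tuple × ℝ × (Tuple →L[ℝ] ℝ) => (q.1, q.2.1))
        (x, 0, 0) := by fun_prop
      have htw : Filter.Tendsto (fun q : Tuple × ℝ × (Tuple →L[ℝ] ℝ) => twist q.2.1 q.1)
          (𝓝 (x, 0, 0)) (𝓝 x) := by
        have h : Continuous fun q : Tuple × ℝ × (Tuple →L[ℝ] ℝ) => twist q.2.1 q.1 :=
          contDiff_twist.continuous.comp
            (g := fun q : ℝ × Tuple => twist q.1 q.2)
            (f := fun q : Tuple × ℝ × (Tuple →L[ℝ] ℝ) => (q.2.1, q.1)) (by fun_prop)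
        simpa [twist_zero] using h.tendsto (x, 0, 0)
      have hdist : ∀ᶠ q : Tuple × ℝ × (Tuple →L[ℝ] ℝ) in 𝓝 (x, 0, 0),
          dist (twist q.2.1 q.1) q.1 < δ x / 2 := by
        refine (htw.dist hfst).eventually_lt_const ?_
        simpa using hδ_pos x hxM
      have hδx : ∀ᶠ y in 𝓝 x, y ∈ M → δ x / 2 < δ y :=
        eventually_nhdsWithin_iff.1
          ((hδ x hxM).eventually_const_lt (by linarith [hδ_pos x hxM]))
      filter_upwards [eventually_norm_fderiv_le x,
        htw.eventually (eventually_nhdsWithin_iff.1 (hU x hxM)),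
        htw.eventually (isOpen_setOf_injective.mem_nhds hx.1), hdist,
        hfst.eventually hδx, hpair.eventually (eventually_twist hxM hx.2)]
        with q h1 h2 h3 h4 h5 h6 _
      refine ⟨h1, fun hq => ⟨h2 ⟨IsTwistFrame.twist_mem_S3 hq _, h3⟩, h4.trans (h5 hq), h6 hq⟩⟩
    -- Off `M` only the derivative bound must hold, since an injective tuple outside `M` has a
    -- neighbourhood disjoint from `M`.
    · have hcl : x ∉ closure M := fun h => hxM (mem_M_of_mem_closure hx.1 h)
      filter_upwards [eventually_norm_fderiv_le x,
        hfst.eventually (isClosed_closure.isOpen_compl.mem_nhds hcl)] with q h1 h2 _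
      exact ⟨h1, fun hq => absurd (subset_closure hq) h2⟩)
  have hone : (1 : ℝ) ∈ Icc (0 : ℝ) 1 := by simp
  refine ⟨f, hf, hzero, fun t ht x => ?_, fun t ht x hx => ?_, fun x hx hg => ?_⟩
  · have hfx : HasFDerivAt f (fderiv ℝ f x) x := (hf.differentiable (by simp) x).hasFDerivAt
    rw [(hasFDerivAt_displacement_graph (hfx.const_mul t)).fderiv]
    by_cases hx : x ∈ twistDomain
    · exact (hP x hx t ht).1
    -- A zero of the nonnegative function `f` is a minimum, so its derivative vanishes there.
    · have hmin : IsLocalMin f x := Filter.Eventually.of_forall fun y => by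
        rw [hzero x hx]
        by_cases hy : y ∈ twistDomain
        · exact (hpos y hy).le
        · exact (hzero y hy).ge
      rw [hzero x hx, hmin.fderiv_eq_zero, mul_zero, smul_zero, fderiv_displacement_zero, norm_zero]
      norm_num
  · by_cases hxd : x ∈ twistDomain
    · have := (hP x hxd t ht).2 hx
      exact ⟨this.1, this.2.1⟩
    · rw [hzero x hxd, mul_zero, twist_zero, dist_self]
      exact ⟨mem_of_mem_nhdsWithin hx.1 (hU x hx), hδ_pos x hx⟩
  · have hxd : x ∈ twistDomain := ⟨hx.1.2, hg⟩
    have := ((hP x hxd 1 hone).2 hx).2.2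
    rw [one_mul] at this
    exact this (hpos x hxd)

theorem smoothOn_of_contDiff {X Y : Type*} [NormedAddCommGroup X] [NormedSpace ℝ X]
    [NormedAddCommGroup Y] [NormedSpace ℝ Y] {f : X → Y} (hf : ContDiff ℝ ∞ f) (s : Set X) :
    SmoothOn f s :=
  fun x _ => ⟨univ, f, isOpen_univ, mem_univ x, hf.contDiffOn, fun _ _ => rfl⟩

/-- Twisting by a function of small derivative that vanishes where the twist could produce
coincident points is a proper smooth embedding. -/
theorem isProperSmoothEmbedding_twist {f : Tuple → ℝ} (hf : ContDiff ℝ ∞ f)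
    (hzero : ∀ x, ¬ Function.Injective x → f x = 0)
    (hd : ∀ x, ‖fderiv ℝ (fun y => displacement (f y, y)) x‖ ≤ 1 / 2) :
    IsProperSmoothEmbedding (fun x => twist (f x) x) M := by
  obtain ⟨e, he, hinv⟩ := exists_contDiff_inverse
    (contDiff_displacement.comp (hf.prodMk contDiff_id)) hd
  have he' : ∀ x, e x = twist (f x) x := fun x => by
    rw [he]
    simp [displacement]
  -- Non-injective tuples are fixed by the bijection `e`, so no injective tuple can be mapped to one
  -- of them.
  have hinj : ∀ x, Function.Injective (e x) ↔ Function.Injective x := by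
    have hfix : ∀ x, ¬ Function.Injective x → e x = x := fun x hx => by
      rw [he', hzero x hx, twist_zero]
    intro x
    constructor
    · intro h
      by_contra hx
      rw [hfix x hx] at h
      exact hx h
    · intro h
      by_contra hx
      rw [e.injective (hfix _ hx)] at hx
      exact hx h
  have hC6 : ∀ x, e x ∈ C6 ↔ x ∈ C6 := by
    intro x
    refine and_congr (forall_congr' fun i => ?_) (hinj x)
    rw [mem_sphere_zero_iff_norm, mem_sphere_zero_iff_norm, he', norm_twist]
  have heq : (fun x => twist (f x) x) = e := funext fun x => (he' x).symm
  rw [heq]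
  -- The closed set is the image of the full closure of `M`; intersecting it with `C6` removes
  -- exactly the limits with coincident points.
  refine ⟨fun x hx => (hC6 x).2 hx.1, ?_, ⟨e.symm, smoothOn_of_contDiff hinv _,
    fun x _ => e.symm_apply_apply x⟩, e '' closure M, e.isClosedMap _ isClosed_closure, ?_⟩
  · rw [← heq]
    exact smoothOn_of_contDiff (contDiff_twist.comp (hf.prodMk contDiff_id)) _
  · ext y
    constructor
    · rintro ⟨x, hx, rfl⟩
      exact ⟨⟨x, subset_closure hx, rfl⟩, (hC6 x).2 hx.1⟩
    · rintro ⟨⟨x, hx, rfl⟩, hy⟩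
      exact ⟨x, mem_M_of_mem_closure ((hC6 x).1 hy).2 hx, rfl⟩

end InscribedTrefoil

end

open InscribedTrefoil
theorem mainTheorem7 (U : Set Tuple) (hU : ∀ x ∈ M, U ∈ 𝓝[C6] x)
    (δ : Tuple → ℝ) (hδ : ContinuousOn δ M) (hδ_pos : ∀ x ∈ M, 0 < δ x) :
    ∃ (M' : Set Tuple) (F : ℝ → Tuple → Tuple),
      IsIsotopy F M ∧ F 1 '' M = M' ∧
      (∀ t ∈ Icc (0 : ℝ) 1, ∀ x ∈ M, F t x ∈ U ∧ dist (F t x) x < δ x) ∧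
      (∀ t ∈ Icc (0 : ℝ) 1, ∀ x ∈ M₀, F t x = x) ∧
      M ∩ M' = M₀ ∧
      (∀ y ∈ M' \ M₀, IsStereographicTrefoil y) ∧
      (∀ x ∈ M \ M₀, IsHalfTwist x (F 1 x)) := by
  obtain ⟨f, hf, hzero, hd, hclose, hT⟩ := exists_twist_size hU hδ hδ_pos
  have hfix : ∀ t : ℝ, ∀ x ∈ M₀, twist (t * f x) x = x := fun t x hx => by
    rw [hzero x fun h => h.2 (prismGram_eq_zero_of_mem_M₀ hx), mul_zero, twist_zero]
  refine ⟨_, fun t x => twist (t * f x) x, ⟨?_, fun t ht => ?_, fun x _ => ?_⟩, rfl, hclose,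
    fun t _ => hfix t, ?_, ?_, fun x hx => isHalfTwist_twist hx.1 _⟩
  · exact smoothOn_of_contDiff (contDiff_twist.comp
      ((contDiff_fst.mul (hf.comp contDiff_snd)).prodMk contDiff_snd)) _
  · refine isProperSmoothEmbedding_twist (contDiff_const.mul hf) (fun x hx => ?_) (hd t ht)
    rw [hzero x fun h => hx h.1, mul_zero]
  · simp [twist_zero]
  · ext y
    constructor
    · rintro ⟨hy, x, hx, rfl⟩
      by_cases hg : prismGram x = 0
      · have hx₀ := mem_M₀_of_prismGram_eq_zero hx hg
        simpa only [hfix 1 x hx₀] using hx₀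
      · simp only [one_mul] at hy
        exact absurd hy (hT x hx hg).2
    · exact fun hy => ⟨hy.1, y, hy.1, hfix 1 y hy⟩
  · rintro _ ⟨⟨x, hx, rfl⟩, hy⟩
    have hg : prismGram x ≠ 0 := fun hg => by
      have hx₀ := mem_M₀_of_prismGram_eq_zero hx hg
      simp only [hfix 1 x hx₀] at hy
      exact hy hx₀
    simpa only [one_mul] using (hT x hx hg).1
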